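/- Let $N\ge 2$ and let $F_N$ be the free group of rank $N$, with boundary $\partial F_N$ (infinite reduced words) and double boundary $\partial^2F_N=\{(x,y)\in\partial F_N\times\partial F_N: x\ne y\}$. A geodesic current on $F_N$ is a non-negative Radon measure on $\partial^2F_N$ that is invariant under $F_N$ and under the flip $(x,y)\mapsto(y,x)$. Let $\Gamma$ be a finite connected graph without valence-one vertices, with a marking $\alpha$, i.e. (the homotopy class of) a homotopy equivalence from the $N$-petal rose to $\Gamma$, identifying $F_N$ with $\pi_1(\Gamma)$. Let $E\Gamma$ be the set of oriented edges and $\mathcal P\Gamma$ the set of non-trivial finite reduced edge paths of $\Gamma$. For $v\in\mathcal P\Gamma$ and a lift $\gamma$ of $v$ to the universal cover $\tilde\Gamma$, let $Cyl_\alpha(\gamma)\subset\partial^2F_N$ be the set of all $(x,y)$ such that the geodesic of $\tilde\Gamma$ from $\tilde\alpha(x)$ to $\tilde\alpha(y)$ contains $\gamma$ (traversed in its direction), where $\tilde\alpha:\partial F_N\to\partial\tilde\Gamma$ is induced by $\alpha$; for a geodesic current $\mu$ put $\langle v,\mu\rangle_\alpha=\mu(Cyl_\alpha(\gamma))$, which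 does not depend on the lift. For an edge path $w$ let $\ell(w)$ be its number of edges, $(v,w)$ the number of positions of $w$ from which $v$ can be read in forward direction, and $\langle v,w\rangle=(v,w)+(v^{-1},w)$. Let $\varphi\in Out(F_N)$, and let $f:\Gamma\to\Gamma$ be a train-track map (a graph map, sending vertices to vertices and edges to non-trivial edge paths, such that $f^k(e)$ has no backtracking for all $k\ge1$ and $e\in E\Gamma$) that determines $\varphi$ through $\alpha$, and whose transition matrix $M(f)$, which counts the occurrences of $e_i^{\pm1}$ in $f(e_j)$, has only positive entries. Then there are numbers $a_v$ $(v\in\mathcal P\Gamma)$ such that $$\lim_{n\to\infty}\frac{\langle v,f^n(e)\rangle}{\ell(f^n(e))}=a_v\qquad\text{for all } v\in\mathcal P\Gamma \text{ and all } e\in E\Gamma .$$ They satisfy the switch conditions: for all $v\in\mathcal P\Gamma$, $0\le a_v<\infty$, $a_{v^{-1}}=a_v$ and $$\sum_{e\in E\Gamma,\ ve\in\mathcal P\Gamma}a_{ve}=a_v=\sum_{e\in E\Gamma,\ ev\in\mathcal P\Gamma}a_{ev}.$$ There is a unique geodesic current $\mu_+=\mu_{+,\Gamma}(\varphi)$ on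 $F_N$ with $\langle v,\mu_+\rangle_\alpha=a_v$ for all $v\in\mathcal P\Gamma$ (the stable current of $\varphi$). Likewise, if $f':\Gamma'\to\Gamma'$ is a train-track map with positive transition matrix on a graph $\Gamma'$ with marking $\alpha'$, of the same kind, that determines $\varphi^{-1}$, then the limiting frequencies of $f'$ exist, are independent of the edge and satisfy the switch conditions, and there is a unique geodesic current $\mu_-=\mu_{+,\Gamma'}(\varphi^{-1})$ whose values $\langle v,\mu_-\rangle_{\alpha'}$, $v\in\mathcal P\Gamma'$, are the limiting frequencies of $f'$ (the unstable current of $\varphi$). -/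

import Mathlib

open MeasureTheory Filter Topology

namespace TrainTrack

/-! ### The boundary of a free group

Letters of the free group on `A` are pairs `(a, true)` (the generator `a`) and `(a, false)`
(its inverse), as in Mathlib's `FreeGroup A`. -/

/-- Formal inverse of a letter. -/
def letterInv {A : Type*} (d : A × Bool) : A × Bool := (d.1, !d.2)

theorem letterInv_letterInv {A : Type*} (d : A × Bool) : letterInv (letterInv d) = d := by
  simp [letterInv]

/-- The boundary `∂F(A)` of the free group on `A`: infinite reduced words. -/
def Boundary (A : Type*) : Type _ :=
  {x : ℕ → A × Bool // ∀ n, x (n + 1) ≠ letterInv (x n)}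

namespace Boundary

variable {A : Type*}

/-- The `n`-th letter of a boundary point. -/
def letter (x : Boundary A) (n : ℕ) : A × Bool := x.1 n

/-- The boundary carries the topology of letterwise convergence (the product topology, the set
of letters being discrete). -/
instance : TopologicalSpace (Boundary A) :=
  TopologicalSpace.induced (fun x : Boundary A => x.letter)
    (@Pi.topologicalSpace ℕ (fun _ => A × Bool) (fun _ => ⊥))

/-- The initial subword of length `n`. -/
def take (x : Boundary A) (n : ℕ) : List (A × Bool) := List.ofFn fun i : Fin n => x.letter i

/-- Erase the first letter. -/
def tail (x : Boundary A) : Boundary A := ⟨fun n => x.1 (n + 1), fun n => x.2 (n + 1)⟩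

/-- Put the letter `d` in front of a word that does not begin with `d⁻¹`. -/
def cons (d : A × Bool) (x : Boundary A) (h : x.letter 0 ≠ letterInv d) : Boundary A :=
  ⟨fun n => Nat.casesOn n d x.1, fun n => by cases n with
    | zero => exact h
    | succ n => exact x.2 n⟩

variable [DecidableEq A]

/-- Left multiplication of an infinite reduced word by a letter, followed by reduction. -/
def letterMul (d : A × Bool) (x : Boundary A) : Boundary A :=
  if h : x.letter 0 = letterInv d then x.tail else x.cons d h

theorem letterMul_letterInv_letterMul (d : A × Bool) (x : Boundary A) :
    letterMul (letterInv d) (letterMul d x) = x := by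
  by_cases h : x.letter 0 = letterInv d
  · have h1 : letterMul d x = x.tail := dif_pos h
    have h2 : x.tail.letter 0 ≠ letterInv (letterInv d) := by
      rw [← h]; exact x.2 0
    rw [h1, letterMul, dif_neg h2]
    apply Subtype.ext
    funext n
    cases n with
    | zero => exact h.symm
    | succ n => rfl
  · have h1 : letterMul d x = x.cons d h := dif_neg h
    have h2 : (x.cons d h).letter 0 = letterInv (letterInv d) := by
      rw [letterInv_letterInv]; rfl
    rw [h1, letterMul, dif_pos h2]
    rfl

/-- Left multiplication by a letter as a permutation of the boundary. -/
def letterPerm (d : A × Bool) : Equiv.Perm (Boundary A) where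
  toFun := letterMul d
  invFun := letterMul (letterInv d)
  left_inv := letterMul_letterInv_letterMul d
  right_inv x := by
    have h := letterMul_letterInv_letterMul (letterInv d) x
    rwa [letterInv_letterInv] at h

/-- The action of the free group on its boundary: left multiplication and reduction. -/
instance : MulAction (FreeGroup A) (Boundary A) :=
  MulAction.compHom (Boundary A) (FreeGroup.lift fun a : A => letterPerm (a, true))

end Boundary

/-! ### Geodesic currents -/

/-- The double boundary: pairs of distinct boundary points. -/
def DoubleBoundary (A : Type*) : Type _ := {z : Boundary A × Boundary A // z.1 ≠ z.2}

namespace DoubleBoundary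

variable {A : Type*}

instance : TopologicalSpace (DoubleBoundary A) :=
  inferInstanceAs (TopologicalSpace {z : Boundary A × Boundary A // z.1 ≠ z.2})

instance : MeasurableSpace (DoubleBoundary A) := borel _

instance : BorelSpace (DoubleBoundary A) := ⟨rfl⟩

/-- First endpoint. -/
def fst (z : DoubleBoundary A) : Boundary A := z.1.1

/-- Second endpoint. -/
def snd (z : DoubleBoundary A) : Boundary A := z.1.2

/-- The flip map `(x, y) ↦ (y, x)`. -/
def flip (z : DoubleBoundary A) : DoubleBoundary A := ⟨(z.snd, z.fst), fun h => z.2 h.symm⟩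

/-- The diagonal action of the free group. -/
instance [DecidableEq A] : MulAction (FreeGroup A) (DoubleBoundary A) where
  smul g z := ⟨(g • z.fst, g • z.snd), fun h => z.2 (MulAction.injective g h)⟩
  one_smul z := Subtype.ext (Prod.ext (one_smul _ z.fst) (one_smul _ z.snd))
  mul_smul g h z := Subtype.ext (Prod.ext (mul_smul g h z.fst) (mul_smul g h z.snd))

end DoubleBoundary

/-- A geodesic current on the free group `F(A)`: a (non-negative) Radon measure on the double
boundary, invariant under the group and under the flip map. -/
structure IsGeodesicCurrent {A : Type*} [DecidableEq A] (μ : Measure (DoubleBoundary A)) :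
    Prop where
  regular : μ.Regular
  smul_invariant : SMulInvariantMeasure (FreeGroup A) (DoubleBoundary A) μ
  flip_invariant : MeasurePreserving (DoubleBoundary.flip (A := A)) μ μ

/-! ### Graphs, edge paths, fundamental group -/

/-- A graph with vertex set `V` and set `E` of positively oriented edges. The oriented edges are
the pairs `(e, true)` (the edge `e`) and `(e, false)` (the edge `e⁻¹`). -/
structure EGraph (V E : Type*) where
  /-- initial vertex of a positive edge -/
  init : E → V
  /-- terminal vertex of a positive edge -/
  term : E → V

namespace EGraph

variable {V E : Type*} (Γ : EGraph V E)

/-- Initial vertex of an oriented edge. -/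
def o (d : E × Bool) : V := if d.2 then Γ.init d.1 else Γ.term d.1

/-- Terminal vertex of an oriented edge. -/
def t (d : E × Bool) : V := if d.2 then Γ.term d.1 else Γ.init d.1

/-- `Γ.IsPath p w q`: the list `w` of oriented edges is an edge path from `p` to `q`
(the empty list being the trivial path at a vertex). -/
def IsPath : V → List (E × Bool) → V → Prop
  | p, [], q => p = q
  | p, d :: w, q => Γ.o d = p ∧ IsPath (Γ.t d) w q

/-- The set `𝒫Γ` of nontrivial finite reduced edge paths. -/
def reducedPaths : Set (List (E × Bool)) :=
  {v | v ≠ [] ∧ FreeGroup.IsReduced v ∧ ∃ p q, Γ.IsPath p v q}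

/-- Connected, and no vertex has valence one (the valence of `x` is the number of oriented edges
starting at `x`). -/
structure IsCore : Prop where
  connected : ∀ p q, ∃ w, Γ.IsPath p w q
  valence_ne_one : ∀ x, {d : E × Bool | Γ.o d = x}.ncard ≠ 1

variable {Γ}

theorem IsPath.append {p q r : V} {w w' : List (E × Bool)} (h : Γ.IsPath p w q)
    (h' : Γ.IsPath q w' r) : Γ.IsPath p (w ++ w') r := by
  induction w generalizing p with
  | nil => cases h; exact h'
  | cons d w ih => exact ⟨h.1, ih h.2⟩

theorem IsPath.invRev {p q : V} {w : List (E × Bool)} (h : Γ.IsPath p w q) :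
    Γ.IsPath q (FreeGroup.invRev w) p := by
  induction w generalizing p with
  | nil => exact Eq.symm h
  | cons d w ih =>
    rw [FreeGroup.invRev_cons]
    refine (ih h.2).append ?_
    obtain ⟨e, b⟩ := d
    obtain ⟨h1, -⟩ := h
    cases b <;> exact ⟨rfl, h1⟩

variable (Γ)

/-- The fundamental group `π₁(Γ, p)`. Two edge paths with the same endpoints are homotopic
relative to the endpoints iff they agree after cancellation of subpaths `e e⁻¹`, that is, iff they
define the same element of the free group on the edges; so the homotopy classes of edge loops
at `p` form a subgroup of that free group. -/
def pi1 (p : V) : Subgroup (FreeGroup E) where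
  carrier := {g | ∃ w, Γ.IsPath p w p ∧ FreeGroup.mk w = g}
  one_mem' := ⟨[], rfl, rfl⟩
  mul_mem' := by
    rintro _ _ ⟨w, hw, rfl⟩ ⟨w', hw', rfl⟩
    exact ⟨w ++ w', hw.append hw', FreeGroup.mul_mk.symm⟩
  inv_mem' := by
    rintro _ ⟨w, hw, rfl⟩
    exact ⟨FreeGroup.invRev w, hw.invRev, FreeGroup.inv_mk.symm⟩

end EGraph

/-! ### Markings and cylinder sets -/

/-- A marking of the graph `Γ` by the free group `F_N`, given by the isomorphism that a homotopy
equivalence from the rose induces on fundamental groups. -/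
structure Marking (N : ℕ) {V E : Type*} (Γ : EGraph V E) where
  /-- the base vertex -/
  base : V
  /-- the induced isomorphism of fundamental groups -/
  iso : FreeGroup (Fin N) ≃* Γ.pi1 base

namespace Marking

variable {N : ℕ} {V E : Type*} [DecidableEq E] {Γ : EGraph V E} (α : Marking N Γ)

/-- The induced map `∂F_N → ∂Γ̃`, as a relation. A point of `∂Γ̃` is represented by the image in
`Γ` of the ray towards it from the base vertex of the universal cover, an infinite reduced word in
the oriented edges. The image of `x` is the limit of the vertices `α(x₀⋯xₙ₋₁)` of `Γ̃`. -/
def BoundaryMap (x : Boundary (Fin N)) (ξ : Boundary E) : Prop :=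
  ∀ k, ∀ᶠ n in atTop,
    ξ.take k <+: (α.iso (FreeGroup.mk (x.take n)) : FreeGroup E).toWord

/-- Vertices of the universal cover `Γ̃` above the vertex `q` of `Γ`: homotopy classes of edge
paths from the base vertex to `q`. -/
def vertexLifts (q : V) : Set (FreeGroup E) :=
  {h | ∃ w, Γ.IsPath α.base w q ∧ FreeGroup.mk w = h}

/-- The cylinder set `Cyl_α(γ)`, where `γ` is the lift to `Γ̃` of the edge path `v` that begins
at the vertex `h` of `Γ̃`. For boundary points `ξ`, `η` of `Γ̃`, the rays from `h` to `ξ` and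
to `η` read `h⁻¹ξ` and `h⁻¹η`. The geodesic from `ξ` to `η` contains `γ` iff `h` is on that
geodesic (the two rays have different initial edges) and the ray from `h` to `η` begins with
`γ`. -/
def cylinder (h : FreeGroup E) (v : List (E × Bool)) : Set (DoubleBoundary (Fin N)) :=
  {z | ∃ ξ η : Boundary E, α.BoundaryMap z.fst ξ ∧ α.BoundaryMap z.snd η ∧
    (h⁻¹ • ξ).letter 0 ≠ (h⁻¹ • η).letter 0 ∧ (h⁻¹ • η).take v.length = v}

/-- `⟨v, μ⟩_α = a v` for all reduced edge paths `v`: the set `Cyl_α(γ)` has measure `a v` for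
every lift `γ` of `v`. -/
def HasOccurrences (μ : Measure (DoubleBoundary (Fin N))) (a : List (E × Bool) → ℝ) : Prop :=
  ∀ v ∈ Γ.reducedPaths, ∀ p q, Γ.IsPath p v q → ∀ h ∈ α.vertexLifts p,
    μ (α.cylinder h v) = ENNReal.ofReal (a v)

end Marking

/-! ### Graph maps and train tracks -/

/-- A graph map `Γ → Γ`: vertices go to vertices and edges to edge paths. -/
structure GraphMap {V E : Type*} (Γ : EGraph V E) where
  /-- action on vertices -/
  onV : V → V
  /-- the image path of a positive edge -/
  onE : E → List (E × Bool)
  isPath : ∀ e, Γ.IsPath (onV (Γ.init e)) (onE e) (onV (Γ.term e))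

namespace GraphMap

variable {V E : Type*} {Γ : EGraph V E} (f : GraphMap Γ)

/-- Image of an oriented edge; `f(e⁻¹) = f(e)⁻¹`. -/
def onEdge (d : E × Bool) : List (E × Bool) :=
  if d.2 then f.onE d.1 else FreeGroup.invRev (f.onE d.1)

/-- Image of an edge path (without cancellation). -/
def onPath (w : List (E × Bool)) : List (E × Bool) := w.flatMap f.onEdge

/-- The edge path `fⁿ(e)`. -/
def iter (n : ℕ) (e : E × Bool) : List (E × Bool) := f.onPath^[n] [e]

/-- Action of `f` on homotopy classes of edge paths. -/
def onHomotopy : FreeGroup E →* FreeGroup E := FreeGroup.lift fun e => FreeGroup.mk (f.onE e)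

/-- `f` is a train-track map: no edge is mapped to a vertex, and there is no backtracking in
`fᵏ(e)` for `k ≥ 1`. -/
structure IsTrainTrack : Prop where
  ne_nil : ∀ e, f.onE e ≠ []
  reduced : ∀ k, 1 ≤ k → ∀ e, FreeGroup.IsReduced (f.iter k e)

variable [DecidableEq E]

/-- The transition matrix: the `(i, j)` entry is the number of occurrences of `e_i` and `e_i⁻¹`
in `f(e_j)`. -/
def transitionMatrix : Matrix E E ℕ :=
  Matrix.of fun i j => (f.onE j).count (i, true) + (f.onE j).count (i, false)

end GraphMap

instance conj_range_normal (G : Type*) [Group G] :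
    (MulAut.conj : G →* MulAut G).range.Normal where
  conj_mem := by
    rintro _ ⟨g, rfl⟩ Φ
    refine ⟨Φ g, ?_⟩
    ext x
    simp [MulAut.conj_apply]

/-- The group of outer automorphisms. -/
abbrev Out (G : Type*) [Group G] : Type _ := MulAut G ⧸ (MulAut.conj : G →* MulAut G).range

/-- The graph map `f` determines the outer automorphism `φ`: for some automorphism `Φ` in the
class `φ` and some path `u` from the base vertex `p` to `f(p)`, the marking conjugates `Φ` to
`g ↦ u f(g) u⁻¹` on `π₁(Γ, p)`. (Then `f` is a homotopy equivalence.) -/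
def Determines {N : ℕ} {V E : Type*} {Γ : EGraph V E} (α : Marking N Γ) (f : GraphMap Γ)
    (φ : Out (FreeGroup (Fin N))) : Prop :=
  ∃ Φ : MulAut (FreeGroup (Fin N)), (Φ : Out (FreeGroup (Fin N))) = φ ∧
    ∃ u, Γ.IsPath α.base u (f.onV α.base) ∧
      ∀ g, (α.iso (Φ g) : FreeGroup E) =
        FreeGroup.mk u * f.onHomotopy (α.iso g : FreeGroup E) * (FreeGroup.mk u)⁻¹

/-- `f` is a train-track representative of `φ`, with respect to the marking `α` of the (finite)
graph `Γ`, whose transition matrix is positive. -/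
structure IsPositiveTrainTrackRep {N : ℕ} {V E : Type*} [DecidableEq E] {Γ : EGraph V E}
    (α : Marking N Γ) (f : GraphMap Γ) (φ : Out (FreeGroup (Fin N))) : Prop where
  core : Γ.IsCore
  determines : Determines α f φ
  trainTrack : f.IsTrainTrack
  matrix_pos : ∀ i j, 0 < f.transitionMatrix i j

/-! ### Frequencies -/

section Frequencies

variable {V E : Type*} [DecidableEq E]

/-- `(v, w)`: the number of positions of `w` from which the nontrivial path `v` can be read in
forward direction. -/
def occ (v w : List (E × Bool)) : ℕ := w.tails.countP fun u => v.isPrefixOf u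

/-- `⟨v, w⟩ = (v, w) + (v⁻¹, w)`. -/
def symOcc (v w : List (E × Bool)) : ℕ := occ v w + occ (FreeGroup.invRev v) w

/-- For every reduced edge path `v`, the frequency `⟨v, fⁿ(e)⟩ / ℓ(fⁿ(e))` converges to `a v`,
for all oriented edges `e`. -/
def HasLimitingFrequencies {Γ : EGraph V E} (f : GraphMap Γ) (a : List (E × Bool) → ℝ) : Prop :=
  ∀ v ∈ Γ.reducedPaths, ∀ e : E × Bool,
    Tendsto (fun n => (symOcc v (f.iter n e) : ℝ) / ((f.iter n e).length : ℝ)) atTop (𝓝 (a v))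

/-- The switch conditions for a family of numbers indexed by the reduced edge paths: they are
non-negative, invariant under inversion of paths, and additive under the extensions of a path by
one edge at its end, and at its beginning. -/
structure SwitchConditions (Γ : EGraph V E) (a : List (E × Bool) → ℝ) : Prop where
  nonneg : ∀ v ∈ Γ.reducedPaths, 0 ≤ a v
  inv : ∀ v ∈ Γ.reducedPaths, a (FreeGroup.invRev v) = a v
  right : ∀ v ∈ Γ.reducedPaths, ∑ᶠ e ∈ {e | v ++ [e] ∈ Γ.reducedPaths}, a (v ++ [e]) = a v
  left : ∀ v ∈ Γ.reducedPaths, ∑ᶠ e ∈ {e | e :: v ∈ Γ.reducedPaths}, a (e :: v) = a v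

end Frequencies

end TrainTrack

/-! ### Limits of ratios under a positive matrix -/

namespace TrainTrack

section WeightedAverages

variable {ι : Type*} [Fintype ι]

/-! Frequencies. The word f^(n+1)(e) is the concatenation of the words f^n(d), with d running
through the edges of f(e). Hence the vector of lengths of the f^n(e) evolves exactly by the
transition matrix M, and the vector of occurrence counts of v does so up to a bounded error, caused
by occurrences across the junctions. The ratio of count and length at time n+1 is therefore a
weighted average of the ratios at time n, up to an error C/length. Positivity of M bounds the
weights below by a constant, and since F_N is not abelian there are at least two edges, so lengths
grow at least like 2^n. Averaging with weights bounded below contracts the oscillation, so all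
ratios converge to one limit (`exists_limit_ratio`). The switch conditions hold because every
occurrence of v continues by one letter except one at the very end of the word, and by the
train-track property only reduced continuations occur.

Currents. The marking induces an injective equivariant map from the boundary of F_N to the rays of
the universal cover; it is onto because Γ is finite and connected. A pair of boundary points is
sorted by the two vertices where its geodesic crosses the sphere of radius n about the base vertex.
These compact open atoms are cylinders of the segments joining the two vertices. Going from n to n+1
lengthens the segment by an edge at each end, so the switch conditions say exactly that the
prescribed masses are additive (`Marking.consistent_mass`). They define a content and hence a Radon
measure (`AtomSystem.Consistent.exists_regular_measure`).

The atoms only see cylinders between vertices at equal distance from the base; the switch conditions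
and flip invariance carry the values to all cylinders (`Marking.cylinderEq_of_norm_eq`). Since atoms
generate the Borel sets, cylinder values determine the measure. This gives uniqueness, and also
invariance under F_N, because a translate has the same cylinder values. -/

/-- The index where `r` is minimal has weight at least δ in the `p`-average, which pulls that
average down to at most max − δ(max − min), while the `q`-average is at least min. -/
theorem weighted_sum_sub_le {δ D : ℝ} {r p q : ι → ℝ}
    (h0 : 0 ≤ δ) (hp : ∀ i, δ ≤ p i) (hp1 : ∑ i, p i = 1) (hq : ∀ i, 0 ≤ q i) (hq1 : ∑ i, q i = 1)
    (hδ : δ ≤ 1) (hr : ∀ i j, r i - r j ≤ D) :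
    ∑ i, p i * r i - ∑ i, q i * r i ≤ (1 - δ) * D := by
  classical
  have hne : Nonempty ι := by
    by_contra h
    rw [not_nonempty_iff] at h
    simp at hp1
  obtain ⟨M, hM⟩ := Finite.exists_max r
  obtain ⟨m, hm⟩ := Finite.exists_min r
  have h1 : ∑ i, p i * r i ≤ r M - δ * (r M - r m) := by
    have h : ∑ i, p i * (r M - r i) ≥ p m * (r M - r m) :=
      Finset.single_le_sum (f := fun i => p i * (r M - r i))
        (fun i _ => ?_) (Finset.mem_univ m)
    · have h2 : ∑ i, p i * (r M - r i) = r M - ∑ i, p i * r i := by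
        simp [mul_sub, Finset.sum_sub_distrib, ← Finset.sum_mul, hp1]
      have h3 := mul_le_mul_of_nonneg_right (hp m) (sub_nonneg.2 (hM m))
      linarith
    · exact mul_nonneg (h0.trans (hp i)) (sub_nonneg.2 (hM i))
  have h2 : r m ≤ ∑ i, q i * r i := by
    calc r m = ∑ i, q i * r m := by rw [← Finset.sum_mul, hq1, one_mul]
      _ ≤ _ := Finset.sum_le_sum fun i _ => mul_le_mul_of_nonneg_left (hm i) (hq i)
  have h3 : (1 - δ) * (r M - r m) ≤ (1 - δ) * D :=
    mul_le_mul_of_nonneg_left (hr M m) (by linarith)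
  linarith

/-- Averaging shrinks the oscillation of `r n` over the indices by the factor 1 − δ, and the errors
are summable. So the oscillation decays geometrically, and so do the increments in time, which stay
within it up to the error. -/
theorem cauchy_of_contracting_osc {δ C : ℝ} (h0 : 0 < δ) (hδ : δ ≤ 1) {r : ℕ → ι → ℝ}
    {p : ℕ → ι → ι → ℝ} (hp : ∀ n e i, δ ≤ p n e i) (hp1 : ∀ n e, ∑ i, p n e i = 1)
    (hr : ∀ n e, |r (n + 1) e - ∑ i, p n e i * r n i| ≤ C * (1 / 2) ^ n) :
    ∃ a, ∀ e, Tendsto (fun n => r n e) atTop (𝓝 a) := by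
  cases isEmpty_or_nonempty ι with
  | inl h => exact ⟨0, fun e => h.elim e⟩
  | inr hne =>
  obtain ⟨e₀⟩ := id hne
  have hC : 0 ≤ C := by simpa using (abs_nonneg _).trans (hr 0 e₀)
  -- Half of the gain δ is kept as contraction and the other half absorbs the errors; `ρ ≥ 1/2`
  -- makes ρ^n dominate 2^(-n).
  set ρ : ℝ := 1 - δ / 2 with hρ
  have hρ2 : 1 / 2 ≤ ρ := by linarith
  have hρ1 : ρ < 1 := by linarith
  have hρ0 : 0 < ρ := by linarith
  obtain ⟨B, hB0, hB⟩ : ∃ B, 0 ≤ B ∧ ∀ i j, r 0 i - r 0 j ≤ B := by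
    obtain ⟨M, hM⟩ := Finite.exists_max (r 0)
    obtain ⟨m, hm⟩ := Finite.exists_min (r 0)
    exact ⟨r 0 M - r 0 m, sub_nonneg.2 (hM m), fun i j => sub_le_sub (hM i) (hm j)⟩
  -- `A` bounds the initial oscillation and satisfies 2C ≤ (δ/2)A, so the two errors of one step fit
  -- into the reserved half.
  set A : ℝ := max B (4 * C / δ) with hA
  have hA0 : 0 ≤ A := hB0.trans (le_max_left _ _)
  have hAC : 2 * C ≤ δ / 2 * A := by
    have : 4 * C / δ ≤ A := le_max_right _ _
    rw [div_le_iff₀ h0] at this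
    linarith
  have hpow : ∀ n : ℕ, (1 / 2 : ℝ) ^ n ≤ ρ ^ n := fun n => by gcongr
  have osc : ∀ n i j, r n i - r n j ≤ A * ρ ^ n := by
    intro n
    induction n with
    | zero => intro i j; rw [pow_zero, mul_one]; exact (hB i j).trans (le_max_left _ _)
    | succ n ih =>
      intro i j
      have h1 := weighted_sum_sub_le h0.le (hp n i) (hp1 n i)
        (fun k => h0.le.trans (hp n j k)) (hp1 n j) hδ ih
      have h2 := (abs_le.1 (hr n i)).2
      have h3 := (abs_le.1 (hr n j)).1
      have h4 : C * (1 / 2) ^ n ≤ C * ρ ^ n := mul_le_mul_of_nonneg_left (hpow n) hC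
      have h5 := mul_le_mul_of_nonneg_right hAC (pow_nonneg hρ0.le n)
      calc r (n + 1) i - r (n + 1) j ≤ (1 - δ) * (A * ρ ^ n) + 2 * C * ρ ^ n := by linarith
        _ ≤ A * ρ ^ (n + 1) := by rw [pow_succ, hρ]; linarith
  -- Letting `e` and `i` differ gives at once the Cauchy property and the independence of the limit
  -- from the index.
  have step : ∀ n e i, |r (n + 1) e - r n i| ≤ (A + C) * ρ ^ n := by
    intro n e i
    have h1 : |∑ k, p n e k * r n k - r n i| ≤ A * ρ ^ n := by
      have : ∑ k, p n e k * r n k - r n i = ∑ k, p n e k * (r n k - r n i) := by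
        simp [mul_sub, Finset.sum_sub_distrib, ← Finset.sum_mul, hp1]
      rw [this]
      refine (Finset.abs_sum_le_sum_abs _ _).trans ?_
      calc ∑ k, |p n e k * (r n k - r n i)| ≤ ∑ k, p n e k * (A * ρ ^ n) := by
            refine Finset.sum_le_sum fun k _ => ?_
            rw [abs_mul, abs_of_nonneg (h0.le.trans (hp n e k))]
            refine mul_le_mul_of_nonneg_left ?_ (h0.le.trans (hp n e k))
            exact abs_le.2 ⟨by linarith [osc n i k], osc n k i⟩
        _ = _ := by rw [← Finset.sum_mul, hp1, one_mul]
    have h4 : C * (1 / 2) ^ n ≤ C * ρ ^ n := mul_le_mul_of_nonneg_left (hpow n) hC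
    calc |r (n + 1) e - r n i|
        ≤ |r (n + 1) e - ∑ k, p n e k * r n k| + |∑ k, p n e k * r n k - r n i| :=
          abs_sub_le _ _ _
      _ ≤ _ := by linarith [hr n e]
  have hc : CauchySeq fun n => r n e₀ := by
    refine cauchySeq_of_le_geometric ρ (A + C) hρ1 fun n => ?_
    rw [dist_comm, Real.dist_eq]
    exact step n e₀ e₀
  obtain ⟨a, ha⟩ := cauchySeq_tendsto_of_complete hc
  refine ⟨a, fun e => ?_⟩
  rw [← tendsto_add_atTop_iff_nat 1]
  have h0' : Tendsto (fun n => r (n + 1) e - r n e₀) atTop (𝓝 0) := by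
    refine squeeze_zero_norm (fun n => step n e e₀) ?_
    simpa using (tendsto_pow_atTop_nhds_zero_of_lt_one hρ0.le hρ1).const_mul (A + C)
  simpa using h0'.add ha

/-- The ratio at time n+1 is the average of the ratios at time n with weights `M i e * L n i / L (n
+ 1) e`. These are bounded below because after one step all entries of `L` are comparable, the
coefficients of `M` lying between 1 and `K`. The error in `O` becomes geometric on division by `L`,
which at least doubles as there are two indices. -/
theorem exists_limit_ratio [Nontrivial ι] {M : ι → ι → ℕ} (hM : ∀ i j, 0 < M i j)
    {L O : ℕ → ι → ℝ} {C : ℝ} (hL0 : ∀ e, L 0 e = 1)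
    (hL : ∀ n e, L (n + 1) e = ∑ i, M i e * L n i)
    (hO : ∀ n e, |O (n + 1) e - ∑ i, M i e * O n i| ≤ C) :
    ∃ a, ∀ e, Tendsto (fun n => O n e / L n e) atTop (𝓝 a) := by
  obtain ⟨e₀⟩ := (inferInstance : Nonempty ι)
  have hC : 0 ≤ C := (abs_nonneg _).trans (hO 0 e₀)
  have hM1 : ∀ i j, (1 : ℝ) ≤ M i j := fun i j => by exact_mod_cast hM i j
  have hLpow : ∀ n e, (2 : ℝ) ^ n ≤ L n e := by
    intro n
    induction n with
    | zero => intro e; simp [hL0]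
    | succ n ih =>
      intro e
      rw [hL]
      have h2 : (2 : ℝ) ≤ Fintype.card ι := by
        exact_mod_cast (Fintype.one_lt_card : 1 < Fintype.card ι)
      calc (2 : ℝ) ^ (n + 1) ≤ ∑ i : ι, (2 : ℝ) ^ n := by
            rw [Finset.sum_const, Finset.card_univ, nsmul_eq_mul, pow_succ, mul_comm]
            gcongr
        _ ≤ _ := Finset.sum_le_sum fun i _ => by
            nlinarith [ih i, hM1 i e, pow_pos (two_pos (α := ℝ)) n]
  have hLpos : ∀ n e, 0 < L n e := fun n e => (by positivity : (0 : ℝ) < 2 ^ n).trans_le (hLpow n e)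
  obtain ⟨K, hK1, hK⟩ : ∃ K : ℝ, 1 ≤ K ∧ ∀ i j, (M i j : ℝ) ≤ K := by
    obtain ⟨x, hx⟩ := Finite.exists_max fun x : ι × ι => (M x.1 x.2 : ℝ)
    exact ⟨M x.1 x.2, hM1 _ _, fun i j => hx (i, j)⟩
  have hK0 : 0 < K := by linarith
  have hcomp : ∀ n e d, L n e ≤ K * L n d := by
    intro n e d
    cases n with
    | zero => simpa [hL0] using hK1
    | succ n =>
      rw [hL, hL, Finset.mul_sum]
      refine Finset.sum_le_sum fun i _ => ?_
      rw [← mul_assoc]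
      refine mul_le_mul_of_nonneg_right ?_ (hLpos n i).le
      calc (M i e : ℝ) ≤ K := hK i e
        _ ≤ K * M i d := le_mul_of_one_le_right hK0.le (hM1 i d)
  set q : ℝ := (Fintype.card ι : ℝ) with hq
  have hq1 : 1 ≤ q := by rw [hq]; exact_mod_cast Fintype.card_pos
  have hLle : ∀ n e d, L (n + 1) e ≤ K * (K * q) * L n d := by
    intro n e d
    rw [hL]
    calc ∑ i, (M i e : ℝ) * L n i ≤ ∑ i : ι, K * (K * L n d) :=
          Finset.sum_le_sum fun i _ => mul_le_mul (hK i e) (hcomp n i d) (hLpos n i).le hK0.le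
      _ = _ := by rw [Finset.sum_const, Finset.card_univ, nsmul_eq_mul]; ring
  have hKq : 1 ≤ K * (K * q) := one_le_mul_of_one_le_of_one_le hK1
    (one_le_mul_of_one_le_of_one_le hK1 hq1)
  refine cauchy_of_contracting_osc (δ := (K * (K * q))⁻¹) (C := C) (by positivity)
    (inv_le_one_of_one_le₀ hKq) (p := fun n e i => M i e * L n i / L (n + 1) e) ?_ ?_ ?_
  · intro n e i
    rw [le_div_iff₀ (hLpos _ _), inv_mul_le_iff₀ (by positivity)]
    calc L (n + 1) e ≤ K * (K * q) * L n i := hLle n e i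
      _ ≤ _ := by
        refine mul_le_mul_of_nonneg_left ?_ (by positivity)
        exact le_mul_of_one_le_left (hLpos n i).le (hM1 i e)
  · intro n e
    rw [← Finset.sum_div, ← hL, div_self (hLpos _ _).ne']
  · intro n e
    have h1 : ∑ i, (M i e : ℝ) * L n i / L (n + 1) e * (O n i / L n i)
        = (∑ i, M i e * O n i) / L (n + 1) e := by
      rw [Finset.sum_div]
      refine Finset.sum_congr rfl fun i _ => ?_
      have := (hLpos n i).ne'
      have := (hLpos (n + 1) e).ne'
      field_simp
    rw [h1, ← sub_div, abs_div, abs_of_pos (hLpos _ _), div_le_iff₀ (hLpos _ _)]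
    refine (hO n e).trans ?_
    have h2 : (2 : ℝ) ^ n ≤ L (n + 1) e :=
      (pow_le_pow_right₀ one_le_two n.le_succ).trans (hLpow _ _)
    calc C = C * (1 / 2) ^ n * 2 ^ n := by
          rw [mul_assoc, ← mul_pow]; norm_num
      _ ≤ _ := mul_le_mul_of_nonneg_left h2 (by positivity)

end WeightedAverages

end TrainTrack

/-! ### Counting occurrences of subwords -/

namespace TrainTrack

section Words

variable {E : Type*}

theorem invRev_singleton (d : E × Bool) : FreeGroup.invRev [d] = [letterInv d] := rfl

theorem isPrefix_append_singleton_iff {v w : List (E × Bool)} :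
    v <+: w ↔ v = w ∨ ∃ d, v ++ [d] <+: w := by
  constructor
  · rintro ⟨t, rfl⟩
    cases t with
    | nil => simp
    | cons d t => exact Or.inr ⟨d, t, by simp⟩
  · rintro (rfl | ⟨d, h⟩)
    · exact List.prefix_refl _
    · exact (List.prefix_append v [d]).trans h

theorem invRev_suffix_iff {v w : List (E × Bool)} :
    FreeGroup.invRev v <:+ FreeGroup.invRev w ↔ v <+: w := by
  constructor
  · rintro ⟨t, ht⟩
    refine ⟨FreeGroup.invRev t, ?_⟩
    rw [← FreeGroup.invRev_invRev (L₁ := w), ← ht, FreeGroup.invRev_append, FreeGroup.invRev_invRev]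
  · rintro ⟨t, rfl⟩
    exact ⟨FreeGroup.invRev t, FreeGroup.invRev_append.symm⟩

theorem invRev_ne_nil {v : List (E × Bool)} (hv : v ≠ []) : FreeGroup.invRev v ≠ [] := by
  simpa [FreeGroup.invRev] using hv

variable [DecidableEq E]

theorem occ_cons (v w : List (E × Bool)) (d : E × Bool) :
    occ v (d :: w) = occ v w + if v <+: d :: w then 1 else 0 := by
  simp [occ, List.countP_cons]

theorem occ_nil {v : List (E × Bool)} (hv : v ≠ []) : occ v [] = 0 := by
  cases v with
  | nil => exact absurd rfl hv
  | cons d v => simp [occ]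

theorem occ_eq_zero {v w : List (E × Bool)} (hv : v ≠ []) (h : ¬ v <:+: w) : occ v w = 0 := by
  induction w with
  | nil => exact occ_nil hv
  | cons d w ih =>
    rw [occ_cons, ih fun h' => h (h'.trans (List.suffix_cons d w).isInfix),
      if_neg fun h' => h h'.isInfix]

theorem occ_append_ge {v : List (E × Bool)} (hv : v ≠ []) (w₁ w₂ : List (E × Bool)) :
    occ v w₁ + occ v w₂ ≤ occ v (w₁ ++ w₂) := by
  induction w₁ with
  | nil => simp [occ_nil hv]
  | cons d w ih =>
    rw [List.cons_append, occ_cons, occ_cons, ← List.cons_append]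
    by_cases h : v <+: d :: w
    · rw [if_pos h, if_pos (h.trans (List.prefix_append (d :: w) w₂))]
      omega
    · rw [if_neg h]
      omega

/-- New occurrences straddle the junction, so they start among the last letters of `w₁`. The minimum
is what makes the induction close: a new occurrence starting at the first letter forces `v` to be
longer than `w₁`. -/
theorem occ_append_le {v : List (E × Bool)} (hv : v ≠ []) (w₁ w₂ : List (E × Bool)) :
    occ v (w₁ ++ w₂) ≤ occ v w₁ + occ v w₂ + min w₁.length v.length := by
  induction w₁ with
  | nil => simp [occ_nil hv]
  | cons d w ih =>
    rw [List.cons_append, occ_cons, occ_cons, List.length_cons]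
    by_cases h : v <+: d :: (w ++ w₂)
    · rw [if_pos h]
      by_cases hl : v.length ≤ w.length + 1
      · have h' : v <+: d :: w := List.prefix_of_prefix_length_le h
          (List.prefix_append (d :: w) w₂) (by simpa using hl)
        rw [if_pos h']
        omega
      · omega
    · rw [if_neg h]
      split_ifs <;> omega

/-- Occurrences are counted by their beginnings, but the count can also be updated at the end of the
word. This is the form that matches `occ_cons` under inversion. -/
theorem occ_concat {v : List (E × Bool)} (hv : v ≠ []) (w : List (E × Bool)) (d : E × Bool) :
    occ v (w ++ [d]) = occ v w + if v <:+ w ++ [d] then 1 else 0 := by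
  induction w with
  | nil =>
    rw [List.nil_append, occ_cons, occ_nil hv]
    congr 1
    refine if_congr ?_ rfl rfl
    constructor
    · intro h
      have : v = [d] := by simpa [List.prefix_cons_iff, hv] using h
      simp [this]
    · intro h
      rcases List.suffix_cons_iff.1 h with h | h
      · simp [h]
      · exact absurd (List.suffix_nil.1 h) hv
  | cons e w ih =>
    rw [List.cons_append, occ_cons, ih, occ_cons]
    have h1 : (v <+: e :: (w ++ [d])) ↔ v = e :: (w ++ [d]) ∨ v <+: e :: w := by
      rw [← List.cons_append, List.prefix_concat_iff]
    have h2 : (v <:+ e :: (w ++ [d])) ↔ v = e :: (w ++ [d]) ∨ v <:+ w ++ [d] :=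
      List.suffix_cons_iff
    by_cases h : v = e :: (w ++ [d])
    · have h3 : ¬ v <+: e :: w := fun h' => by
        have := h'.length_le
        simp [h] at this
      have h4 : ¬ v <:+ w ++ [d] := fun h' => by
        have := h'.length_le
        simp [h] at this
      rw [if_neg h3, if_neg h4, if_pos (h1.2 (Or.inl h)), if_pos (h2.2 (Or.inl h))]
    · rw [if_congr h1 rfl rfl, if_congr h2 rfl rfl]
      simp only [h, false_or]
      omega

theorem occ_invRev_invRev {v : List (E × Bool)} (hv : v ≠ []) (w : List (E × Bool)) :
    occ (FreeGroup.invRev v) (FreeGroup.invRev w) = occ v w := by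
  induction w with
  | nil => rw [FreeGroup.invRev_empty, occ_nil hv, occ_nil (invRev_ne_nil hv)]
  | cons d w ih =>
    have h : FreeGroup.invRev (d :: w) = FreeGroup.invRev w ++ [letterInv d] :=
      FreeGroup.invRev_cons
    rw [occ_cons, h, occ_concat (invRev_ne_nil hv), ih, ← h]
    simp only [invRev_suffix_iff]

theorem symOcc_eq {v : List (E × Bool)} (hv : v ≠ []) (w : List (E × Bool)) :
    symOcc v w = occ v w + occ v (FreeGroup.invRev w) := by
  rw [symOcc, ← occ_invRev_invRev hv (FreeGroup.invRev w), FreeGroup.invRev_invRev]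

theorem symOcc_invRev_right {v : List (E × Bool)} (hv : v ≠ []) (w : List (E × Bool)) :
    symOcc v (FreeGroup.invRev w) = symOcc v w := by
  rw [symOcc_eq hv, symOcc_eq hv, FreeGroup.invRev_invRev, add_comm]

theorem symOcc_invRev_left (v w : List (E × Bool)) :
    symOcc (FreeGroup.invRev v) w = symOcc v w := by
  rw [symOcc, symOcc, FreeGroup.invRev_invRev, add_comm]

theorem symOcc_nil {v : List (E × Bool)} (hv : v ≠ []) : symOcc v [] = 0 := by
  rw [symOcc_eq hv, FreeGroup.invRev_empty, occ_nil hv]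

theorem abs_symOcc_append_sub_le {v : List (E × Bool)} (hv : v ≠ []) (w₁ w₂ : List (E × Bool)) :
    |(symOcc v (w₁ ++ w₂) : ℝ) - (symOcc v w₁ + symOcc v w₂)| ≤ 2 * v.length := by
  have h1 := occ_append_ge hv w₁ w₂
  have h2 := occ_append_le hv w₁ w₂
  have h3 := occ_append_ge (invRev_ne_nil hv) w₁ w₂
  have h4 := occ_append_le (invRev_ne_nil hv) w₁ w₂
  rw [FreeGroup.invRev_length] at h4
  have h5 : symOcc v w₁ + symOcc v w₂ ≤ symOcc v (w₁ ++ w₂) := by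
    simp only [symOcc]; omega
  have h6 : symOcc v (w₁ ++ w₂) ≤ symOcc v w₁ + symOcc v w₂ + 2 * v.length := by
    simp only [symOcc]
    have := min_le_right w₁.length v.length
    omega
  have h5' : (symOcc v w₁ : ℝ) + symOcc v w₂ ≤ symOcc v (w₁ ++ w₂) := by exact_mod_cast h5
  have h6' : (symOcc v (w₁ ++ w₂) : ℝ) ≤ symOcc v w₁ + symOcc v w₂ + 2 * v.length := by
    exact_mod_cast h6
  rw [abs_le]
  constructor <;> linarith

theorem abs_symOcc_flatMap_sub_le {v : List (E × Bool)} (hv : v ≠ [])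
    (g : E × Bool → List (E × Bool)) (w : List (E × Bool)) :
    |(symOcc v (w.flatMap g) : ℝ) - (w.map fun d => (symOcc v (g d) : ℝ)).sum|
      ≤ 2 * v.length * w.length := by
  induction w with
  | nil => simp [symOcc_nil hv]
  | cons d w ih =>
    rw [List.flatMap_cons, List.map_cons, List.sum_cons, List.length_cons]
    have h := abs_symOcc_append_sub_le hv (g d) (w.flatMap g)
    rw [abs_le] at *
    push_cast
    constructor <;> linarith [h.1, h.2, ih.1, ih.2]

/-- An occurrence of `v` is followed by exactly one letter, unless it ends the word. This is the
finite version of the switch condition. -/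
theorem occ_eq_sum_extensions [Fintype E] {v : List (E × Bool)} (hv : v ≠ [])
    (w : List (E × Bool)) :
    occ v w = (∑ d, occ (v ++ [d]) w) + if v <:+ w then 1 else 0 := by
  induction w with
  | nil =>
    rw [occ_nil hv, if_neg (by simpa using hv)]
    simp [occ_nil]
  | cons e w ih =>
    simp only [occ_cons, Finset.sum_add_distrib]
    rw [ih]
    have hsum : (∑ d, if v ++ [d] <+: e :: w then 1 else 0)
        = if ∃ d, v ++ [d] <+: e :: w then 1 else 0 := by
      split_ifs with h
      · obtain ⟨d, hd⟩ := h
        rw [Finset.sum_eq_single d, if_pos hd]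
        · intro d' _ hne
          rw [if_neg]
          intro hd'
          have := List.prefix_of_prefix_length_le hd' hd (by simp)
          have := this.eq_of_length (by simp)
          simp at this
          exact hne this
        · simp
      · exact Finset.sum_eq_zero fun d _ => if_neg fun hd => h ⟨d, hd⟩
    rw [hsum]
    have h1 : (v <+: e :: w) ↔ v = e :: w ∨ ∃ d, v ++ [d] <+: e :: w :=
      isPrefix_append_singleton_iff
    have h2 : (v <:+ e :: w) ↔ v = e :: w ∨ v <:+ w := List.suffix_cons_iff
    by_cases h : v = e :: w
    · have h3 : ¬ ∃ d, v ++ [d] <+: e :: w := fun ⟨d, h'⟩ => by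
        have := h'.length_le
        simp [h] at this
      have h4 : ¬ v <:+ w := fun h' => by
        have := h'.length_le
        simp [h] at this
      rw [if_neg h3, if_neg h4, if_pos (h1.2 (Or.inl h)), if_pos (h2.2 (Or.inl h))]
    · rw [if_congr h1 rfl rfl, if_congr h2 rfl rfl]
      simp only [h, false_or]
      omega

theorem abs_symOcc_sub_sum_extensions_le [Fintype E] {v : List (E × Bool)} (hv : v ≠ [])
    (w : List (E × Bool)) :
    |(symOcc v w : ℝ) - ∑ d, (symOcc (v ++ [d]) w : ℝ)| ≤ 2 := by
  have h1 := occ_eq_sum_extensions hv w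
  have h2 := occ_eq_sum_extensions hv (FreeGroup.invRev w)
  have h3 : ∀ d, symOcc (v ++ [d]) w = occ (v ++ [d]) w + occ (v ++ [d]) (FreeGroup.invRev w) :=
    fun d => symOcc_eq (by simp) w
  have h4 : symOcc v w = (∑ d, symOcc (v ++ [d]) w) + ((if v <:+ w then 1 else 0) +
      if v <:+ FreeGroup.invRev w then 1 else 0) := by
    rw [symOcc_eq hv, h1, h2]
    simp only [h3, Finset.sum_add_distrib]
    omega
  rw [h4]
  push_cast
  rw [add_sub_cancel_left]
  split_ifs <;> norm_num

end Words

end TrainTrack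

/-! ### Reduced words, and frequencies under a graph map -/

namespace TrainTrack

section Reduced

variable {A : Type*}

theorem eq_letterInv_comm {c d : A × Bool} : c = letterInv d ↔ d = letterInv c := by
  constructor <;> (rintro rfl; rw [letterInv_letterInv])

theorem isReduced_iff_isChain {w : List (A × Bool)} :
    FreeGroup.IsReduced w ↔ w.IsChain fun c d => d ≠ letterInv c := by
  have : (fun a b : A × Bool => a.1 = b.1 → a.2 = b.2) = fun c d => d ≠ letterInv c := by
    funext c d
    obtain ⟨c, b⟩ := c
    obtain ⟨d, b'⟩ := d
    simp only [letterInv, ne_eq, Prod.mk.injEq, not_and, eq_iff_iff, eq_comm (a := d)]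
    cases b <;> cases b' <;> simp
  rw [FreeGroup.IsReduced, this]

theorem isReduced_invRev {w : List (A × Bool)} :
    FreeGroup.IsReduced (FreeGroup.invRev w) ↔ FreeGroup.IsReduced w := by
  simp only [FreeGroup.isReduced_iff_not_step]
  constructor
  · intro h L hL
    exact h _ hL.invRev
  · intro h L hL
    apply h (FreeGroup.invRev L)
    simpa using hL.invRev

theorem isReduced_append_iff {u v : List (A × Bool)} :
    FreeGroup.IsReduced (u ++ v) ↔ FreeGroup.IsReduced u ∧ FreeGroup.IsReduced v ∧
      ∀ c ∈ u.getLast?, ∀ d ∈ v.head?, d ≠ letterInv c := by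
  simp only [isReduced_iff_isChain, List.isChain_append]

end Reduced

namespace EGraph

variable {V E : Type*} {Γ : EGraph V E}

theorem isPath_append_iff {p r : V} {u v : List (E × Bool)} :
    Γ.IsPath p (u ++ v) r ↔ ∃ q, Γ.IsPath p u q ∧ Γ.IsPath q v r := by
  induction u generalizing p with
  | nil => simp [IsPath]
  | cons d u ih => simp [IsPath, ih, and_assoc]

theorem o_letterInv (d : E × Bool) : Γ.o (letterInv d) = Γ.t d := by
  obtain ⟨e, b⟩ := d
  cases b <;> rfl

theorem t_letterInv (d : E × Bool) : Γ.t (letterInv d) = Γ.o d := by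
  rw [← o_letterInv, letterInv_letterInv]

theorem mem_reducedPaths_of_infix {u v : List (E × Bool)} (hu : u ≠ []) (h : u <:+: v)
    (hv : FreeGroup.IsReduced v) {p q : V} (hp : Γ.IsPath p v q) : u ∈ Γ.reducedPaths := by
  refine ⟨hu, hv.infix h, ?_⟩
  obtain ⟨s, t, rfl⟩ := h
  obtain ⟨q₁, h1, -⟩ := isPath_append_iff.1 hp
  obtain ⟨q₂, -, h2⟩ := isPath_append_iff.1 h1
  exact ⟨_, _, h2⟩

theorem invRev_mem_reducedPaths {v : List (E × Bool)} (hv : v ∈ Γ.reducedPaths) :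
    FreeGroup.invRev v ∈ Γ.reducedPaths := by
  obtain ⟨h0, h1, p, q, h2⟩ := hv
  exact ⟨invRev_ne_nil h0, isReduced_invRev.2 h1, q, p, h2.invRev⟩

end EGraph

namespace GraphMap

variable {V E : Type*} {Γ : EGraph V E} (f : GraphMap Γ)

theorem onEdge_letterInv (d : E × Bool) :
    f.onEdge (letterInv d) = FreeGroup.invRev (f.onEdge d) := by
  obtain ⟨e, b⟩ := d
  cases b <;> simp [onEdge, letterInv]

theorem onPath_append (u v : List (E × Bool)) : f.onPath (u ++ v) = f.onPath u ++ f.onPath v := by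
  simp [onPath]

theorem onPath_invRev (w : List (E × Bool)) :
    f.onPath (FreeGroup.invRev w) = FreeGroup.invRev (f.onPath w) := by
  induction w with
  | nil => rfl
  | cons d w ih =>
    rw [FreeGroup.invRev_cons, onPath_append, ih, invRev_singleton]
    have h1 : f.onPath [letterInv d] = FreeGroup.invRev (f.onEdge d) := by
      simp [onPath, onEdge_letterInv]
    have h2 : f.onPath (d :: w) = f.onEdge d ++ f.onPath w := by simp [onPath]
    rw [h1, h2, FreeGroup.invRev_append]

theorem iterate_onPath (n : ℕ) (w : List (E × Bool)) : f.onPath^[n] w = w.flatMap (f.iter n) := by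
  have happ : ∀ u v, f.onPath^[n] (u ++ v) = f.onPath^[n] u ++ f.onPath^[n] v := by
    induction n with
    | zero => simp
    | succ n ih => intro u v; simp only [Function.iterate_succ_apply, onPath_append, ih]
  induction w with
  | nil =>
    have h := happ [] []
    simp only [List.append_nil] at h
    simpa using h
  | cons d w ih =>
    have h := happ [d] w
    rw [List.singleton_append] at h
    rw [h, ih, List.flatMap_cons]
    rfl

theorem iter_succ (n : ℕ) (d : E × Bool) : f.iter (n + 1) d = (f.onEdge d).flatMap (f.iter n) := by
  rw [← iterate_onPath, iter, Function.iterate_succ_apply]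
  congr 1
  simp [onPath]

theorem iter_letterInv (n : ℕ) (d : E × Bool) :
    f.iter n (letterInv d) = FreeGroup.invRev (f.iter n d) := by
  have : ∀ w, f.onPath^[n] (FreeGroup.invRev w) = FreeGroup.invRev (f.onPath^[n] w) := by
    induction n with
    | zero => simp
    | succ n ih => intro w; simp only [Function.iterate_succ_apply, onPath_invRev, ih]
  rw [iter, iter, ← this, invRev_singleton]

variable {f}

theorem isPath_onEdge (d : E × Bool) :
    Γ.IsPath (f.onV (Γ.o d)) (f.onEdge d) (f.onV (Γ.t d)) := by
  obtain ⟨e, b⟩ := d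
  cases b
  · exact (f.isPath e).invRev
  · exact f.isPath e

theorem isPath_onPath {p q : V} {w : List (E × Bool)} (h : Γ.IsPath p w q) :
    Γ.IsPath (f.onV p) (f.onPath w) (f.onV q) := by
  induction w generalizing p with
  | nil => exact congrArg f.onV h
  | cons d w ih =>
    obtain ⟨rfl, h2⟩ := h
    have : f.onPath (d :: w) = f.onEdge d ++ f.onPath w := by simp [onPath]
    rw [this]
    exact (isPath_onEdge d).append (ih h2)

theorem isPath_iter (n : ℕ) (d : E × Bool) : ∃ p q, Γ.IsPath p (f.iter n d) q := by
  have : ∀ w p q, Γ.IsPath p w q → ∃ p q, Γ.IsPath p (f.onPath^[n] w) q := by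
    induction n with
    | zero => exact fun w p q h => ⟨p, q, h⟩
    | succ n ih => exact fun w p q h => ih _ _ _ (isPath_onPath h)
  exact this [d] _ _ ⟨rfl, rfl⟩

variable [DecidableEq E]

/-- Grouping the letters of `w` by unoriented edge turns a sum along an image path into a sum
weighted by a column of the transition matrix. -/
theorem sum_map_onE [Fintype E] {g : E × Bool → ℝ} (hg : ∀ d, g (letterInv d) = g d)
    (w : List (E × Bool)) :
    (w.map g).sum = ∑ i, ((w.count (i, true) + w.count (i, false) : ℕ) : ℝ) * g (i, true) := by
  induction w with
  | nil => simp
  | cons d w ih =>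
    obtain ⟨e, b⟩ := d
    rw [List.map_cons, List.sum_cons, ih]
    have hb : g (e, b) = g (e, true) := by
      cases b
      · exact (hg (e, true))
      · rfl
    have : ∀ i, ((((e, b) :: w).count (i, true) + ((e, b) :: w).count (i, false) : ℕ) : ℝ)
        * g (i, true) = ((w.count (i, true) + w.count (i, false) : ℕ) : ℝ) * g (i, true)
          + if e = i then g (i, true) else 0 := by
      intro i
      rw [List.count_cons, List.count_cons]
      cases b <;> by_cases h : e = i <;> simp [h] <;> ring
    simp only [this, Finset.sum_add_distrib]
    rw [Finset.sum_ite_eq, if_pos (Finset.mem_univ e), hb, add_comm]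

theorem exists_hasLimitingFrequencies [Finite E] [Nontrivial E]
    (hM : ∀ i j, 0 < f.transitionMatrix i j) : ∃ a, HasLimitingFrequencies f a := by
  have := Fintype.ofFinite E
  have key : ∀ v : List (E × Bool), v ≠ [] → ∃ a : ℝ, ∀ e : E × Bool,
      Tendsto (fun n => (symOcc v (f.iter n e) : ℝ) / ((f.iter n e).length : ℝ)) atTop (𝓝 a) := by
    intro v hv
    obtain ⟨K, hK⟩ : ∃ K, ∀ e : E, (f.onEdge (e, true)).length ≤ K := by
      obtain ⟨M, hM⟩ := Finite.exists_max fun e : E => (f.onEdge (e, true)).length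
      exact ⟨_, hM⟩
    have hL : ∀ n e, ((f.iter (n + 1) (e, true)).length : ℝ) =
        ∑ i, (f.transitionMatrix i e : ℝ) * ((f.iter n (i, true)).length : ℝ) := by
      intro n e
      have h := sum_map_onE (g := fun d => ((f.iter n d).length : ℝ))
        (fun d => by rw [iter_letterInv, FreeGroup.invRev_length]) (f.onEdge (e, true))
      change _ = ∑ i, (((f.onEdge (e, true)).count (i, true) +
        (f.onEdge (e, true)).count (i, false) : ℕ) : ℝ) * _
      rw [← h, iter_succ, List.length_flatMap, Nat.cast_list_sum, List.map_map]
      rfl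
    have hO : ∀ n e, |(symOcc v (f.iter (n + 1) (e, true)) : ℝ) -
        ∑ i, (f.transitionMatrix i e : ℝ) * (symOcc v (f.iter n (i, true)) : ℝ)|
          ≤ 2 * v.length * K := by
      intro n e
      have h := sum_map_onE (g := fun d => (symOcc v (f.iter n d) : ℝ))
        (fun d => by rw [iter_letterInv, symOcc_invRev_right hv]) (f.onEdge (e, true))
      change |_ - ∑ i, (((f.onEdge (e, true)).count (i, true) +
        (f.onEdge (e, true)).count (i, false) : ℕ) : ℝ) * _| ≤ _
      rw [← h, iter_succ]
      refine (abs_symOcc_flatMap_sub_le hv _ _).trans ?_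
      have := hK e
      gcongr
    obtain ⟨a, ha⟩ := exists_limit_ratio hM
      (L := fun n e => ((f.iter n (e, true)).length : ℝ))
      (O := fun n e => (symOcc v (f.iter n (e, true)) : ℝ)) (fun e => by simp [iter]) hL hO
    refine ⟨a, fun e => ?_⟩
    obtain ⟨e, b⟩ := e
    cases b
    · have h : ∀ n, f.iter n (e, false) = FreeGroup.invRev (f.iter n (e, true)) :=
        fun n => f.iter_letterInv n (e, true)
      simp only [h, symOcc_invRev_right hv, FreeGroup.invRev_length]
      exact ha e
    · exact ha e
  choose a ha using key
  -- The value at the empty word is arbitrary, because reduced paths are non-trivial.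
  refine ⟨fun v => if h : v = [] then 0 else a v h, fun v hv e => ?_⟩
  dsimp only
  rw [dif_neg hv.1]
  exact ha v hv.1 e

/-- The image of an edge contains every one of the at least two edges, so each application of `f` at
least doubles the length. -/
theorem tendsto_length_iter [Finite E] [Nontrivial E]
    (hM : ∀ i j, 0 < f.transitionMatrix i j) (d : E × Bool) :
    Tendsto (fun n => ((f.iter n d).length : ℝ)) atTop atTop := by
  have := Fintype.ofFinite E
  have hlen : ∀ d, 2 ≤ (f.onEdge d).length := by
    have h : ∀ e, 2 ≤ (f.onEdge (e, true)).length := by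
      intro e
      have h := sum_map_onE (g := fun _ => 1) (fun d => rfl) (f.onEdge (e, true))
      simp only [List.map_const', List.sum_replicate, nsmul_eq_mul, mul_one] at h
      have h2 : ∑ i : E, 1 ≤ ∑ i : E, ((f.onEdge (e, true)).count (i, true) +
        (f.onEdge (e, true)).count (i, false)) := Finset.sum_le_sum fun i _ => hM i e
      rw [Finset.sum_const, Finset.card_univ, smul_eq_mul, mul_one] at h2
      have h3 := (Fintype.one_lt_card : 1 < Fintype.card E)
      have h4 : (f.onEdge (e, true)).length = ∑ i : E, ((f.onEdge (e, true)).count (i, true) +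
        (f.onEdge (e, true)).count (i, false)) := by exact_mod_cast h
      omega
    rintro ⟨e, b⟩
    cases b
    · have := f.onEdge_letterInv (e, true)
      change f.onEdge (e, false) = _ at this
      rw [this, FreeGroup.invRev_length]
      exact h e
    · exact h e
  have h2 : ∀ n d, 2 ^ n ≤ (f.iter n d).length := by
    intro n
    induction n with
    | zero => intro d; simp [iter]
    | succ n ih =>
      intro d
      rw [iter_succ, List.length_flatMap]
      calc 2 ^ (n + 1) ≤ (f.onEdge d).length * 2 ^ n := by
            rw [pow_succ, mul_comm]; exact Nat.mul_le_mul_right _ (hlen d)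
        _ = ((f.onEdge d).map fun _ => 2 ^ n).sum := by simp
        _ ≤ _ := List.sum_le_sum fun i _ => ih i
  refine tendsto_atTop_mono (fun n => ?_) (tendsto_pow_atTop_atTop_of_one_lt (one_lt_two (α := ℝ)))
  exact_mod_cast h2 n d

theorem symOcc_iter_eq_zero (hf : f.IsTrainTrack) {v : List (E × Bool)} (hv : v ≠ [])
    (hv' : v ∉ Γ.reducedPaths) {n : ℕ} (hn : 1 ≤ n) (d : E × Bool) :
    symOcc v (f.iter n d) = 0 := by
  have h : ∀ d, occ v (f.iter n d) = 0 := fun d => occ_eq_zero hv fun h => by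
    obtain ⟨p, q, hp⟩ := isPath_iter (f := f) n d
    exact hv' (EGraph.mem_reducedPaths_of_infix hv h (hf.reduced n hn d) hp)
  rw [symOcc_eq hv, ← iter_letterInv, h, h]

theorem switchConditions [Finite E] [Nontrivial E] (hf : f.IsTrainTrack)
    (hM : ∀ i j, 0 < f.transitionMatrix i j) {a : List (E × Bool) → ℝ}
    (ha : HasLimitingFrequencies f a) : SwitchConditions Γ a := by
  have := Fintype.ofFinite E
  classical
  obtain ⟨e₀⟩ : Nonempty E := inferInstance
  have inv : ∀ v ∈ Γ.reducedPaths, a (FreeGroup.invRev v) = a v := fun v hv => by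
    have h := ha _ (EGraph.invRev_mem_reducedPaths hv) (e₀, true)
    simp only [symOcc_invRev_left] at h
    exact tendsto_nhds_unique h (ha v hv (e₀, true))
  have right : ∀ v ∈ Γ.reducedPaths,
      ∑ᶠ e ∈ {e | v ++ [e] ∈ Γ.reducedPaths}, a (v ++ [e]) = a v := by
    intro v hv
    -- Extensions that are not reduced paths must contribute limit 0 to the sum over all letters;
    -- the train-track property excludes them from f^n(e) for n ≥ 1.
    have hlim : ∀ d, Tendsto (fun n => (symOcc (v ++ [d]) (f.iter n (e₀, true)) : ℝ) /
        ((f.iter n (e₀, true)).length : ℝ)) atTop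
        (𝓝 ({e | v ++ [e] ∈ Γ.reducedPaths}.indicator (fun e => a (v ++ [e])) d)) := by
      intro d
      by_cases hd : v ++ [d] ∈ Γ.reducedPaths
      · rw [Set.indicator_of_mem (by exact hd)]
        exact ha _ hd _
      · rw [Set.indicator_of_notMem (by exact hd)]
        refine tendsto_const_nhds.congr' ?_
        filter_upwards [eventually_ge_atTop 1] with n hn
        rw [symOcc_iter_eq_zero hf (by simp) hd hn]
        simp
    have hsum := tendsto_finsetSum Finset.univ fun d _ => hlim d
    have herr : Tendsto (fun n => (symOcc v (f.iter n (e₀, true)) : ℝ) /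
        ((f.iter n (e₀, true)).length : ℝ) - ∑ d, (symOcc (v ++ [d]) (f.iter n (e₀, true)) : ℝ) /
        ((f.iter n (e₀, true)).length : ℝ)) atTop (𝓝 0) := by
      refine squeeze_zero_norm (fun n => ?_)
        ((tendsto_length_iter hM (e₀, true)).const_div_atTop 2)
      rw [← Finset.sum_div, ← sub_div, norm_div, Real.norm_eq_abs, Real.norm_natCast]
      gcongr
      exact abs_symOcc_sub_sum_extensions_le hv.1 _
    have h := herr.add hsum
    simp only [sub_add_cancel, zero_add] at h
    rw [finsum_mem_eq_finite_toFinset_sum _ (Set.toFinite _)]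
    rw [Finset.sum_indicator_eq_sum_filter] at h
    rw [tendsto_nhds_unique (ha v hv (e₀, true)) h]
    refine Finset.sum_congr ?_ fun _ _ => rfl
    ext; simp
  refine ⟨fun v hv => ?_, inv, right, fun v hv => ?_⟩
  · exact ge_of_tendsto' (ha v hv (e₀, true)) fun n => by positivity
  -- Inversion turns the extensions at the beginning of `v` into extensions at the end of its
  -- inverse.
  · rw [← inv v hv, ← right _ (EGraph.invRev_mem_reducedPaths hv)]
    have hcons : ∀ e, FreeGroup.invRev (e :: v) = FreeGroup.invRev v ++ [letterInv e] :=
      fun e => FreeGroup.invRev_cons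
    have hmem : ∀ e, e :: v ∈ Γ.reducedPaths ↔ FreeGroup.invRev v ++ [letterInv e] ∈
        Γ.reducedPaths := fun e => by
      rw [← hcons]
      refine ⟨EGraph.invRev_mem_reducedPaths, fun h => ?_⟩
      simpa using EGraph.invRev_mem_reducedPaths h
    refine finsum_mem_eq_of_bijOn letterInv ⟨?_, ?_, ?_⟩ ?_
    · exact fun e he => (hmem e).1 he
    · exact (Function.LeftInverse.injective letterInv_letterInv).injOn
    · exact fun e he => ⟨letterInv e, (hmem _).2 (by rwa [letterInv_letterInv]),
        letterInv_letterInv e⟩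
    · exact fun e he => by rw [← hcons, inv _ he]

end GraphMap

end TrainTrack

/-! ### Regular measures from consistent masses on nested partitions -/

namespace TrainTrack

section Content
open TopologicalSpace
open scoped NNReal ENNReal

variable {X W : Type*} [TopologicalSpace X]

/-- A sequence of successively finer partitions `{π n = s}` of increasing open sets `D n`
exhausting `X` into finitely many compact open atoms. -/
structure AtomSystem (X : Type*) [TopologicalSpace X] (W : Type*) where
  /-- the domain of the `n`-th partition -/
  D : ℕ → Set X
  /-- the atom at level `n` of a point -/
  π : ℕ → X → W
  locConst : ∀ n, IsLocallyConstant (π n)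
  finite : ∀ n, (Set.range (π n)).Finite
  refines : ∀ n x y, π (n + 1) x = π (n + 1) y → π n x = π n y
  separates : ∀ x y, (∀ n, π n x = π n y) → x = y
  saturated : ∀ n x y, π n x = π n y → x ∈ D n → y ∈ D n
  mono : Monotone D
  exhausts : ∀ x, ∃ n, x ∈ D n
  compact : ∀ n, ∀ x ∈ D n, IsCompact {y | π n y = π n x}

namespace AtomSystem

variable (S : AtomSystem X W)

/-- The atom of `x` at level `n`. -/
def atom (n : ℕ) (x : X) : Set X := {y | S.π n y = S.π n x}

theorem mem_atom (n : ℕ) (x : X) : x ∈ S.atom n x := rfl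

theorem isOpen_atom (n : ℕ) (x : X) : IsOpen (S.atom n x) := (S.locConst n).isOpen_fiber _

theorem isClosed_atom (n : ℕ) (x : X) : IsClosed (S.atom n x) := (S.locConst n).isClosed_fiber _

theorem isOpen_D (n : ℕ) : IsOpen (S.D n) := by
  rw [isOpen_iff_mem_nhds]
  exact fun x hx => mem_of_superset ((S.isOpen_atom n x).mem_nhds rfl)
    fun y hy => S.saturated n x y hy.symm hx

theorem refines_le {m n : ℕ} (h : m ≤ n) {x y : X} (hxy : S.π n x = S.π n y) :
    S.π m x = S.π m y := by
  induction n, h using Nat.le_induction with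
  | base => exact hxy
  | succ n _ ih => exact ih (S.refines n x y hxy)

theorem t2Space (S : AtomSystem X W) : T2Space X := by
  refine ⟨fun x y hxy => ?_⟩
  obtain ⟨n, hn⟩ : ∃ n, S.π n x ≠ S.π n y := by
    by_contra! h
    exact hxy (S.separates x y h)
  refine ⟨S.atom n x, S.atom n y, S.isOpen_atom n x, S.isOpen_atom n y, rfl, rfl, ?_⟩
  exact Set.disjoint_left.2 fun z hz hz' => hn (hz.symm.trans hz')

theorem antitone_atom (x : X) : Antitone fun n => S.atom n x :=
  fun _ _ h _ hy => S.refines_le h hy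

/-- The atoms of `x` decrease to {x}. Inside a compact atom, the closed decreasing traces on the
complement of `U` have empty intersection, so one of them is already empty. -/
theorem exists_atom_subset {U : Set X} (hU : IsOpen U) {x : X} (hx : x ∈ U) :
    ∃ n, x ∈ S.D n ∧ S.atom n x ⊆ U := by
  obtain ⟨n₀, hn₀⟩ := S.exhausts x
  have hK : IsCompact (S.atom n₀ x \ U) := (S.compact n₀ x hn₀).diff hU
  obtain ⟨k, hk⟩ := hK.elim_directed_family_closed (fun n => S.atom n x)
    (fun n => S.isClosed_atom _ x) (by
      rw [Set.eq_empty_iff_forall_notMem]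
      rintro y ⟨⟨-, hy⟩, hy'⟩
      rw [Set.mem_iInter] at hy'
      exact hy (by rwa [S.separates y x hy']))
    (S.antitone_atom x).directed_ge
  refine ⟨max n₀ k, S.mono (le_max_left _ _) hn₀, fun y hy => ?_⟩
  by_contra hyU
  have : y ∈ (S.atom n₀ x \ U) ∩ S.atom k x :=
    ⟨⟨S.antitone_atom x (le_max_left _ _) hy, hyU⟩, S.antitone_atom x (le_max_right _ _) hy⟩
  rw [hk] at this
  exact this

theorem weaklyLocallyCompactSpace (S : AtomSystem X W) : WeaklyLocallyCompactSpace X := by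
  refine ⟨fun x => ?_⟩
  obtain ⟨n, hn⟩ := S.exhausts x
  exact ⟨S.atom n x, S.compact n x hn, (S.isOpen_atom n x).mem_nhds rfl⟩

/-- The set of all atoms of all levels. -/
def atoms : Set (Set X) := {A | ∃ n, ∃ x ∈ S.D n, S.atom n x = A}

theorem atom_eq_of_mem {n : ℕ} {x y : X} (h : y ∈ S.atom n x) : S.atom n y = S.atom n x := by
  ext z
  change S.π n z = S.π n y ↔ S.π n z = S.π n x
  rw [show S.π n y = S.π n x from h]

theorem countable_atoms : S.atoms.Countable := by
  have h : S.atoms ⊆ ⋃ n, (fun s => {y | S.π n y = s}) '' Set.range (S.π n) := by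
    rintro _ ⟨n, x, -, rfl⟩
    exact Set.mem_iUnion.2 ⟨n, _, ⟨x, rfl⟩, rfl⟩
  exact (Set.countable_iUnion fun n => ((S.finite n).image _).countable).mono h

theorem sUnion_atoms : ⋃₀ S.atoms = Set.univ := by
  refine Set.eq_univ_of_forall fun x => ?_
  obtain ⟨n, hn⟩ := S.exhausts x
  exact ⟨_, ⟨n, x, hn, rfl⟩, S.mem_atom n x⟩

/-- Two atoms that meet are nested, and their intersection is the finer one. -/
theorem isPiSystem_atoms : IsPiSystem S.atoms := by
  rintro _ ⟨m, x, hx, rfl⟩ _ ⟨n, y, hy, rfl⟩ ⟨z, hzx, hzy⟩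
  rw [← S.atom_eq_of_mem hzx, ← S.atom_eq_of_mem hzy]
  rcases le_total m n with h | h
  · rw [Set.inter_eq_right.2 (S.antitone_atom z h)]
    exact ⟨n, z, S.saturated _ _ _ hzy.symm hy, rfl⟩
  · rw [Set.inter_eq_left.2 (S.antitone_atom z h)]
    exact ⟨m, z, S.saturated _ _ _ hzx.symm hx, rfl⟩

theorem isTopologicalBasis_atoms : IsTopologicalBasis S.atoms := by
  refine isTopologicalBasis_of_isOpen_of_nhds ?_ fun x U hx hU => ?_
  · rintro _ ⟨n, x, -, rfl⟩
    exact S.isOpen_atom n x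
  · obtain ⟨n, hn, hs⟩ := S.exists_atom_subset hU hx
    exact ⟨_, ⟨n, x, hn, rfl⟩, S.mem_atom n x, hs⟩

/-- The atoms form a countable π-system which is also a basis, hence generates the Borel sets, and
they cover the space by sets of finite measure. -/
theorem measure_ext [MeasurableSpace X] [BorelSpace X] {μ ν : Measure X}
    (hfin : ∀ n, ∀ x ∈ S.D n, μ (S.atom n x) ≠ ∞)
    (h : ∀ n, ∀ x ∈ S.D n, μ (S.atom n x) = ν (S.atom n x)) : μ = ν := by
  have hgen : ‹MeasurableSpace X› = MeasurableSpace.generateFrom S.atoms := by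
    have := S.isTopologicalBasis_atoms.secondCountableTopology S.countable_atoms
    rw [BorelSpace.measurable_eq (α := X), S.isTopologicalBasis_atoms.borel_eq_generateFrom]
  refine Measure.ext_of_generateFrom_of_cover_subset hgen S.isPiSystem_atoms subset_rfl
    S.countable_atoms S.sUnion_atoms ?_ ?_
  · rintro _ ⟨n, x, hx, rfl⟩
    exact hfin n x hx
  · rintro _ ⟨n, x, hx, rfl⟩
    exact h n x hx

open Classical in
/-- The labels of the atoms of level `n` that meet `K`. -/
noncomputable def labels (n : ℕ) (K : Set X) : Finset W :=
  ((S.finite n).subset (Set.image_subset_range (S.π n) (K ∩ S.D n))).toFinset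

theorem mem_labels {n : ℕ} {K : Set X} {s : W} :
    s ∈ S.labels n K ↔ ∃ x ∈ K, x ∈ S.D n ∧ S.π n x = s := by
  simp [labels, and_assoc]

theorem labels_mono (n : ℕ) {K K' : Set X} (h : K ⊆ K') : S.labels n K ⊆ S.labels n K' := by
  intro s
  simp only [mem_labels]
  exact fun ⟨x, hx, h'⟩ => ⟨x, h hx, h'⟩

theorem labels_union [DecidableEq W] (n : ℕ) (K K' : Set X) :
    S.labels n (K ∪ K') = S.labels n K ∪ S.labels n K' := by
  ext s
  simp only [mem_labels, Finset.mem_union, Set.mem_union]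
  constructor
  · rintro ⟨x, hx | hx, h⟩
    exacts [Or.inl ⟨x, hx, h⟩, Or.inr ⟨x, hx, h⟩]
  · rintro (⟨x, hx, h⟩ | ⟨x, hx, h⟩)
    exacts [⟨x, Or.inl hx, h⟩, ⟨x, Or.inr hx, h⟩]

theorem exists_subset_D {K : Set X} (hK : IsCompact K) : ∃ n, K ⊆ S.D n :=
  hK.elim_directed_cover S.D S.isOpen_D (fun x _ => Set.mem_iUnion.2 (S.exhausts x))
    S.mono.directed_le

/-- A mass distribution on the atoms is consistent if the mass of an atom is the sum of the masses
of the atoms into which it splits at the next level. -/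
def Consistent (m : W → ℝ≥0) : Prop :=
  ∀ n, ∀ x ∈ S.D n, ∑ s ∈ S.labels (n + 1) (S.atom n x), m s = m (S.π n x)

variable {S}

namespace Consistent

variable {m : W → ℝ≥0}

/-- The total mass of the atoms of level `n` that meet `K`. -/
noncomputable def approx (S : AtomSystem X W) (m : W → ℝ≥0) (n : ℕ) (K : Set X) : ℝ≥0 :=
  ∑ s ∈ S.labels n K, m s

/-- The set on the right is the union of the atoms of level `n` that meet `K` inside `D n`; cutting
these into their pieces preserves the total mass. -/
theorem approx_atom_next (hm : S.Consistent m) {n : ℕ} {K : Set X} :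
    ∑ s ∈ (S.labels n K), m s =
      ∑ s ∈ S.labels (n + 1) {y | ∃ x ∈ K, x ∈ S.D n ∧ y ∈ S.atom n x}, m s := by
  classical
  have h : S.labels (n + 1) {y | ∃ x ∈ K, x ∈ S.D n ∧ y ∈ S.atom n x} =
      (S.labels n K).biUnion fun s => S.labels (n + 1) {y | S.π n y = s} := by
    ext t
    simp only [mem_labels, Finset.mem_biUnion]
    constructor
    · rintro ⟨y, ⟨x, hx, hxD, hy⟩, hyD, rfl⟩
      exact ⟨_, ⟨x, hx, hxD, rfl⟩, y, hy, hyD, rfl⟩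
    · rintro ⟨_, ⟨x, hx, hxD, rfl⟩, y, hy, hyD, rfl⟩
      exact ⟨y, ⟨x, hx, hxD, hy⟩, hyD, rfl⟩
  rw [h, Finset.sum_biUnion]
  · refine Finset.sum_congr rfl fun s hs => ?_
    obtain ⟨x, -, hxD, rfl⟩ := S.mem_labels.1 hs
    exact (hm n x hxD).symm
  · intro s _ s' _ hss
    refine Finset.disjoint_left.2 fun t ht ht' => hss ?_
    obtain ⟨y, rfl, -, rfl⟩ := S.mem_labels.1 ht
    obtain ⟨y', rfl, -, h'⟩ := S.mem_labels.1 ht'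
    exact S.refines _ _ _ h'.symm

/-- After the cut, `K` meets only some of the pieces, so the outer approximations decrease. -/
theorem approx_succ_le (hm : S.Consistent m) {n : ℕ} {K : Set X} (hK : K ⊆ S.D n) :
    approx S m (n + 1) K ≤ approx S m n K := by
  have h : K ⊆ {y | ∃ x ∈ K, x ∈ S.D n ∧ y ∈ S.atom n x} :=
    fun x hx => ⟨x, hx, hK hx, S.mem_atom n x⟩
  refine le_of_le_of_eq ?_ (hm.approx_atom_next (n := n) (K := K)).symm
  exact Finset.sum_le_sum_of_subset (S.labels_mono _ h)

/-- An atom meets all the pieces into which it is cut, so nothing is lost at finer levels. -/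
theorem approx_atom (hm : S.Consistent m) {n k : ℕ} (hk : n ≤ k) {x : X} (hx : x ∈ S.D n) :
    approx S m k (S.atom n x) = m (S.π n x) := by
  induction k, hk using Nat.le_induction with
  | base =>
    have : S.labels n (S.atom n x) = {S.π n x} := by
      ext s
      rw [mem_labels, Finset.mem_singleton]
      constructor
      · rintro ⟨y, hy, -, rfl⟩
        exact hy
      · rintro rfl
        exact ⟨x, rfl, hx, rfl⟩
    rw [approx, this, Finset.sum_singleton]
  | succ k hk ih =>
    refine Eq.trans ?_ ((hm.approx_atom_next (n := k) (K := S.atom n x)).symm.trans ih)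
    refine congrArg (fun K => ∑ s ∈ S.labels (k + 1) K, m s) (Set.ext fun y => ?_)
    constructor
    · intro hy
      exact ⟨y, hy, S.mono hk (S.saturated n x y (Eq.symm hy) hx), S.mem_atom k y⟩
    · rintro ⟨z, hz, -, hy⟩
      exact (S.refines_le hk hy).trans hz

theorem tendsto_approx (hm : S.Consistent m) {K : Set X} (hK : IsCompact K) :
    Tendsto (fun n => approx S m n K) atTop (𝓝 (limUnder atTop fun n => approx S m n K)) := by
  obtain ⟨n, hn⟩ := S.exists_subset_D hK
  -- Monotonicity starts only at the level whose domain contains `K`; the limit does not see the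
  -- shift.
  have hanti : Antitone fun k => approx S m (k + n) K := by
    refine antitone_nat_of_succ_le fun k => ?_
    rw [add_right_comm]
    exact hm.approx_succ_le (hn.trans (S.mono (Nat.le_add_left _ _)))
  have := tendsto_atTop_ciInf hanti (OrderBot.bddBelow _)
  rw [tendsto_add_atTop_iff_nat (f := fun k => approx S m k K)] at this
  exact tendsto_nhds_limUnder ⟨_, this⟩

/-- The content defined by a consistent mass distribution. -/
noncomputable def content (hm : S.Consistent m) : Content X where
  toFun K := limUnder atTop fun n => approx S m n K
  mono' K₁ K₂ h := le_of_tendsto_of_tendsto' (hm.tendsto_approx K₁.2) (hm.tendsto_approx K₂.2)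
    fun n => Finset.sum_le_sum_of_subset (S.labels_mono n h)
  sup_le' K₁ K₂ := by
    classical
    refine le_of_tendsto_of_tendsto' (hm.tendsto_approx (K₁ ⊔ K₂).2)
      ((hm.tendsto_approx K₁.2).add (hm.tendsto_approx K₂.2)) fun n => ?_
    simp only [approx, Compacts.carrier_eq_coe, Compacts.coe_sup, labels_union]
    rw [← Finset.sum_union_inter]
    exact le_self_add
  sup_disjoint' K₁ K₂ hd _ _ := by
    classical
    refine tendsto_nhds_unique (hm.tendsto_approx (K₁ ⊔ K₂).2)
      (((hm.tendsto_approx K₁.2).add (hm.tendsto_approx K₂.2)).congr' ?_)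
    -- Each pair in K₁ × K₂ is separated at some level, and compactness gives one level for all
    -- pairs. From there on no atom meets both sets, and the approximations add.
    obtain ⟨n₀, hn₀⟩ := (K₁.2.prod K₂.2).elim_directed_cover
      (fun n => {p : X × X | S.π n p.1 ≠ S.π n p.2})
      (fun n => by
        have h : IsLocallyConstant fun p : X × X => (S.π n p.1, S.π n p.2) :=
          ((S.locConst n).comp_continuous continuous_fst).prodMk
            ((S.locConst n).comp_continuous continuous_snd)
        exact h {q : W × W | q.1 ≠ q.2})
      (fun p hp => by
        by_contra h
        simp only [Set.mem_iUnion, Set.mem_ofPred_eq, not_exists, not_not] at h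
        exact Set.disjoint_left.1 hd hp.1 (by rw [S.separates _ _ h]; exact hp.2))
      (Monotone.directed_le fun a b hab p hp h => hp (S.refines_le hab h))
    filter_upwards [eventually_ge_atTop n₀] with n hn
    simp only [approx, Compacts.carrier_eq_coe, Compacts.coe_sup, labels_union]
    rw [Finset.sum_union]
    refine Finset.disjoint_left.2 fun s hs hs' => ?_
    obtain ⟨x, hx, -, rfl⟩ := S.mem_labels.1 hs
    obtain ⟨y, hy, -, h⟩ := S.mem_labels.1 hs'
    exact hn₀ (Set.mk_mem_prod hx hy) (S.refines_le hn h.symm)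

/-- On a set that is both compact and open the measure of a content equals the content, and for an
atom the approximations are eventually constant. -/
theorem exists_regular_measure (hm : S.Consistent m) [MeasurableSpace X] [BorelSpace X] :
    ∃ μ : Measure X, μ.Regular ∧ ∀ n, ∀ x ∈ S.D n, μ (S.atom n x) = m (S.π n x) := by
  have := S.t2Space
  have := S.weaklyLocallyCompactSpace
  refine ⟨hm.content.measure, inferInstance, fun n x hx => ?_⟩
  rw [Content.measure_apply _ (S.isOpen_atom n x).measurableSet,
    Content.outerMeasure_of_isOpen _ _ (S.isOpen_atom n x),
    Content.innerContent_of_isCompact _ (K := S.atom n x) (S.compact n x hx) (S.isOpen_atom n x)]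
  change ((limUnder atTop fun k => approx S m k (S.atom n x) : ℝ≥0) : ℝ≥0∞) = _
  congr 1
  refine Tendsto.limUnder_eq (tendsto_const_nhds.congr' ?_)
  filter_upwards [eventually_ge_atTop n] with k hk
  exact (hm.approx_atom hk hx).symm

end Consistent

end AtomSystem
end Content
end TrainTrack

/-! ### The boundary of a free group: prefixes, topology, action -/

namespace TrainTrack

namespace Boundary

variable {A : Type*}

theorem letter_injective : Function.Injective (letter : Boundary A → ℕ → A × Bool) :=
  Subtype.val_injective

@[simp] theorem length_take (x : Boundary A) (n : ℕ) : (x.take n).length = n := by simp [take]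

@[simp] theorem take_zero (x : Boundary A) : x.take 0 = [] := rfl

theorem letter_zero_of_take {x : Boundary A} {n : ℕ} {c : A × Bool} {w : List (A × Bool)}
    (h : x.take n = c :: w) : x.letter 0 = c := by
  cases n with
  | zero => simp at h
  | succ n =>
    rw [take, List.ofFn_succ] at h
    exact (List.cons.inj h).1

theorem getElem_take (x : Boundary A) {n i : ℕ} (h : i < (x.take n).length) :
    (x.take n)[i] = x.letter i := by simp [take]

theorem take_add (x : Boundary A) (m n : ℕ) :
    x.take (m + n) = x.take m ++ List.ofFn fun i : Fin n => x.letter (m + i) := by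
  rw [take, List.ofFn_add]
  rfl

theorem take_succ (x : Boundary A) (n : ℕ) : x.take (n + 1) = x.take n ++ [x.letter n] := by
  rw [take_add]; simp

theorem take_succ_eq_cons (x : Boundary A) (n : ℕ) :
    x.take (n + 1) = x.letter 0 :: x.tail.take n := by
  rw [take, List.ofFn_succ]; rfl

theorem take_prefix (x : Boundary A) {m n : ℕ} (h : m ≤ n) : x.take m <+: x.take n := by
  obtain ⟨k, rfl⟩ := Nat.exists_eq_add_of_le h
  rw [take_add]
  exact List.prefix_append _ _

theorem take_of_prefix {x : Boundary A} {v : List (A × Bool)} {n : ℕ} (h : v <+: x.take n) :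
    x.take v.length = v := by
  have hl := h.length_le
  rw [length_take] at hl
  exact (List.prefix_of_prefix_length_le (x.take_prefix hl) h (by simp)).eq_of_length (by simp)

theorem take_take_eq {x y : Boundary A} {m n : ℕ} (hmn : m ≤ n) (h : x.take n = y.take n) :
    x.take m = y.take m := by
  have := take_of_prefix (h ▸ x.take_prefix hmn : x.take m <+: y.take n)
  rw [length_take] at this
  exact this.symm

theorem letter_eq_of_take {x y : Boundary A} {n i : ℕ} (h : x.take n = y.take n) (hi : i < n) :
    x.letter i = y.letter i := by
  have h1 := x.getElem_take (n := n) (i := i) (by simpa)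
  rw [← h1, ← y.getElem_take (n := n) (i := i) (by simpa)]
  simp only [h]

theorem ext_take {x y : Boundary A} (h : ∀ n, x.take n = y.take n) : x = y :=
  letter_injective (funext fun i => letter_eq_of_take (h (i + 1)) i.lt_succ_self)

theorem isReduced_take (x : Boundary A) (n : ℕ) : FreeGroup.IsReduced (x.take n) := by
  rw [isReduced_iff_isChain]
  refine List.isChain_iff_getElem.2 fun i hi => ?_
  rw [getElem_take, getElem_take]
  exact x.2 i

theorem tail_letter (x : Boundary A) (n : ℕ) : x.tail.letter n = x.letter (n + 1) := rfl

theorem iterate_tail_letter (x : Boundary A) (m n : ℕ) :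
    (tail^[m] x).letter n = x.letter (m + n) := by
  induction m generalizing x with
  | zero => simp
  | succ m ih => rw [Function.iterate_succ_apply, ih, tail_letter]; congr 1; omega

theorem exists_of_words {W : ℕ → List (A × Bool)} (hl : ∀ k, (W k).length = k)
    (hp : ∀ k, W k <+: W (k + 1)) (hr : ∀ k, FreeGroup.IsReduced (W k)) :
    ∃ x : Boundary A, ∀ k, x.take k = W k := by
  have hle : ∀ m n, m ≤ n → W m <+: W n := fun m n h => by
    induction n, h using Nat.le_induction with
    | base => exact List.prefix_refl _
    | succ n _ ih => exact ih.trans (hp n)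
  have hi : ∀ i, i < (W (i + 1)).length := fun i => by rw [hl]; exact i.lt_succ_self
  obtain ⟨x, hx⟩ : ∃ x : Boundary A, ∀ i, x.letter i = (W (i + 1))[i]'(hi i) := by
    refine ⟨⟨fun i => (W (i + 1))[i]'(hi i), fun i => ?_⟩, fun i => rfl⟩
    have h1 := isReduced_iff_isChain.1 (hr (i + 2))
    have h2 := List.isChain_iff_getElem.1 h1 i (by rw [hl]; omega)
    have h3 : (W (i + 1))[i]'(hi i) = (W (i + 2))[i]'(by rw [hl]; omega) :=
      (hle _ _ (Nat.le_succ (i + 1))).getElem _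
    change (W (i + 2))[i + 1]'(hi (i + 1)) ≠ letterInv ((W (i + 1))[i]'(hi i))
    rw [h3]
    exact h2
  refine ⟨x, fun k => List.ext_getElem (by rw [length_take, hl]) fun i h1 h2 => ?_⟩
  rw [getElem_take, hx]
  rw [length_take] at h1
  exact (hle _ _ h1).getElem _

section Topology

theorem isLocallyConstant_letter (n : ℕ) : IsLocallyConstant fun x : Boundary A => x.letter n := by
  let _ : TopologicalSpace (A × Bool) := ⊥
  have : DiscreteTopology (A × Bool) := ⟨rfl⟩
  have h : Continuous fun x : Boundary A => x.letter n :=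
    (continuous_apply n).comp continuous_induced_dom
  exact (IsLocallyConstant.iff_continuous _).2 h

theorem isLocallyConstant_take (n : ℕ) : IsLocallyConstant fun x : Boundary A => x.take n := by
  induction n with
  | zero => exact IsLocallyConstant.const []
  | succ n ih =>
    simp only [take_succ]
    exact (ih.prodMk (isLocallyConstant_letter n)).comp fun p => p.1 ++ [p.2]

theorem continuous_of_letter {Y : Type*} [TopologicalSpace Y] {f : Y → Boundary A}
    (h : ∀ n, IsLocallyConstant fun y => (f y).letter n) : Continuous f := by
  let _ : TopologicalSpace (A × Bool) := ⊥
  refine continuous_induced_rng.2 (continuous_pi fun n => ?_)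
  exact (h n).continuous

theorem continuous_of_take {Y : Type*} [TopologicalSpace Y] {f : Y → Boundary A}
    (h : ∀ n, IsLocallyConstant fun y => (f y).take n) : Continuous f := by
  refine continuous_of_letter fun n => (IsLocallyConstant.iff_eventually_eq _).2 fun y => ?_
  filter_upwards [(IsLocallyConstant.iff_eventually_eq _).1 (h (n + 1)) y] with z hz
  exact letter_eq_of_take hz n.lt_succ_self

/-- Being reduced is a condition on neighbouring letters, hence closed in a product of finite
discrete spaces. -/
instance [Finite A] : CompactSpace (Boundary A) := by
  let _ : TopologicalSpace (A × Bool) := ⊥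
  have : DiscreteTopology (A × Bool) := ⟨rfl⟩
  have h : IsEmbedding (letter : Boundary A → ℕ → A × Bool) := ⟨⟨rfl⟩, letter_injective⟩
  have hr : Set.range (letter : Boundary A → ℕ → A × Bool) =
      ⋂ n, {x | x (n + 1) ≠ letterInv (x n)} := by
    ext x
    simp only [Set.mem_range, Set.mem_iInter]
    exact ⟨by rintro ⟨y, rfl⟩; exact y.2, fun hx => ⟨⟨x, hx⟩, rfl⟩⟩
  have hc : IsClosed (Set.range (letter : Boundary A → ℕ → A × Bool)) := by
    rw [hr]
    refine isClosed_iInter fun n => ?_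
    have hcont : Continuous fun x : ℕ → A × Bool => (x (n + 1), x n) := by fun_prop
    exact (isClosed_discrete {p : (A × Bool) × (A × Bool) | p.1 ≠ letterInv p.2}).preimage hcont
  exact (IsClosedEmbedding.mk h hc).compactSpace

end Topology

section Action

theorem mk_cons (d : A × Bool) (w : List (A × Bool)) :
    FreeGroup.mk (d :: w) = FreeGroup.mk [d] * FreeGroup.mk w := by
  rw [FreeGroup.mul_mk, List.singleton_append]

theorem mk_letterInv (d : A × Bool) : FreeGroup.mk [letterInv d] = (FreeGroup.mk [d])⁻¹ := by
  rw [FreeGroup.inv_mk, invRev_singleton]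

theorem cons_take_succ (d : A × Bool) (x : Boundary A) (h : x.letter 0 ≠ letterInv d) (n : ℕ) :
    (x.cons d h).take (n + 1) = d :: x.take n := by
  rw [take_succ_eq_cons]
  rfl

variable [DecidableEq A]

theorem of_smul (a : A) (x : Boundary A) : FreeGroup.of a • x = letterMul (a, true) x := by
  change (FreeGroup.lift fun a : A => letterPerm (a, true)) (FreeGroup.of a) x = _
  rw [FreeGroup.lift_apply_of]
  rfl

theorem mk_singleton_smul (d : A × Bool) (x : Boundary A) :
    FreeGroup.mk [d] • x = letterMul d x := by
  obtain ⟨a, b⟩ := d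
  cases b
  · have h : FreeGroup.mk [(a, false)] = (FreeGroup.of a)⁻¹ := rfl
    rw [h, inv_smul_eq_iff, of_smul]
    exact ((letterPerm (a, true)).right_inv x).symm
  · exact of_smul a x

theorem mk_smul_of_ne {d : A × Bool} {x : Boundary A} (h : x.letter 0 ≠ letterInv d) :
    FreeGroup.mk [d] • x = x.cons d h := by
  rw [mk_singleton_smul, letterMul, dif_neg h]

theorem mk_smul_of_eq {d : A × Bool} {x : Boundary A} (h : x.letter 0 = letterInv d) :
    FreeGroup.mk [d] • x = x.tail := by
  rw [mk_singleton_smul, letterMul, dif_pos h]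

/-- Reducedness at the junction means that no letter cancels, so multiplication is plain
concatenation. -/
theorem take_mk_smul {w : List (A × Bool)} {x : Boundary A}
    (h : FreeGroup.IsReduced (w ++ [x.letter 0])) (n : ℕ) :
    (FreeGroup.mk w • x).take (w.length + n) = w ++ x.take n := by
  induction w with
  | nil => rw [← FreeGroup.one_eq_mk, one_smul]; simp
  | cons d w ih =>
    have h' : FreeGroup.IsReduced (w ++ [x.letter 0]) := h.infix ⟨[d], [], by simp⟩
    have h0 : (FreeGroup.mk w • x).letter 0 ≠ letterInv d := by
      have h1 := ih h'
      cases w with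
      | nil =>
        rw [← FreeGroup.one_eq_mk, one_smul]
        simpa [isReduced_iff_isChain] using h
      | cons c w =>
        rw [letter_zero_of_take h1]
        simp only [isReduced_iff_isChain, List.cons_append, List.isChain_cons_cons] at h
        exact h.1
    rw [mk_cons, mul_smul, mk_smul_of_ne h0, List.length_cons, add_right_comm, cons_take_succ,
      ih h', List.cons_append]

theorem inv_mk_take_smul (x : Boundary A) (n : ℕ) :
    (FreeGroup.mk (x.take n))⁻¹ • x = tail^[n] x := by
  induction n generalizing x with
  | zero => rw [take_zero, ← FreeGroup.one_eq_mk, inv_one, one_smul]; rfl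
  | succ n ih =>
    rw [take_succ_eq_cons, mk_cons, mul_inv_rev, mul_smul, ← mk_letterInv,
      mk_smul_of_eq (letterInv_letterInv _).symm, ih, Function.iterate_succ_apply]

instance : ContinuousConstSMul (FreeGroup A) (Boundary A) := by
  have hd : ∀ d : A × Bool, Continuous (letterMul d) := fun d => by
    classical
    refine continuous_of_letter fun n => ?_
    have : (fun y : Boundary A => (letterMul d y).letter n) =
        (fun p : (A × Bool) × (A × Bool) × (A × Bool) => if p.1 = letterInv d then p.2.1 else
          if n = 0 then d else p.2.2) ∘ fun y : Boundary A =>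
            (y.letter 0, y.letter (n + 1), y.letter (n - 1)) := by
      funext y
      simp only [Function.comp]
      by_cases h : y.letter 0 = letterInv d
      · rw [letterMul, dif_pos h, if_pos h]; rfl
      · rw [letterMul, dif_neg h, if_neg h]
        cases n <;> rfl
    rw [this]
    exact ((isLocallyConstant_letter 0).prodMk
      ((isLocallyConstant_letter _).prodMk (isLocallyConstant_letter _))).comp _
  refine ⟨fun g => ?_⟩
  induction g using Quot.inductionOn with
  | h w =>
    change Continuous fun x => FreeGroup.mk w • x
    induction w with
    | nil => simp only [← FreeGroup.one_eq_mk, one_smul]; exact continuous_id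
    | cons d w ih =>
      have h : (fun x : Boundary A => FreeGroup.mk (d :: w) • x) =
          fun x => letterMul d (FreeGroup.mk w • x) := by
        funext x
        rw [mk_cons, mul_smul, mk_singleton_smul]
      rw [h]
      exact (hd d).comp ih

end Action

end Boundary

end TrainTrack

/-! ### Geometry of the Cayley tree and convergence to the boundary -/

namespace TrainTrack

section WordGeometry

variable {A : Type*} [DecidableEq A]

theorem toWord_mul_mk_singleton (g : FreeGroup A) (d : A × Bool) :
    (∃ w, g.toWord = w ++ [letterInv d] ∧ (g * FreeGroup.mk [d]).toWord = w) ∨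
      (g * FreeGroup.mk [d]).toWord = g.toWord ++ [d] := by
  by_cases h : ∃ w, g.toWord = w ++ [letterInv d]
  · obtain ⟨w, hw⟩ := h
    refine Or.inl ⟨w, hw, ?_⟩
    have h1 : g = FreeGroup.mk w * (FreeGroup.mk [d])⁻¹ := by
      rw [← FreeGroup.mk_toWord (x := g), hw, ← FreeGroup.mul_mk, Boundary.mk_letterInv]
    rw [h1, inv_mul_cancel_right, FreeGroup.toWord_mk]
    exact (FreeGroup.isReduced_toWord.infix
      (hw ▸ (List.prefix_append w [letterInv d]).isInfix)).reduce_eq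
  · right
    have h1 : FreeGroup.IsReduced (g.toWord ++ [d]) := by
      rw [isReduced_append_iff]
      refine ⟨FreeGroup.isReduced_toWord, FreeGroup.IsReduced.singleton, ?_⟩
      intro c hc d' hd' hcd
      obtain rfl : d = d' := by simpa using hd'
      obtain ⟨w, hw⟩ := List.getLast?_eq_some_iff.1 hc
      exact h ⟨w, by rw [hcd, letterInv_letterInv, hw]⟩
    conv_lhs => rw [← FreeGroup.mk_toWord (x := g), FreeGroup.mul_mk, FreeGroup.toWord_mk]
    exact h1.reduce_eq

/-- Each letter of `u` changes the reduced word only at its end and shortens it by at most one, so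
the letters of `u` cannot eat into `p`. -/
theorem prefix_toWord_mul_mk {g : FreeGroup A} {p u : List (A × Bool)} (hp : p <+: g.toWord)
    (hl : p.length + u.length ≤ g.norm) : p <+: (g * FreeGroup.mk u).toWord := by
  induction u generalizing g with
  | nil => rwa [← FreeGroup.one_eq_mk, mul_one]
  | cons d u ih =>
    rw [Boundary.mk_cons, ← mul_assoc]
    rw [List.length_cons] at hl
    rcases toWord_mul_mk_singleton g d with ⟨w, h1, h2⟩ | h
    · have h3 : g.norm = w.length + 1 := by rw [FreeGroup.norm, h1]; simp
      refine ih ?_ (by rw [FreeGroup.norm, h2]; omega)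
      rw [h2]
      exact List.prefix_of_prefix_length_le hp (h1 ▸ List.prefix_append _ _) (by omega)
    · refine ih (h ▸ hp.trans (List.prefix_append _ _)) ?_
      rw [FreeGroup.norm, h, List.length_append, ← FreeGroup.norm]
      omega

/-- Here `(g⁻¹ * h).norm` is the distance in the tree: a path from `g` too short to return to the
vertex `p` and pass it stays in the branch behind `p`. -/
theorem prefix_toWord_of_dist_le {g h : FreeGroup A} {p : List (A × Bool)} (hp : p <+: g.toWord)
    (hl : p.length + (g⁻¹ * h).norm ≤ g.norm) : p <+: h.toWord := by
  have := prefix_toWord_mul_mk (u := (g⁻¹ * h).toWord) hp hl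
  rwa [FreeGroup.mk_toWord, mul_inv_cancel_left] at this

theorem norm_dist_comm (g h : FreeGroup A) : (g⁻¹ * h).norm = (h⁻¹ * g).norm := by
  rw [← FreeGroup.norm_inv_eq, mul_inv_rev, inv_inv]

theorem norm_dist_triangle (g h k : FreeGroup A) :
    (g⁻¹ * k).norm ≤ (g⁻¹ * h).norm + (h⁻¹ * k).norm := by
  have := FreeGroup.norm_mul_le (g⁻¹ * h) (h⁻¹ * k)
  rwa [mul_assoc, mul_inv_cancel_left] at this

theorem finite_norm_le [Finite A] (C : ℕ) : {g : FreeGroup A | g.norm ≤ C}.Finite := by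
  refine ((List.finite_length_le (A × Bool) C).image FreeGroup.mk).subset fun g hg => ?_
  exact ⟨g.toWord, hg, FreeGroup.mk_toWord⟩

/-- The sequence `g` of elements of the free group converges to the boundary point `ξ`. -/
def ConvergesTo (g : ℕ → FreeGroup A) (ξ : Boundary A) : Prop :=
  ∀ k, ∀ᶠ n in atTop, ξ.take k <+: (g n).toWord

theorem toWord_mk_take (x : Boundary A) (n : ℕ) : (FreeGroup.mk (x.take n)).toWord = x.take n := by
  rw [FreeGroup.toWord_mk]
  exact (x.isReduced_take n).reduce_eq

theorem norm_mk_take (x : Boundary A) (n : ℕ) : (FreeGroup.mk (x.take n)).norm = n := by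
  rw [FreeGroup.norm, toWord_mk_take, Boundary.length_take]

theorem convergesTo_mk_take (x : Boundary A) :
    ConvergesTo (fun n => FreeGroup.mk (x.take n)) x := fun k => by
  filter_upwards [eventually_ge_atTop k] with n hn
  rw [toWord_mk_take]
  exact x.take_prefix hn

theorem norm_step_mk_take (x : Boundary A) (n : ℕ) :
    ((FreeGroup.mk (x.take n))⁻¹ * FreeGroup.mk (x.take (n + 1))).norm ≤ 1 := by
  rw [Boundary.take_succ, ← FreeGroup.mul_mk, inv_mul_cancel_left]
  exact FreeGroup.norm_mk_le

/-- Once all norms exceed k + C, a step of size `C` cannot change the first `k` letters. The stable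
prefixes fit together to the limit. -/
theorem exists_convergesTo {g : ℕ → FreeGroup A} {C : ℕ}
    (hstep : ∀ n, ((g n)⁻¹ * g (n + 1)).norm ≤ C) (hg : Tendsto (fun n => (g n).norm) atTop atTop) :
    ∃ ξ, ConvergesTo g ξ := by
  have h1 : ∀ k, ∃ n₀, ∀ n ≥ n₀, (g n₀).toWord.take k <+: (g n).toWord ∧ k ≤ (g n).norm := by
    intro k
    obtain ⟨n₀, hn₀⟩ := eventually_atTop.1 (hg.eventually_ge_atTop (k + C))
    refine ⟨n₀, fun n hn => ⟨?_, by have := hn₀ n hn; omega⟩⟩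
    induction n, hn using Nat.le_induction with
    | base => exact List.take_prefix _ _
    | succ n hn ih =>
      refine prefix_toWord_of_dist_le ih ?_
      have h1 := hn₀ n hn
      have h2 := hstep n
      have h3 := List.length_take_le k (g n₀).toWord
      omega
  choose N hN using h1
  set W : ℕ → List (A × Bool) := fun k => (g (N k)).toWord.take k with hW
  have hl : ∀ k, (W k).length = k := fun k => by
    rw [hW, List.length_take, min_eq_left]
    exact (hN k (N k) le_rfl).2
  obtain ⟨ξ, hξ⟩ := Boundary.exists_of_words hl
    (fun k => List.prefix_of_prefix_length_le (hN k _ (le_max_left _ (N (k + 1)))).1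
      (hN (k + 1) _ (le_max_right _ _)).1 ((hl k).trans_le (k.le_succ.trans (hl (k + 1)).ge)))
    (fun k => FreeGroup.isReduced_toWord.infix (List.take_prefix _ _).isInfix)
  refine ⟨ξ, fun k => ?_⟩
  filter_upwards [eventually_ge_atTop (N k)] with n hn
  rw [hξ]
  exact (hN k n hn).1

/-- A convergent sequence with bounded steps has the initial subword of its limit as soon as it
stays far away from the identity. -/
theorem ConvergesTo.prefix_of_norm_ge {g : ℕ → FreeGroup A} {ξ : Boundary A} {C k n₀ : ℕ}
    (hξ : ConvergesTo g ξ) (hstep : ∀ n, ((g n)⁻¹ * g (n + 1)).norm ≤ C)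
    (hn₀ : ∀ n ≥ n₀, k + C ≤ (g n).norm) : ξ.take k <+: (g n₀).toWord := by
  have h : ∀ n ≥ n₀, ξ.take k <+: (g n).toWord → ξ.take k <+: (g n₀).toWord := by
    intro n hn
    induction n, hn using Nat.le_induction with
    | base => exact id
    | succ n hn ih =>
      intro h
      refine ih (prefix_toWord_of_dist_le h ?_)
      rw [norm_dist_comm, Boundary.length_take]
      have h1 := hn₀ (n + 1) (by omega)
      have h2 := hstep n
      omega
  obtain ⟨n, hn, hn'⟩ := ((hξ k).and (eventually_ge_atTop n₀)).exists
  exact h n hn' hn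

/-- The branch behind the k-th vertex of the ray can only be entered through that vertex. The
sequence starts outside at time `m` and ends up inside, so some term lies within one step of it. -/
theorem ConvergesTo.exists_near {g : ℕ → FreeGroup A} {ξ : Boundary A} {C k m : ℕ}
    (hξ : ConvergesTo g ξ) (hstep : ∀ n, ((g n)⁻¹ * g (n + 1)).norm ≤ C)
    (hk : (g m).norm < k) : ∃ n ≥ m, ((FreeGroup.mk (ξ.take k))⁻¹ * g n).norm ≤ C := by
  by_contra! hfar
  have h : ∀ n ≥ m, ¬ ξ.take k <+: (g n).toWord := by
    intro n hn
    induction n, hn using Nat.le_induction with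
    | base =>
      intro h
      have := h.length_le
      rw [Boundary.length_take] at this
      exact absurd hk (not_lt.2 this)
    | succ n hn ih =>
      intro h
      obtain ⟨q, hq⟩ := h
      have h1 : (FreeGroup.mk (ξ.take k))⁻¹ * g (n + 1) = FreeGroup.mk q := by
        rw [← FreeGroup.mk_toWord (x := g (n + 1)), ← hq, ← FreeGroup.mul_mk, inv_mul_cancel_left]
      have h2 : C < q.length := by
        have := hfar (n + 1) (by omega)
        rw [h1] at this
        exact this.trans_le FreeGroup.norm_mk_le
      refine ih (prefix_toWord_of_dist_le ⟨q, hq⟩ ?_)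
      have h3 : (g (n + 1)).norm = (ξ.take k).length + q.length := by
        rw [FreeGroup.norm, ← hq, List.length_append]
      rw [norm_dist_comm, h3]
      have := hstep n
      omega
  obtain ⟨n, hn, hn'⟩ := ((hξ k).and (eventually_ge_atTop m)).exists
  exact h n hn' hn

theorem ConvergesTo.frequently_near {g g' : ℕ → FreeGroup A} {ξ : Boundary A} {C C' : ℕ}
    (hg : ConvergesTo g ξ) (hstep : ∀ n, ((g n)⁻¹ * g (n + 1)).norm ≤ C)
    (hg' : ConvergesTo g' ξ) (hstep' : ∀ n, ((g' n)⁻¹ * g' (n + 1)).norm ≤ C') (k₀ : ℕ) :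
    ∃ n ≥ k₀, ∃ m ≥ k₀, ((g n)⁻¹ * g' m).norm ≤ C + C' := by
  set k := max (g k₀).norm (g' k₀).norm + 1
  obtain ⟨n, hn, h1⟩ := hg.exists_near hstep (k := k) (m := k₀)
    (Nat.lt_succ_of_le (le_max_left _ _))
  obtain ⟨m, hm, h2⟩ := hg'.exists_near hstep' (k := k) (m := k₀)
    (Nat.lt_succ_of_le (le_max_right _ _))
  refine ⟨n, hn, m, hm, (norm_dist_triangle _ (FreeGroup.mk (ξ.take k)) _).trans ?_⟩
  rw [norm_dist_comm]
  omega

/-- Far out, points at bounded distance share long prefixes. Together with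
`ConvergesTo.frequently_near` this characterises equality of limits by repeated closeness, which is
invariant under injective homomorphisms in both directions. -/
theorem ConvergesTo.eq_of_frequently_near {g g' : ℕ → FreeGroup A} {ξ ξ' : Boundary A} {D : ℕ}
    (hg : ConvergesTo g ξ) (hg' : ConvergesTo g' ξ')
    (h : ∀ k₀, ∃ n ≥ k₀, ∃ m ≥ k₀, ((g n)⁻¹ * g' m).norm ≤ D) : ξ = ξ' := by
  refine Boundary.ext_take fun k => ?_
  obtain ⟨k₀, hk₀⟩ := eventually_atTop.1 ((hg (k + D)).and (hg' k))
  obtain ⟨n, hn, m, hm, hd⟩ := h k₀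
  have h1 : ξ.take k <+: (g' m).toWord := by
    refine prefix_toWord_of_dist_le ((ξ.take_prefix (Nat.le_add_right k D)).trans (hk₀ n hn).1) ?_
    have := (hk₀ n hn).1.length_le
    rw [Boundary.length_take] at this ⊢
    change k + D ≤ (g n).norm at this
    omega
  exact (List.prefix_of_prefix_length_le h1 (hk₀ m hm).2 (by simp)).eq_of_length (by simp)

theorem ConvergesTo.unique {g : ℕ → FreeGroup A} {ξ ξ' : Boundary A} (hg : ConvergesTo g ξ)
    (hg' : ConvergesTo g ξ') : ξ = ξ' :=
  hg.eq_of_frequently_near (D := 0) hg' fun k₀ => ⟨k₀, le_rfl, k₀, le_rfl, by simp⟩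

theorem ConvergesTo.tendsto_norm {g : ℕ → FreeGroup A} {ξ : Boundary A} (hg : ConvergesTo g ξ) :
    Tendsto (fun n => (g n).norm) atTop atTop := by
  refine tendsto_atTop.2 fun k => ?_
  filter_upwards [hg k] with n hn
  have := hn.length_le
  rwa [Boundary.length_take] at this

theorem ConvergesTo.of_near {g : ℕ → FreeGroup A} {ξ : Boundary A} {D : ℕ}
    (h : ∀ n, ((FreeGroup.mk (ξ.take n))⁻¹ * g n).norm ≤ D) : ConvergesTo g ξ := fun k => by
  filter_upwards [eventually_ge_atTop (k + D)] with n hn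
  refine prefix_toWord_of_dist_le (g := FreeGroup.mk (ξ.take n)) ?_ ?_
  · rw [toWord_mk_take]
    exact ξ.take_prefix (by omega)
  · rw [norm_mk_take, Boundary.length_take]
    have := h n
    omega

/-- One extra letter of agreement is required because a cancellation may use it up. -/
theorem prefix_mk_singleton_smul {η : Boundary A} {a : FreeGroup A} {k : ℕ} (d : A × Bool)
    (h : η.take (k + 1) <+: a.toWord) :
    (FreeGroup.mk [d] • η).take k <+: (FreeGroup.mk [d] * a).toWord := by
  obtain ⟨t, ht⟩ := h
  have ha : FreeGroup.mk [d] * a = FreeGroup.mk (d :: (η.take (k + 1) ++ t)) := by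
    rw [ht, Boundary.mk_cons d a.toWord, FreeGroup.mk_toWord]
  have hr : FreeGroup.IsReduced (η.take (k + 1) ++ t) := ht ▸ FreeGroup.isReduced_toWord
  by_cases hd : η.letter 0 = letterInv d
  · rw [Boundary.mk_smul_of_eq hd]
    rw [Boundary.take_succ_eq_cons, List.cons_append] at hr ha
    have h1 : FreeGroup.mk [d] * a = FreeGroup.mk (η.tail.take k ++ t) := by
      rw [ha, Boundary.mk_cons, Boundary.mk_cons (η.letter 0), hd, Boundary.mk_letterInv,
        mul_inv_cancel_left]
    rw [h1, FreeGroup.toWord_mk, (hr.infix ⟨[η.letter 0], [], by simp⟩ :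
      FreeGroup.IsReduced (η.tail.take k ++ t)).reduce_eq]
    exact List.prefix_append _ _
  · rw [Boundary.mk_smul_of_ne hd, ha, FreeGroup.toWord_mk, FreeGroup.IsReduced.reduce_eq]
    · refine ((η.cons d hd).take_prefix (Nat.le_add_right k 2)).trans ?_
      rw [Boundary.cons_take_succ]
      exact ⟨t, rfl⟩
    · rw [Boundary.take_succ_eq_cons, List.cons_append, isReduced_iff_isChain] at hr ⊢
      exact List.isChain_cons_cons.2 ⟨hd, hr⟩

theorem ConvergesTo.mul_left {g : ℕ → FreeGroup A} {ξ : Boundary A} (hg : ConvergesTo g ξ)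
    (h : FreeGroup A) : ConvergesTo (fun n => h * g n) (h • ξ) := by
  induction h using Quot.inductionOn with
  | h w =>
    change ConvergesTo (fun n => FreeGroup.mk w * g n) (FreeGroup.mk w • ξ)
    induction w with
    | nil => simpa [← FreeGroup.one_eq_mk] using hg
    | cons d w ih =>
      intro k
      filter_upwards [ih (k + 1)] with n hn
      rw [Boundary.mk_cons d w, mul_smul, mul_assoc]
      exact prefix_mk_singleton_smul d hn

end WordGeometry

/-! ### Boundary maps of injective homomorphisms -/

section BoundaryMap

variable {A B : Type*} [DecidableEq A] [DecidableEq B] {ψ : FreeGroup A →* FreeGroup B}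

theorem exists_norm_map_le [Finite A] (ψ : FreeGroup A →* FreeGroup B) (C : ℕ) :
    ∃ C', ∀ g : FreeGroup A, g.norm ≤ C → (ψ g).norm ≤ C' := by
  obtain ⟨C', hC'⟩ := ((finite_norm_le (A := A) C).image fun g => (ψ g).norm).bddAbove
  exact ⟨C', fun g hg => hC' ⟨g, hg, rfl⟩⟩

/-- Balls are finite, so injectivity makes the homomorphism proper. This weak control replaces
quasi-isometry estimates in the construction of the boundary map. -/
theorem exists_norm_le_of_map [Finite B] (hψ : Function.Injective ψ) (C : ℕ) :
    ∃ C', ∀ g : FreeGroup A, (ψ g).norm ≤ C → g.norm ≤ C' := by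
  obtain ⟨C', hC'⟩ := (((finite_norm_le (A := B) C).preimage hψ.injOn).image
    fun g => g.norm).bddAbove
  exact ⟨C', fun g hg => hC' ⟨g, hg, rfl⟩⟩

theorem tendsto_norm_map [Finite B] (hψ : Function.Injective ψ) {g : ℕ → FreeGroup A}
    (hg : Tendsto (fun n => (g n).norm) atTop atTop) :
    Tendsto (fun n => (ψ (g n)).norm) atTop atTop := by
  refine tendsto_atTop.2 fun R => ?_
  obtain ⟨C', hC'⟩ := exists_norm_le_of_map hψ R
  filter_upwards [hg.eventually_gt_atTop C'] with n hn
  by_contra h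
  exact absurd (hC' (g n) (by omega)) (by omega)

theorem norm_map_dist_le {C C' : ℕ} (h : ∀ g : FreeGroup A, g.norm ≤ C → (ψ g).norm ≤ C')
    {a b : FreeGroup A} (hab : (a⁻¹ * b).norm ≤ C) : ((ψ a)⁻¹ * ψ b).norm ≤ C' := by
  rw [← map_inv, ← map_mul]
  exact h _ hab

theorem exists_convergesTo_map [Finite A] [Finite B] (hψ : Function.Injective ψ) (x : Boundary A) :
    ∃ ξ, ConvergesTo (fun n => ψ (FreeGroup.mk (x.take n))) ξ := by
  obtain ⟨C, hC⟩ := exists_norm_map_le ψ 1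
  exact exists_convergesTo (C := C) (fun n => norm_map_dist_le hC (norm_step_mk_take x n))
    (tendsto_norm_map hψ (by simp only [norm_mk_take]; exact tendsto_id))

/-- The map of boundaries induced by an injective homomorphism of free groups. -/
noncomputable def inducedMap [Finite A] [Finite B] (hψ : Function.Injective ψ) (x : Boundary A) :
    Boundary B :=
  (exists_convergesTo_map hψ x).choose

variable [Finite A] [Finite B] (hψ : Function.Injective ψ)

theorem convergesTo_inducedMap (x : Boundary A) :
    ConvergesTo (fun n => ψ (FreeGroup.mk (x.take n))) (inducedMap hψ x) :=
  (exists_convergesTo_map hψ x).choose_spec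

/-- The limit may be computed along any bounded-step sequence tending to `x`: such a sequence comes
close to the prefixes of `x` arbitrarily far out, and the homomorphism preserves closeness. -/
theorem eq_inducedMap_of_convergesTo {g : ℕ → FreeGroup A} {x : Boundary A} {ξ : Boundary B}
    {C : ℕ} (hstep : ∀ n, ((g n)⁻¹ * g (n + 1)).norm ≤ C) (hg : ConvergesTo g x)
    (hψg : ConvergesTo (fun n => ψ (g n)) ξ) : ξ = inducedMap hψ x := by
  obtain ⟨D, hD⟩ := exists_norm_map_le ψ (C + 1)
  refine hψg.eq_of_frequently_near (D := D) (convergesTo_inducedMap hψ x) fun k₀ => ?_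
  obtain ⟨n, hn, m, hm, h⟩ := hg.frequently_near hstep (convergesTo_mk_take x)
    (norm_step_mk_take x) k₀
  exact ⟨n, hn, m, hm, norm_map_dist_le hD h⟩

theorem inducedMap_injective : Function.Injective (inducedMap hψ) := by
  intro x y hxy
  obtain ⟨C, hC⟩ := exists_norm_map_le ψ 1
  obtain ⟨D, hD⟩ := exists_norm_le_of_map hψ (C + C)
  refine (convergesTo_mk_take x).eq_of_frequently_near (D := D) (convergesTo_mk_take y)
    fun k₀ => ?_
  obtain ⟨n, hn, m, hm, h⟩ := (convergesTo_inducedMap hψ x).frequently_near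
    (fun n => norm_map_dist_le hC (norm_step_mk_take x n)) (hxy ▸ convergesTo_inducedMap hψ y)
    (fun n => norm_map_dist_le hC (norm_step_mk_take y n)) k₀
  refine ⟨n, hn, m, hm, hD _ ?_⟩
  rwa [map_mul, map_inv]

theorem inducedMap_smul (h : FreeGroup A) (x : Boundary A) :
    inducedMap hψ (h • x) = ψ h • inducedMap hψ x := by
  symm
  refine eq_inducedMap_of_convergesTo hψ (g := fun n => h * FreeGroup.mk (x.take n)) (C := 1)
    (fun n => ?_) ((convergesTo_mk_take x).mul_left h) ?_
  · rw [mul_inv_rev, mul_assoc, inv_mul_cancel_left]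
    exact norm_step_mk_take x n
  · simp only [map_mul]
    exact (convergesTo_inducedMap hψ x).mul_left (ψ h)

/-- Preimages of points near the ray have bounded steps by properness, and they leave every ball
because their images do; so they converge to a preimage of `ξ`. -/
theorem exists_inducedMap_eq {ξ : Boundary B} {D : ℕ}
    (h : ∀ n, ∃ g, ((FreeGroup.mk (ξ.take n))⁻¹ * ψ g).norm ≤ D) : ∃ x, inducedMap hψ x = ξ := by
  choose g hg using h
  obtain ⟨C, hC⟩ := exists_norm_le_of_map hψ (D + 1 + D)
  have hstep : ∀ n, ((g n)⁻¹ * g (n + 1)).norm ≤ C := fun n => by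
    refine hC _ ?_
    rw [map_mul, map_inv]
    have h1 := norm_dist_triangle (ψ (g n)) (FreeGroup.mk (ξ.take n)) (ψ (g (n + 1)))
    have h2 := norm_dist_triangle (FreeGroup.mk (ξ.take n)) (FreeGroup.mk (ξ.take (n + 1)))
      (ψ (g (n + 1)))
    have h3 := norm_step_mk_take ξ n
    have h4 := hg n
    have h5 := hg (n + 1)
    rw [norm_dist_comm] at h4
    omega
  have hξ : ConvergesTo (fun n => ψ (g n)) ξ := ConvergesTo.of_near hg
  obtain ⟨x, hx⟩ := exists_convergesTo hstep (tendsto_atTop.2 fun R => by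
    obtain ⟨R', hR'⟩ := exists_norm_map_le ψ R
    filter_upwards [hξ.tendsto_norm.eventually_gt_atTop R'] with n hn
    by_contra hlt
    exact absurd (hR' (g n) (by omega)) (by omega))
  exact ⟨x, (eq_inducedMap_of_convergesTo hψ hstep hx hξ).symm⟩

/-- Properness gives a time, the same for all `x`, after which images stay far from the identity. So
a fixed number of letters of `x` determines the first `k` letters of the image. -/
theorem isLocallyConstant_take_inducedMap (k : ℕ) :
    IsLocallyConstant fun x => (inducedMap hψ x).take k := by
  obtain ⟨C, hC⟩ := exists_norm_map_le ψ 1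
  obtain ⟨n₀, hn₀⟩ := exists_norm_le_of_map hψ (k + C)
  have h : ∀ x, (inducedMap hψ x).take k <+: (ψ (FreeGroup.mk (x.take (n₀ + 1)))).toWord := by
    intro x
    refine (convergesTo_inducedMap hψ x).prefix_of_norm_ge (C := C) (n₀ := n₀ + 1)
      (fun n => norm_map_dist_le hC (norm_step_mk_take x n)) fun n hn => ?_
    by_contra hlt
    have := hn₀ _ (le_of_lt (not_le.1 hlt))
    rw [norm_mk_take] at this
    omega
  have h' : (fun x => (inducedMap hψ x).take k) = (fun w : List (A × Bool) =>
      (ψ (FreeGroup.mk w)).toWord.take k) ∘ fun x : Boundary A => x.take (n₀ + 1) := by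
    funext x
    have := List.prefix_iff_eq_take.1 (h x)
    rwa [Boundary.length_take] at this
  rw [h']
  exact (Boundary.isLocallyConstant_take _).comp _

theorem continuous_inducedMap : Continuous (inducedMap hψ) :=
  Boundary.continuous_of_take (isLocallyConstant_take_inducedMap hψ)

end BoundaryMap

end TrainTrack

/-! ### Rays in a graph and their extension -/

namespace TrainTrack

namespace EGraph

variable {V E : Type*} {Γ : EGraph V E}

theorem IsPath.red {p q : V} {w w' : List (E × Bool)} (hr : FreeGroup.Red w w')
    (h : Γ.IsPath p w q) : Γ.IsPath p w' q := by
  induction hr with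
  | refl => exact h
  | tail _ hstep ih =>
    obtain @⟨L₁, L₂, x, b⟩ := hstep
    obtain ⟨q', h1, h2⟩ := isPath_append_iff.1 ih
    obtain ⟨rfl, h3, h4⟩ := h2
    have h5 : Γ.t (x, !b) = Γ.o (x, b) := t_letterInv (x, b)
    rw [h5] at h4
    exact h1.append h4

/-- The oriented edges that can follow the oriented edge `l` in a reduced edge path. -/
def next (Γ : EGraph V E) (l : E × Bool) : Set (E × Bool) := {e | Γ.o e = Γ.t l ∧ e ≠ letterInv l}

theorem append_mem_reducedPaths_iff {u : List (E × Bool)} {l e : E × Bool}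
    (h : u ++ [l] ∈ Γ.reducedPaths) : (u ++ [l]) ++ [e] ∈ Γ.reducedPaths ↔ e ∈ Γ.next l := by
  obtain ⟨-, hr, p, q, hp⟩ := h
  obtain ⟨q', hp1, hp2, rfl⟩ := isPath_append_iff.1 hp
  constructor
  · rintro ⟨-, hr', p', q', hp'⟩
    obtain ⟨q₁, h1, h2, rfl⟩ := isPath_append_iff.1 hp'
    obtain ⟨q₂, h3, h4, rfl⟩ := isPath_append_iff.1 h1
    exact ⟨h2, (isReduced_append_iff.1 hr').2.2 l (by simp) e (by simp)⟩
  · rintro ⟨h1, h2⟩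
    refine ⟨by simp, isReduced_append_iff.2 ⟨hr, FreeGroup.IsReduced.singleton, ?_⟩, p, Γ.t e,
      hp.append ⟨h1, rfl⟩⟩
    intro c hc d hd
    obtain rfl : l = c := by simpa using hc
    obtain rfl : e = d := by simpa using hd
    exact h2

/-- Edges before `l` are recorded by their inverses, as directions `e` leaving the initial vertex of
`l` other than `l` itself; this is the mirror image of `append_mem_reducedPaths_iff`. -/
theorem cons_mem_reducedPaths_iff {u : List (E × Bool)} {l e : E × Bool}
    (h : l :: u ∈ Γ.reducedPaths) :
    letterInv e :: l :: u ∈ Γ.reducedPaths ↔ e ∈ Γ.next (letterInv l) := by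
  have hinv : ∀ {w : List (E × Bool)}, FreeGroup.invRev w ∈ Γ.reducedPaths ↔
      w ∈ Γ.reducedPaths := fun {w} =>
    ⟨fun h => by simpa using invRev_mem_reducedPaths h, invRev_mem_reducedPaths⟩
  have h' : FreeGroup.invRev u ++ [letterInv l] ∈ Γ.reducedPaths := by
    rw [← invRev_singleton, ← FreeGroup.invRev_cons]
    exact hinv.2 h
  rw [← append_mem_reducedPaths_iff h', ← hinv, FreeGroup.invRev_cons (a := letterInv e),
    FreeGroup.invRev_cons (a := l), invRev_singleton, invRev_singleton, letterInv_letterInv]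

section Switch

variable [Finite E] {a : List (E × Bool) → ℝ}

/-- The switch condition at the end of a path, as a finite sum. -/
theorem _root_.TrainTrack.SwitchConditions.sum_next (ha : SwitchConditions Γ a)
    {u : List (E × Bool)} {l : E × Bool} (h : u ++ [l] ∈ Γ.reducedPaths) :
    ∑ e ∈ (Set.toFinite (Γ.next l)).toFinset, a (u ++ [l] ++ [e]) = a (u ++ [l]) := by
  rw [← ha.right _ h, ← finsum_mem_eq_finite_toFinset_sum]
  have : Γ.next l = {e | u ++ [l] ++ [e] ∈ Γ.reducedPaths} :=
    Set.ext fun e => (append_mem_reducedPaths_iff h).symm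
  rw [this]

/-- The switch condition at the beginning of a path, as a finite sum. -/
theorem _root_.TrainTrack.SwitchConditions.sum_next_letterInv (ha : SwitchConditions Γ a)
    {u : List (E × Bool)} {l : E × Bool} (h : l :: u ∈ Γ.reducedPaths) :
    ∑ e ∈ (Set.toFinite (Γ.next (letterInv l))).toFinset, a (letterInv e :: l :: u) =
      a (l :: u) := by
  have h' : FreeGroup.invRev u ++ [letterInv l] ∈ Γ.reducedPaths := by
    rw [← invRev_singleton, ← FreeGroup.invRev_cons]
    exact invRev_mem_reducedPaths h
  have h1 := ha.sum_next h'
  have hl : FreeGroup.invRev u ++ [letterInv l] = FreeGroup.invRev (l :: u) := by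
    rw [FreeGroup.invRev_cons, invRev_singleton]
  rw [hl, ha.inv _ h] at h1
  rw [← h1]
  refine Finset.sum_congr rfl fun e he => ?_
  have he' := (cons_mem_reducedPaths_iff h).2 ((Set.Finite.mem_toFinset _).1 he)
  rw [← ha.inv _ he', FreeGroup.invRev_cons, invRev_singleton, letterInv_letterInv]

end Switch

/-- The infinite reduced word `ξ` is a ray in `Γ` that begins at the vertex `p`. -/
def IsRay (Γ : EGraph V E) (p : V) (ξ : Boundary E) : Prop := ∀ k, ∃ q, Γ.IsPath p (ξ.take k) q

theorem IsRay.o_letter {p : V} {ξ : Boundary E} (h : Γ.IsRay p ξ) : Γ.o (ξ.letter 0) = p := by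
  obtain ⟨q, hq⟩ := h 1
  exact hq.1

theorem isRay_of_letter {ξ : Boundary E}
    (h : ∀ n, Γ.o (ξ.letter (n + 1)) = Γ.t (ξ.letter n)) : Γ.IsRay (Γ.o (ξ.letter 0)) ξ := by
  have key : ∀ k, Γ.IsPath (Γ.o (ξ.letter 0)) (ξ.take k) (Γ.o (ξ.letter k)) := by
    intro k
    induction k with
    | zero => exact rfl
    | succ k ih =>
      rw [Boundary.take_succ]
      exact ih.append ⟨rfl, (h k).symm⟩
  exact fun k => ⟨_, key k⟩

theorem IsRay.tail {p : V} {ξ : Boundary E} (h : Γ.IsRay p ξ) :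
    Γ.IsRay (Γ.t (ξ.letter 0)) ξ.tail := fun k => by
  obtain ⟨q, hq⟩ := h (k + 1)
  rw [Boundary.take_succ_eq_cons] at hq
  exact ⟨q, hq.2⟩

theorem IsRay.of_add {p : V} {ξ : Boundary E} (m : ℕ)
    (h : ∀ k, ∃ q, Γ.IsPath p (ξ.take (m + k)) q) : Γ.IsRay p ξ := fun k => by
  obtain ⟨q, hq⟩ := h k
  obtain ⟨t, ht⟩ := ξ.take_prefix (Nat.le_add_left k m)
  rw [← ht] at hq
  obtain ⟨q', h1, -⟩ := isPath_append_iff.1 hq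
  exact ⟨q', h1⟩

theorem IsRay.letter_succ_mem_next {p : V} {ξ : Boundary E} (h : Γ.IsRay p ξ) (n : ℕ) :
    ξ.letter (n + 1) ∈ Γ.next (ξ.letter n) := by
  refine ⟨?_, ξ.2 n⟩
  obtain ⟨q, hq⟩ := h (n + 2)
  rw [Boundary.take_succ, Boundary.take_succ, List.append_assoc] at hq
  obtain ⟨q', -, h2⟩ := isPath_append_iff.1 hq
  exact h2.2.1

/-- The inverse of an edge already leaves its terminal vertex. Since the valence is not one, another
edge does too, and the path can be continued for ever without backtracking. -/
theorem exists_ray_of_path (hΓ : Γ.IsCore) {p q : V} {w : List (E × Bool)}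
    {l : E × Bool} (hr : FreeGroup.IsReduced (w ++ [l])) (hp : Γ.IsPath p (w ++ [l]) q) :
    ∃ ξ, Γ.IsRay p ξ ∧ ξ.take (w.length + 1) = w ++ [l] := by
  classical
  have hnext : ∀ d, ∃ e, e ∈ Γ.next d := by
    intro d
    by_contra! hne
    refine hΓ.valence_ne_one (Γ.t d) (Set.ncard_eq_one.2 ⟨letterInv d, ?_⟩)
    ext e
    simp only [Set.mem_ofPred_eq, Set.mem_singleton_iff]
    constructor
    · intro he
      by_contra h
      exact hne e ⟨he, h⟩
    · rintro rfl
      exact o_letterInv d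
  choose nx hnx using hnext
  have hs : ∀ n, nx^[n + 1] l = nx (nx^[n] l) := fun n => Function.iterate_succ_apply' nx n l
  obtain ⟨ζ, hζ⟩ : ∃ ζ : Boundary E, ∀ n, ζ.letter n = nx^[n] l :=
    ⟨⟨fun n => nx^[n] l, fun n => by
      have h := (hnx (nx^[n] l)).2
      rwa [← hs] at h⟩, fun n => rfl⟩
  have h0 : ζ.letter 0 = l := hζ 0
  have hray : Γ.IsRay (Γ.o l) ζ := by
    rw [← h0]
    refine isRay_of_letter fun n => ?_
    rw [hζ, hζ, hs]
    exact (hnx _).1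
  have htake := Boundary.take_mk_smul (w := w) (x := ζ) (by rwa [h0])
  obtain ⟨q', hp1, hp2⟩ := isPath_append_iff.1 hp
  refine ⟨FreeGroup.mk w • ζ, IsRay.of_add w.length fun k => ?_, ?_⟩
  · rw [htake]
    obtain ⟨q'', h⟩ := hray k
    rw [hp2.1] at h
    exact ⟨q'', hp1.append h⟩
  · rw [htake, Boundary.take_succ, Boundary.take_zero, h0]
    rfl

variable [DecidableEq E]

theorem IsRay.inv_mk_smul {p q : V} {ξ : Boundary E} (h : Γ.IsRay p ξ) {w : List (E × Bool)}
    (hw : Γ.IsPath p w q) : Γ.IsRay q ((FreeGroup.mk w)⁻¹ • ξ) := by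
  induction w generalizing p ξ with
  | nil =>
    cases hw
    rwa [← FreeGroup.one_eq_mk, inv_one, one_smul]
  | cons d w ih =>
    obtain ⟨rfl, hw⟩ := hw
    rw [Boundary.mk_cons, mul_inv_rev, mul_smul]
    refine ih ?_ hw
    rw [← Boundary.mk_letterInv]
    by_cases hd : ξ.letter 0 = letterInv (letterInv d)
    · rw [Boundary.mk_smul_of_eq hd]
      have := h.tail
      rwa [hd, letterInv_letterInv] at this
    · rw [Boundary.mk_smul_of_ne hd]
      refine IsRay.of_add 1 fun k => ?_
      rw [add_comm, Boundary.cons_take_succ]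
      obtain ⟨q', hq'⟩ := h k
      refine ⟨q', o_letterInv d, ?_⟩
      rwa [t_letterInv]

end EGraph

/-! ### The boundary map of a marking -/

namespace Marking

variable {N : ℕ} {V E : Type*} {Γ : EGraph V E} (α : Marking N Γ)

/-- The marking as a homomorphism to the free group on the edges. -/
def hom : FreeGroup (Fin N) →* FreeGroup E := (Γ.pi1 α.base).subtype.comp α.iso.toMonoidHom

theorem hom_injective : Function.Injective α.hom :=
  Subtype.val_injective.comp α.iso.injective

theorem exists_isPath_hom (g : FreeGroup (Fin N)) :
    ∃ w, Γ.IsPath α.base w α.base ∧ FreeGroup.mk w = α.hom g := (α.iso g).2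

variable [DecidableEq E]

theorem isPath_toWord {q : V} {h : FreeGroup E} (hh : h ∈ α.vertexLifts q) :
    Γ.IsPath α.base h.toWord q := by
  obtain ⟨w, hw, rfl⟩ := hh
  rw [FreeGroup.toWord_mk]
  exact hw.red FreeGroup.reduce.red

variable [Finite E]

/-- The map `∂F_N → ∂Γ̃` induced by the marking. -/
noncomputable def bd : Boundary (Fin N) → Boundary E := inducedMap α.hom_injective

theorem boundaryMap_iff {x : Boundary (Fin N)} {ξ : Boundary E} :
    α.BoundaryMap x ξ ↔ ξ = α.bd x := by
  have h : ConvergesTo (fun n => α.hom (FreeGroup.mk (x.take n))) (α.bd x) :=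
    convergesTo_inducedMap α.hom_injective x
  constructor
  · intro h'
    exact ConvergesTo.unique (g := fun n => α.hom (FreeGroup.mk (x.take n))) h' h
  · rintro rfl
    exact h

theorem bd_smul (g : FreeGroup (Fin N)) (x : Boundary (Fin N)) :
    α.bd (g • x) = α.hom g • α.bd x := inducedMap_smul _ _ _

theorem bd_injective : Function.Injective α.bd := inducedMap_injective _

theorem isLocallyConstant_take_bd (n : ℕ) : IsLocallyConstant fun x => (α.bd x).take n :=
  isLocallyConstant_take_inducedMap _ n

theorem isRay_bd (x : Boundary (Fin N)) : Γ.IsRay α.base (α.bd x) := fun k => by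
  obtain ⟨n, hn⟩ := (convergesTo_inducedMap α.hom_injective x k).exists
  have h : Γ.IsPath α.base (α.hom (FreeGroup.mk (x.take n))).toWord α.base :=
    α.isPath_toWord (α.exists_isPath_hom _)
  obtain ⟨t, ht⟩ := hn
  rw [← ht] at h
  obtain ⟨q, hq, -⟩ := EGraph.isPath_append_iff.1 h
  exact ⟨q, hq⟩

/-- Finiteness and connectedness let every prefix of the ray be closed up to a loop at the base by a
path of bounded length. These loops are images of group elements staying near the ray. -/
theorem exists_bd_eq [Finite V] (hΓ : Γ.IsCore) {ξ : Boundary E} (hξ : Γ.IsRay α.base ξ) :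
    ∃ x, α.bd x = ξ := by
  choose c hc using fun q => hΓ.connected q α.base
  obtain ⟨D, hD⟩ : ∃ D, ∀ q, (c q).length ≤ D := by
    obtain ⟨D, hD⟩ := (Set.finite_range fun q => (c q).length).bddAbove
    exact ⟨D, fun q => hD ⟨q, rfl⟩⟩
  refine exists_inducedMap_eq α.hom_injective (D := D) fun n => ?_
  obtain ⟨q, hq⟩ := hξ n
  refine ⟨α.iso.symm ⟨FreeGroup.mk (ξ.take n ++ c q), _, hq.append (hc q), rfl⟩, ?_⟩
  have h : α.hom (α.iso.symm ⟨FreeGroup.mk (ξ.take n ++ c q), _, hq.append (hc q), rfl⟩) =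
      FreeGroup.mk (ξ.take n ++ c q) := by
    change ((α.iso (α.iso.symm _) : Γ.pi1 α.base) : FreeGroup E) = _
    rw [MulEquiv.apply_symm_apply]
  rw [h, ← FreeGroup.mul_mk, inv_mul_cancel_left]
  exact FreeGroup.norm_mk_le.trans (hD q)

theorem mem_cylinder_iff {h : FreeGroup E} {v : List (E × Bool)} {z : DoubleBoundary (Fin N)} :
    z ∈ α.cylinder h v ↔ (h⁻¹ • α.bd z.fst).letter 0 ≠ (h⁻¹ • α.bd z.snd).letter 0 ∧
      (h⁻¹ • α.bd z.snd).take v.length = v := by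
  constructor
  · rintro ⟨ξ, η, h1, h2, h3⟩
    rw [boundaryMap_iff] at h1 h2
    subst h1 h2
    exact h3
  · intro h'
    exact ⟨_, _, α.boundaryMap_iff.2 rfl, α.boundaryMap_iff.2 rfl, h'⟩

end Marking

end TrainTrack

/-! ### Geometry of cylinders -/

namespace TrainTrack

section WordGeometry

variable {A : Type*}

namespace Boundary

theorem isReduced_append_letter {w : List (A × Bool)} {l : A × Bool} {x : Boundary A}
    (hw : FreeGroup.IsReduced (w ++ [l])) (hx : x.letter 0 ≠ letterInv l) :
    FreeGroup.IsReduced (w ++ [l] ++ [x.letter 0]) := by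
  refine isReduced_append_iff.2 ⟨hw, FreeGroup.IsReduced.singleton, ?_⟩
  intro c hc d hd
  obtain rfl : l = c := by simpa using hc
  obtain rfl : x.letter 0 = d := by simpa using hd
  exact hx

theorem letter_of_take_append {x : Boundary A} {w : List (A × Bool)} {l : A × Bool}
    (h : x.take (w ++ [l]).length = w ++ [l]) : x.letter w.length = l := by
  rw [List.length_append, List.length_singleton, take_succ] at h
  simpa using (List.append_inj_right h (by simp))

end Boundary

variable [DecidableEq A]

theorem exists_split_of_not_prefix {a b : List (A × Bool)} (hab : ¬ a <+: b) (hba : ¬ b <+: a) :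
    ∃ c d a' d' b', a = c ++ d :: a' ∧ b = c ++ d' :: b' ∧ d ≠ d' := by
  induction a generalizing b with
  | nil => exact absurd List.nil_prefix hab
  | cons x a ih =>
    cases b with
    | nil => exact absurd List.nil_prefix hba
    | cons y b =>
      by_cases hxy : x = y
      · subst hxy
        obtain ⟨c, d, a', d', b', rfl, rfl, h⟩ := ih
          (fun h => hab (List.cons_prefix_cons.2 ⟨rfl, h⟩))
          (fun h => hba (List.cons_prefix_cons.2 ⟨rfl, h⟩))
        exact ⟨x :: c, d, a', d', b', rfl, rfl, h⟩
      · exact ⟨[], x, a, y, b, rfl, rfl, hxy⟩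

/-- If neither of two reduced words is an initial subword of the other, then the path between the
corresponding vertices of the tree begins with the inverse of the last letter of the first word,
and ends with the last letter of the second one. -/
theorem toWord_inv_mul_of_not_prefix {h k : FreeGroup A} (hhk : ¬ h.toWord <+: k.toWord)
    (hkh : ¬ k.toWord <+: h.toWord) :
    ∃ a b l r u w, h.toWord = a ++ [l] ∧ k.toWord = b ++ [r] ∧
      (h⁻¹ * k).toWord = letterInv l :: u ∧ (h⁻¹ * k).toWord = w ++ [r] := by
  obtain ⟨c, d, a', d', b', ha, hb, hd⟩ := exists_split_of_not_prefix hhk hkh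
  have hra : FreeGroup.IsReduced (d :: a') :=
    (ha ▸ FreeGroup.isReduced_toWord : FreeGroup.IsReduced (c ++ d :: a')).infix
      (List.suffix_append _ _).isInfix
  have hrb : FreeGroup.IsReduced (d' :: b') :=
    (hb ▸ FreeGroup.isReduced_toWord : FreeGroup.IsReduced (c ++ d' :: b')).infix
      (List.suffix_append _ _).isInfix
  have hw : (h⁻¹ * k).toWord = FreeGroup.invRev (d :: a') ++ d' :: b' := by
    have h1 : h⁻¹ * k = FreeGroup.mk (FreeGroup.invRev (d :: a') ++ d' :: b') := by
      rw [← FreeGroup.mk_toWord (x := h), ← FreeGroup.mk_toWord (x := k), ha, hb,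
        ← FreeGroup.mul_mk, ← FreeGroup.mul_mk, ← FreeGroup.mul_mk, ← FreeGroup.inv_mk,
        mul_inv_rev, mul_assoc, inv_mul_cancel_left]
    rw [h1, FreeGroup.toWord_mk, FreeGroup.IsReduced.reduce_eq]
    refine isReduced_append_iff.2 ⟨isReduced_invRev.2 hra, hrb, ?_⟩
    intro x hx y hy hxy
    rw [FreeGroup.invRev_cons, invRev_singleton] at hx
    obtain rfl : letterInv d = x := by simpa using hx
    obtain rfl : d' = y := by simpa using hy
    rw [letterInv_letterInv] at hxy
    exact hd hxy.symm
  obtain ⟨a₁, l, hl⟩ : ∃ a₁ l, d :: a' = a₁ ++ [l] :=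
    ⟨_, _, (List.dropLast_append_getLast (List.cons_ne_nil d a')).symm⟩
  obtain ⟨b₁, r, hr⟩ : ∃ b₁ r, d' :: b' = b₁ ++ [r] :=
    ⟨_, _, (List.dropLast_append_getLast (List.cons_ne_nil d' b')).symm⟩
  refine ⟨c ++ a₁, c ++ b₁, l, r, FreeGroup.invRev a₁ ++ d' :: b',
    FreeGroup.invRev (d :: a') ++ b₁, by rw [ha, hl, List.append_assoc],
    by rw [hb, hr, List.append_assoc], ?_, by rw [hw, hr, List.append_assoc]⟩
  rw [hw, hl, FreeGroup.invRev_append, invRev_singleton]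
  rfl

theorem toWord_inv_mul_mk_singleton {h k : FreeGroup A} {l e : A × Bool} {u : List (A × Bool)}
    (hu : (h⁻¹ * k).toWord = l :: u) (he : e ≠ l) :
    ((h * FreeGroup.mk [e])⁻¹ * k).toWord = letterInv e :: l :: u := by
  have h1 : (h * FreeGroup.mk [e])⁻¹ * k = FreeGroup.mk (letterInv e :: l :: u) := by
    rw [mul_inv_rev, ← Boundary.mk_letterInv, mul_assoc, ← FreeGroup.mk_toWord (x := h⁻¹ * k), hu,
      ← Boundary.mk_cons]
  rw [h1, FreeGroup.toWord_mk, FreeGroup.IsReduced.reduce_eq]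
  have h2 : FreeGroup.IsReduced (l :: u) := hu ▸ FreeGroup.isReduced_toWord
  rw [isReduced_iff_isChain] at h2 ⊢
  refine List.isChain_cons_cons.2 ⟨?_, h2⟩
  rw [letterInv_letterInv]
  exact he.symm

namespace Boundary

/-- The word `w` followed by `l` is an initial subword of `x` iff removing it from `x` leaves an
infinite word that does not begin with the inverse of `l`. -/
theorem take_eq_iff {w : List (A × Bool)} {l : A × Bool} (hw : FreeGroup.IsReduced (w ++ [l]))
    (x : Boundary A) : x.take (w ++ [l]).length = w ++ [l] ↔
      ((FreeGroup.mk (w ++ [l]))⁻¹ • x).letter 0 ≠ letterInv l := by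
  constructor
  · intro h
    have h1 := inv_mk_take_smul x (w ++ [l]).length
    have h2 := letter_of_take_append h
    rw [h] at h1
    rw [h1, iterate_tail_letter, ← h2, List.length_append]
    exact x.2 _
  · intro h
    have h1 := take_mk_smul (isReduced_append_letter hw h) 0
    rwa [smul_inv_smul, take_zero, List.append_nil, add_zero] at h1

end Boundary

end WordGeometry

namespace Marking

variable {N : ℕ} {V E : Type*} {Γ : EGraph V E} (α : Marking N Γ)

theorem mul_mk_mem_vertexLifts {p q : V} {h : FreeGroup E} (hh : h ∈ α.vertexLifts p)
    {w : List (E × Bool)} (hw : Γ.IsPath p w q) : h * FreeGroup.mk w ∈ α.vertexLifts q := by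
  obtain ⟨w₀, h₀, rfl⟩ := hh
  exact ⟨w₀ ++ w, h₀.append hw, FreeGroup.mul_mk.symm⟩

variable [DecidableEq E]

theorem isPath_toWord_inv_mul {p q : V} {h k : FreeGroup E} (hh : h ∈ α.vertexLifts p)
    (hk : k ∈ α.vertexLifts q) : Γ.IsPath p (h⁻¹ * k).toWord q := by
  obtain ⟨w, hw, rfl⟩ := hh
  obtain ⟨w', hw', rfl⟩ := hk
  rw [FreeGroup.inv_mk, FreeGroup.mul_mk, FreeGroup.toWord_mk]
  exact (hw.invRev.append hw').red FreeGroup.reduce.red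

theorem toWord_inv_mul_mem_reducedPaths {p q : V} {h k : FreeGroup E} (hh : h ∈ α.vertexLifts p)
    (hk : k ∈ α.vertexLifts q) (hne : h ≠ k) : (h⁻¹ * k).toWord ∈ Γ.reducedPaths := by
  refine ⟨fun h0 => hne ?_, FreeGroup.isReduced_toWord, p, q, α.isPath_toWord_inv_mul hh hk⟩
  rwa [FreeGroup.toWord_eq_nil_iff, inv_mul_eq_one] at h0

variable [Finite E]

theorem isRay_inv_smul_bd {p : V} {h : FreeGroup E} (hh : h ∈ α.vertexLifts p)
    (x : Boundary (Fin N)) : Γ.IsRay p (h⁻¹ • α.bd x) := by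
  obtain ⟨w, hw, rfl⟩ := hh
  exact (α.isRay_bd x).inv_mk_smul hw

/-- A cylinder whose path begins with `l` is cut up according to the edge `e` with which the
geodesic arrives at the initial vertex of the path. -/
theorem mem_cylinder_cons_iff {h : FreeGroup E} {l e : E × Bool} {u : List (E × Bool)}
    (he : e ≠ l) {z : DoubleBoundary (Fin N)} :
    z ∈ α.cylinder (h * FreeGroup.mk [e]) (letterInv e :: l :: u) ↔
      z ∈ α.cylinder h (l :: u) ∧ (h⁻¹ • α.bd z.fst).letter 0 = e := by
  simp only [mem_cylinder_iff, mul_inv_rev, mul_smul, ← Boundary.mk_letterInv]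
  generalize h⁻¹ • α.bd z.fst = X
  generalize h⁻¹ • α.bd z.snd = Y
  constructor
  · rintro ⟨h1, h2⟩
    have hY : (FreeGroup.mk [letterInv e] • Y).letter 0 = letterInv e :=
      Boundary.letter_zero_of_take h2
    have hY2 : FreeGroup.mk [e] • FreeGroup.mk [letterInv e] • Y = Y := by
      rw [Boundary.mk_letterInv, smul_inv_smul]
    have hX2 : FreeGroup.mk [e] • FreeGroup.mk [letterInv e] • X = X := by
      rw [Boundary.mk_letterInv, smul_inv_smul]
    rw [hY] at h1
    rw [Boundary.mk_smul_of_eq hY] at hY2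
    rw [Boundary.mk_smul_of_ne h1] at hX2
    rw [List.length_cons, Boundary.take_succ_eq_cons, hY2] at h2
    have h3 := (List.cons.inj h2).2
    have hX0 : X.letter 0 = e := by rw [← hX2]; rfl
    refine ⟨⟨?_, h3⟩, hX0⟩
    rw [hX0, Boundary.letter_zero_of_take h3]
    exact he
  · rintro ⟨⟨h1, h2⟩, rfl⟩
    have hY : Y.letter 0 = l := Boundary.letter_zero_of_take h2
    have hY' : Y.letter 0 ≠ letterInv (letterInv (X.letter 0)) := by
      rw [letterInv_letterInv]; exact h1.symm
    rw [Boundary.mk_smul_of_eq (letterInv_letterInv (X.letter 0)).symm,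
      Boundary.mk_smul_of_ne hY', List.length_cons, Boundary.cons_take_succ, h2]
    exact ⟨X.2 0, rfl⟩

theorem cylinder_eq_iUnion {p q : V} {h : FreeGroup E} (hh : h ∈ α.vertexLifts p) {l : E × Bool}
    {u : List (E × Bool)} (hp : Γ.IsPath p (l :: u) q) :
    α.cylinder h (l :: u) = ⋃ e ∈ (Set.toFinite (Γ.next (letterInv l))).toFinset,
      α.cylinder (h * FreeGroup.mk [e]) (letterInv e :: l :: u) := by
  ext z
  simp only [Set.mem_iUnion, Set.Finite.mem_toFinset, exists_prop]
  constructor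
  · intro hz
    obtain ⟨h1, h2⟩ := α.mem_cylinder_iff.1 hz
    rw [Boundary.letter_zero_of_take h2] at h1
    refine ⟨_, ⟨?_, by rwa [letterInv_letterInv]⟩, (α.mem_cylinder_cons_iff h1).2 ⟨hz, rfl⟩⟩
    rw [(α.isRay_inv_smul_bd hh z.fst).o_letter, EGraph.t_letterInv, hp.1]
  · rintro ⟨e, ⟨-, he⟩, hz⟩
    rw [letterInv_letterInv] at he
    exact ((α.mem_cylinder_cons_iff he).1 hz).1

theorem isOpen_cylinder (h : FreeGroup E) (v : List (E × Bool)) : IsOpen (α.cylinder h v) := by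
  have hc : Continuous α.bd := continuous_inducedMap _
  have h1 : Continuous fun z : DoubleBoundary (Fin N) => z.fst :=
    continuous_fst.comp continuous_subtype_val
  have h2 : Continuous fun z : DoubleBoundary (Fin N) => z.snd :=
    continuous_snd.comp continuous_subtype_val
  have h3 : Continuous fun z : DoubleBoundary (Fin N) => h⁻¹ • α.bd z.fst :=
    (hc.comp h1).const_smul (h⁻¹ : FreeGroup E)
  have h4 : Continuous fun z : DoubleBoundary (Fin N) => h⁻¹ • α.bd z.snd :=
    (hc.comp h2).const_smul (h⁻¹ : FreeGroup E)
  have h5 := ((Boundary.isLocallyConstant_letter 0).comp_continuous h3).prodMk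
    (((Boundary.isLocallyConstant_letter 0).comp_continuous h4).prodMk
      ((Boundary.isLocallyConstant_take v.length).comp_continuous h4))
  have h6 := h5 {s | s.1 ≠ s.2.1 ∧ s.2.2 = v}
  convert h6
  ext z
  exact α.mem_cylinder_iff

/-- A reversed geodesic runs through the inverse path, whose lift starts at the terminal vertex `h *
mk v` of the old one. -/
theorem mem_cylinder_of_flip_mem {h : FreeGroup E} {v : List (E × Bool)} (hv : v ≠ [])
    (hr : FreeGroup.IsReduced v) {z : DoubleBoundary (Fin N)} (hz : z.flip ∈ α.cylinder h v) :
    z ∈ α.cylinder (h * FreeGroup.mk v) (FreeGroup.invRev v) := by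
  obtain ⟨h1, h2⟩ := α.mem_cylinder_iff.1 hz
  rw [mem_cylinder_iff]
  change (h⁻¹ • α.bd z.snd).letter 0 ≠ (h⁻¹ • α.bd z.fst).letter 0 at h1
  change (h⁻¹ • α.bd z.fst).take v.length = v at h2
  simp only [mul_inv_rev, mul_smul]
  generalize h⁻¹ • α.bd z.fst = X at *
  generalize h⁻¹ • α.bd z.snd = Y at *
  obtain ⟨w, l, rfl⟩ : ∃ w l, v = w ++ [l] := ⟨_, _, (List.dropLast_append_getLast hv).symm⟩
  have hX := (Boundary.take_eq_iff hr X).1 h2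
  have hred : FreeGroup.IsReduced (FreeGroup.invRev (w ++ [l]) ++ [Y.letter 0]) := by
    refine isReduced_append_iff.2 ⟨isReduced_invRev.2 hr, FreeGroup.IsReduced.singleton, ?_⟩
    intro c hc d hd
    obtain rfl : Y.letter 0 = d := by simpa using hd
    obtain ⟨m, w', hw'⟩ : ∃ m w', w ++ [l] = m :: w' := List.exists_cons_of_ne_nil hv
    rw [hw'] at hc h2
    rw [FreeGroup.invRev_cons, invRev_singleton] at hc
    obtain rfl : letterInv m = c := by simpa using hc
    rw [letterInv_letterInv, ← Boundary.letter_zero_of_take h2]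
    exact h1
  rw [FreeGroup.inv_mk] at hX ⊢
  have ht := Boundary.take_mk_smul hred 0
  rw [Boundary.take_zero, List.append_nil, add_zero] at ht
  refine ⟨?_, ht⟩
  rw [FreeGroup.invRev_append, invRev_singleton, List.singleton_append] at hX ht ⊢
  rwa [Boundary.letter_zero_of_take ht]

theorem flip_preimage_cylinder {h : FreeGroup E} {v : List (E × Bool)} (hv : v ≠ [])
    (hr : FreeGroup.IsReduced v) : DoubleBoundary.flip ⁻¹' α.cylinder h v =
      α.cylinder (h * FreeGroup.mk v) (FreeGroup.invRev v) := by
  ext z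
  refine ⟨α.mem_cylinder_of_flip_mem hv hr, fun hz => ?_⟩
  have h1 := α.mem_cylinder_of_flip_mem (z := z.flip) (invRev_ne_nil hv) (isReduced_invRev.2 hr) hz
  rwa [FreeGroup.invRev_invRev, ← FreeGroup.inv_mk, mul_inv_cancel_right] at h1

theorem smul_preimage_cylinder (g : FreeGroup (Fin N)) (h : FreeGroup E) (v : List (E × Bool)) :
    (fun z : DoubleBoundary (Fin N) => g • z) ⁻¹' α.cylinder h v =
      α.cylinder ((α.hom g)⁻¹ * h) v := by
  ext z
  have h1 : α.bd (g • z).fst = α.hom g • α.bd z.fst := α.bd_smul g z.fst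
  have h2 : α.bd (g • z).snd = α.hom g • α.bd z.snd := α.bd_smul g z.snd
  rw [Set.mem_preimage, mem_cylinder_iff, mem_cylinder_iff, h1, h2, mul_inv_rev, inv_inv,
    mul_smul, mul_smul]

/-- Cylinders between vertices at the same distance from the base vertex. -/
theorem cylinder_eq_of_norm_eq {h k : FreeGroup E} (hhk : h ≠ k) (hn : h.norm = k.norm) :
    α.cylinder h (h⁻¹ * k).toWord =
      {z | (α.bd z.fst).take h.norm = h.toWord ∧ (α.bd z.snd).take h.norm = k.toWord} := by
  have h1 : ¬ h.toWord <+: k.toWord := fun hp =>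
    hhk (FreeGroup.toWord_injective (hp.eq_of_length hn))
  have h2 : ¬ k.toWord <+: h.toWord := fun hp =>
    hhk (FreeGroup.toWord_injective (hp.eq_of_length hn.symm)).symm
  obtain ⟨a, b, l, r, u, w, ha, hb, hu, hw⟩ := toWord_inv_mul_of_not_prefix h1 h2
  ext z
  have hk : k.norm = (b ++ [r]).length := by rw [FreeGroup.norm, hb]
  have hh : h.norm = (a ++ [l]).length := by rw [FreeGroup.norm, ha]
  have hra : FreeGroup.IsReduced (a ++ [l]) := ha ▸ FreeGroup.isReduced_toWord
  have hrb : FreeGroup.IsReduced (b ++ [r]) := hb ▸ FreeGroup.isReduced_toWord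
  have hrw : FreeGroup.IsReduced (w ++ [r]) := hw ▸ FreeGroup.isReduced_toWord
  have hka : FreeGroup.mk (a ++ [l]) = h := by rw [← ha, FreeGroup.mk_toWord]
  have hkb : FreeGroup.mk (b ++ [r]) = k := by rw [← hb, FreeGroup.mk_toWord]
  have hkw : FreeGroup.mk (w ++ [r]) = h⁻¹ * k := by rw [← hw, FreeGroup.mk_toWord]
  rw [mem_cylinder_iff, Set.mem_ofPred_eq]
  have e1 : (α.bd z.fst).take h.norm = h.toWord ↔ (h⁻¹ • α.bd z.fst).letter 0 ≠ letterInv l := by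
    rw [hh, ha, Boundary.take_eq_iff hra, hka]
  have e2 : (α.bd z.snd).take h.norm = k.toWord ↔ (k⁻¹ • α.bd z.snd).letter 0 ≠ letterInv r := by
    rw [hn, hk, hb, Boundary.take_eq_iff hrb, hkb]
  have e3 : (h⁻¹ • α.bd z.snd).take (h⁻¹ * k).toWord.length = (h⁻¹ * k).toWord ↔
      (k⁻¹ • α.bd z.snd).letter 0 ≠ letterInv r := by
    rw [hw, Boundary.take_eq_iff hrw, hkw, smul_smul, mul_inv_rev, inv_inv, mul_inv_cancel_right]
  rw [e1, e2, ← e3]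
  refine and_congr_left fun h3 => ?_
  rw [hu] at h3
  rw [Boundary.letter_zero_of_take h3]

end Marking

end TrainTrack

/-! ### Atoms of the double boundary and their masses -/

namespace TrainTrack

theorem DoubleBoundary.continuous_flip {A : Type*} :
    Continuous (DoubleBoundary.flip : DoubleBoundary A → DoubleBoundary A) :=
  (continuous_subtype_val.snd.prodMk continuous_subtype_val.fst).subtype_mk _

theorem DoubleBoundary.continuous_smul {A : Type*} [DecidableEq A] (g : FreeGroup A) :
    Continuous fun z : DoubleBoundary A => g • z :=
  ((continuous_subtype_val.fst.const_smul g).prodMk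
    (continuous_subtype_val.snd.const_smul g)).subtype_mk _

namespace Marking

open scoped NNReal ENNReal

variable {N : ℕ} {V E : Type*} {Γ : EGraph V E} (α : Marking N Γ) [DecidableEq E] [Finite E]

/-- The initial subwords of length `n` of the two ends of a geodesic, seen from the base vertex. -/
noncomputable def level (n : ℕ) (z : DoubleBoundary (Fin N)) :
    List (E × Bool) × List (E × Bool) := ((α.bd z.fst).take n, (α.bd z.snd).take n)

theorem isLocallyConstant_level (n : ℕ) : IsLocallyConstant (α.level n) :=
  ((α.isLocallyConstant_take_bd n).comp_continuous continuous_subtype_val.fst).prodMk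
    ((α.isLocallyConstant_take_bd n).comp_continuous continuous_subtype_val.snd)

/-- The double boundary, cut up according to the points at which geodesics enter and leave the
balls around the base vertex. -/
noncomputable def atomSystem :
    AtomSystem (DoubleBoundary (Fin N)) (List (E × Bool) × List (E × Bool)) where
  D n := {z | (α.level n z).1 ≠ (α.level n z).2}
  π := α.level
  locConst := α.isLocallyConstant_level
  finite n := by
    refine ((List.finite_length_le (E × Bool) n).prod
      (List.finite_length_le (E × Bool) n)).subset ?_
    rintro _ ⟨z, rfl⟩
    exact ⟨(Boundary.length_take _ n).le, (Boundary.length_take _ n).le⟩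
  refines n y z h := by
    obtain ⟨h1, h2⟩ := Prod.ext_iff.1 h
    exact Prod.ext (Boundary.take_take_eq n.le_succ h1) (Boundary.take_take_eq n.le_succ h2)
  separates y z h := Subtype.ext (Prod.ext
    (α.bd_injective (Boundary.ext_take fun n => (Prod.ext_iff.1 (h n)).1))
    (α.bd_injective (Boundary.ext_take fun n => (Prod.ext_iff.1 (h n)).2)))
  saturated n y z h hy := by
    rw [Set.mem_ofPred_eq] at hy ⊢
    rwa [← h]
  mono := by
    intro m n hmn z hz h
    exact hz (Boundary.take_take_eq hmn h)
  exhausts z := by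
    by_contra! h
    refine z.2 (α.bd_injective (Boundary.ext_take fun n => ?_))
    have := h n
    rwa [Set.mem_ofPred_eq, not_not] at this
  compact n z hz := by
    have hcl : IsLocallyConstant fun p : Boundary (Fin N) × Boundary (Fin N) =>
        ((α.bd p.1).take n, (α.bd p.2).take n) :=
      ((α.isLocallyConstant_take_bd n).comp_continuous continuous_fst).prodMk
        ((α.isLocallyConstant_take_bd n).comp_continuous continuous_snd)
    have hind : IsInducing (Subtype.val : DoubleBoundary (Fin N) → _) :=
      IsInducing.subtypeVal
    -- The fibre in the compact product avoids the diagonal, because the two prefixes at `z` differ;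
    -- so it lies in the double boundary.
    refine (hind.isCompact_preimage_iff ?_).2 (hcl.isClosed_fiber (α.level n z)).isCompact
    rintro ⟨x, y⟩ hxy
    refine ⟨⟨(x, y), ?_⟩, rfl⟩
    rintro (rfl : x = y)
    obtain ⟨h1, h2⟩ := Prod.ext_iff.1 hxy
    exact hz (h1.symm.trans h2)

variable {α}

theorem exists_vertexLifts_mk_take (x : Boundary (Fin N)) (n : ℕ) :
    ∃ q, FreeGroup.mk ((α.bd x).take n) ∈ α.vertexLifts q := by
  obtain ⟨q, hq⟩ := α.isRay_bd x n
  exact ⟨q, _, hq, rfl⟩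

/-- Fixing the two distinct crossing points of the sphere of radius `n` amounts to fixing the
segment between them. -/
theorem atom_eq_cylinder {n : ℕ} {z : DoubleBoundary (Fin N)} (hz : z ∈ α.atomSystem.D n) :
    α.atomSystem.atom n z = α.cylinder (FreeGroup.mk (α.level n z).1)
      ((FreeGroup.mk (α.level n z).1)⁻¹ * FreeGroup.mk (α.level n z).2).toWord := by
  have h1 : (FreeGroup.mk (α.level n z).1).toWord = (α.level n z).1 := toWord_mk_take _ n
  have h2 : (FreeGroup.mk (α.level n z).2).toWord = (α.level n z).2 := toWord_mk_take _ n
  have h3 : (FreeGroup.mk (α.level n z).1).norm = n := norm_mk_take _ n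
  have h4 : (FreeGroup.mk (α.level n z).2).norm = n := norm_mk_take _ n
  rw [α.cylinder_eq_of_norm_eq (fun h => hz (by rw [← h1, ← h2, h])) (h3.trans h4.symm), h1, h2,
    h3]
  ext y
  exact Prod.ext_iff

variable {a : List (E × Bool) → ℝ}

/-- The masses of the atoms that are prescribed by the weights `a` of the reduced edge paths. -/
noncomputable def mass (a : List (E × Bool) → ℝ) (s : List (E × Bool) × List (E × Bool)) : ℝ≥0 :=
  (a ((FreeGroup.mk s.1)⁻¹ * FreeGroup.mk s.2).toWord).toNNReal

/-- The pieces of an atom prolong its segment by one edge at each end, independently; consistency is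
the switch condition at the beginning followed by the one at the end. -/
theorem consistent_mass [Finite V] (hΓ : Γ.IsCore) (ha : SwitchConditions Γ a) :
    α.atomSystem.Consistent (mass a) := by
  classical
  intro n z hz
  change _ = mass a (α.level n z)
  obtain ⟨p, hp⟩ := exists_vertexLifts_mk_take (α := α) z.fst n
  obtain ⟨q, hq⟩ := exists_vertexLifts_mk_take (α := α) z.snd n
  obtain ⟨p', hpath⟩ : ∃ p', Γ.IsPath α.base (α.level n z).1 p' := α.isRay_bd z.fst n
  obtain ⟨q', hqath⟩ : ∃ q', Γ.IsPath α.base (α.level n z).2 q' := α.isRay_bd z.snd n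
  have h1 : (FreeGroup.mk (α.level n z).1).toWord = (α.level n z).1 := toWord_mk_take _ n
  have h2 : (FreeGroup.mk (α.level n z).2).toWord = (α.level n z).2 := toWord_mk_take _ n
  have hlen : (α.level n z).1.length = (α.level n z).2.length := by simp [level]
  have hred1 : FreeGroup.IsReduced (α.level n z).1 := Boundary.isReduced_take _ n
  have hred2 : FreeGroup.IsReduced (α.level n z).2 := Boundary.isReduced_take _ n
  obtain ⟨a₀, b₀, l, r, u, w, hl, hr, hu, hw⟩ :=
    toWord_inv_mul_of_not_prefix (h := FreeGroup.mk (α.level n z).1)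
      (k := FreeGroup.mk (α.level n z).2)
      (by rw [h1, h2]; exact fun hp => hz (hp.eq_of_length hlen))
      (by rw [h1, h2]; exact fun hp => hz (hp.eq_of_length hlen.symm).symm)
  rw [h1] at hl
  rw [h2] at hr
  have hv := α.toWord_inv_mul_mem_reducedPaths hp hq fun h => hz (by
    rw [← h1, ← h2]; exact congrArg FreeGroup.toWord h)
  change ((FreeGroup.mk (α.level n z).1)⁻¹ * FreeGroup.mk (α.level n z).2).toWord ∈ _ at hv
  have hmk : (FreeGroup.mk (α.level n z).1)⁻¹ * FreeGroup.mk (α.level n z).2 =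
      FreeGroup.mk (w ++ [r]) := by rw [← hw, FreeGroup.mk_toWord]
  have huw : letterInv l :: u = w ++ [r] := hu.symm.trans hw
  have hv2 : ∀ e' ∈ Γ.next r, letterInv l :: (u ++ [e']) ∈ Γ.reducedPaths := by
    intro e' he'
    rw [← List.cons_append, huw, EGraph.append_mem_reducedPaths_iff (hw ▸ hv)]
    exact he'
  have hv3 : ∀ e ∈ Γ.next l, ∀ e' ∈ Γ.next r,
      letterInv e :: letterInv l :: (u ++ [e']) ∈ Γ.reducedPaths := by
    intro e he e' he'
    rw [EGraph.cons_mem_reducedPaths_iff (hv2 e' he'), letterInv_letterInv]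
    exact he
  have hA : (α.level n z).1 ∈ Γ.reducedPaths := ⟨by simp [hl], hred1, _, _, hpath⟩
  have hB : (α.level n z).2 ∈ Γ.reducedPaths := ⟨by simp [hr], hred2, _, _, hqath⟩
  -- Every admissible next edge is realised by a boundary point: the prolonged path extends to a
  -- ray, and every ray from the base is an image.
  have hray : ∀ {x : Boundary (Fin N)} {c : List (E × Bool)} {d e : E × Bool} {p' : V},
      (α.bd x).take n = c ++ [d] → Γ.IsPath α.base (c ++ [d]) p' → e ∈ Γ.next d →
      ∃ y, (α.bd y).take (n + 1) = c ++ [d] ++ [e] := by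
    intro x c d e p' hx hpath he
    have hn : n = (c ++ [d]).length := by rw [← hx, Boundary.length_take]
    have hcd : c ++ [d] ∈ Γ.reducedPaths :=
      ⟨by simp, hx ▸ Boundary.isReduced_take _ n, _, _, hpath⟩
    have hr' := ((EGraph.append_mem_reducedPaths_iff hcd).2 he).2.1
    obtain ⟨c', -, hd⟩ := EGraph.isPath_append_iff.1 hpath
    obtain ⟨ξ, hξ, hξt⟩ := EGraph.exists_ray_of_path hΓ hr'
      (hpath.append (w' := [e]) ⟨he.1.trans hd.2, rfl⟩)
    obtain ⟨y, rfl⟩ := α.exists_bd_eq hΓ hξ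
    exact ⟨y, by rw [hn]; exact hξt⟩
  have hnext : ∀ {x : Boundary (Fin N)} {c : List (E × Bool)} {d : E × Bool},
      (α.bd x).take n = c ++ [d] → (α.bd x).letter n ∈ Γ.next d := by
    intro x c d hx
    have hn : n = c.length + 1 := by
      have := congrArg List.length hx
      simpa using this
    subst hn
    have hd : (α.bd x).letter c.length = d :=
      Boundary.letter_of_take_append (by simpa using hx)
    have := (α.isRay_bd x).letter_succ_mem_next c.length
    rwa [hd] at this
  have hlab : α.atomSystem.labels (n + 1) (α.atomSystem.atom n z) =
      ((Set.toFinite (Γ.next l)).toFinset ×ˢ (Set.toFinite (Γ.next r)).toFinset).image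
        fun s => ((α.level n z).1 ++ [s.1], (α.level n z).2 ++ [s.2]) := by
    ext s
    simp only [AtomSystem.mem_labels, Finset.mem_image, Finset.mem_product,
      Set.Finite.mem_toFinset]
    constructor
    · rintro ⟨y, hy, -, rfl⟩
      obtain ⟨hy1, hy2⟩ := Prod.ext_iff.1 hy
      refine ⟨((α.bd y.fst).letter n, (α.bd y.snd).letter n),
        ⟨hnext (hy1.trans hl), hnext (hy2.trans hr)⟩, ?_⟩
      change _ = ((α.bd y.fst).take (n + 1), (α.bd y.snd).take (n + 1))
      rw [Boundary.take_succ, Boundary.take_succ]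
      change (α.bd y.fst).take n = _ at hy1
      change (α.bd y.snd).take n = _ at hy2
      rw [hy1, hy2]
      rfl
    · rintro ⟨⟨e, e'⟩, ⟨he, he'⟩, rfl⟩
      rw [hl, hr]
      obtain ⟨x, hx⟩ := hray (x := z.fst) hl (hl ▸ hpath) he
      obtain ⟨y, hy⟩ := hray (x := z.snd) hr (hr ▸ hqath) he'
      have hxn : (α.bd x).take n = a₀ ++ [l] := by
        rw [Boundary.take_succ] at hx
        exact (List.append_inj' hx rfl).1
      have hyn : (α.bd y).take n = b₀ ++ [r] := by
        rw [Boundary.take_succ] at hy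
        exact (List.append_inj' hy rfl).1
      have hxy : x ≠ y := by
        rintro rfl
        exact hz (by rw [hl, hr, ← hxn, hyn])
      have hmem : (⟨(x, y), hxy⟩ : DoubleBoundary (Fin N)) ∈ α.atomSystem.atom n z :=
        Prod.ext (hxn.trans hl.symm) (hyn.trans hr.symm)
      refine ⟨⟨(x, y), hxy⟩, hmem, ?_, Prod.ext hx hy⟩
      exact α.atomSystem.mono n.le_succ (α.atomSystem.saturated n _ _ (Eq.symm hmem) hz)
  rw [hlab, Finset.sum_image]
  · have hterm : ∀ s ∈ (Set.toFinite (Γ.next l)).toFinset ×ˢ (Set.toFinite (Γ.next r)).toFinset,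
        mass a ((α.level n z).1 ++ [s.1], (α.level n z).2 ++ [s.2]) =
          (a (letterInv s.1 :: letterInv l :: (u ++ [s.2]))).toNNReal := by
      rintro ⟨e, e'⟩ hs
      simp only [Finset.mem_product, Set.Finite.mem_toFinset] at hs
      have h3 : (FreeGroup.mk ((α.level n z).1 ++ [e]))⁻¹ * FreeGroup.mk ((α.level n z).2 ++ [e'])
          = FreeGroup.mk (letterInv e :: letterInv l :: (u ++ [e'])) := by
        rw [← FreeGroup.mul_mk, ← FreeGroup.mul_mk, mul_inv_rev, ← Boundary.mk_letterInv, mul_assoc,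
          ← mul_assoc (FreeGroup.mk (α.level n z).1)⁻¹, hmk, ← huw, FreeGroup.mul_mk,
          FreeGroup.mul_mk]
        rfl
      rw [mass, h3, FreeGroup.toWord_mk, (hv3 e hs.1 e' hs.2).2.1.reduce_eq]
    rw [Finset.sum_congr rfl hterm, ← Real.toNNReal_sum_of_nonneg, mass, hw]
    · congr 1
      -- With the last edge fixed, the inner sum over first edges collapses; the outer sum is then
      -- the switch condition at the end.
      rw [Finset.sum_product_right, ← ha.sum_next (hw ▸ hv)]
      refine Finset.sum_congr rfl fun e' he' => ?_
      have := ha.sum_next_letterInv (hv2 e' ((Set.Finite.mem_toFinset _).1 he'))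
      rw [letterInv_letterInv] at this
      rw [this, ← List.cons_append, huw]
    · rintro ⟨e, e'⟩ hs
      simp only [Finset.mem_product, Set.Finite.mem_toFinset] at hs
      exact ha.nonneg _ (hv3 e hs.1 e' hs.2)
  · rintro ⟨e, e'⟩ - ⟨d, d'⟩ - h
    simpa using h

end Marking

end TrainTrack

/-! ### From masses of atoms to geodesic currents -/

namespace TrainTrack

namespace Marking

open scoped NNReal ENNReal

variable {N : ℕ} {V E : Type*} {Γ : EGraph V E} {α : Marking N Γ} [DecidableEq E]
  {a : List (E × Bool) → ℝ} {μ : Measure (DoubleBoundary (Fin N))}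

/-- The weight of the path between the vertices `h` and `k` of the universal cover is the measure
of the cylinder of this path. -/
def CylinderEq (α : Marking N Γ) (μ : Measure (DoubleBoundary (Fin N)))
    (a : List (E × Bool) → ℝ) (h k : FreeGroup E) : Prop :=
  μ (α.cylinder h (h⁻¹ * k).toWord) = ENNReal.ofReal (a (h⁻¹ * k).toWord)

theorem hasOccurrences_of_cylinderEq
    (h : ∀ p q, ∀ h ∈ α.vertexLifts p, ∀ k ∈ α.vertexLifts q, h ≠ k → CylinderEq α μ a h k) :
    α.HasOccurrences μ a := by
  intro v hv p q hpath g hg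
  have h1 : (g⁻¹ * (g * FreeGroup.mk v)).toWord = v := by
    rw [inv_mul_cancel_left, FreeGroup.toWord_mk, hv.2.1.reduce_eq]
  have h2 := h p q g hg _ (α.mul_mk_mem_vertexLifts hg hpath) fun heq => hv.1 (by
    rw [← h1, ← heq, inv_mul_cancel, FreeGroup.toWord_one])
  rwa [CylinderEq, h1] at h2

theorem HasOccurrences.cylinderEq (hμ : α.HasOccurrences μ a) {p q : V} {h k : FreeGroup E}
    (hh : h ∈ α.vertexLifts p) (hk : k ∈ α.vertexLifts q) (hne : h ≠ k) : CylinderEq α μ a h k :=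
  hμ _ (α.toWord_inv_mul_mem_reducedPaths hh hk hne) p q (α.isPath_toWord_inv_mul hh hk) h hh

variable [Finite E]

theorem CylinderEq.flip (ha : SwitchConditions Γ a)
    (hμ : MeasurePreserving (DoubleBoundary.flip (A := Fin N)) μ μ) {p q : V}
    {h k : FreeGroup E} (hh : h ∈ α.vertexLifts p) (hk : k ∈ α.vertexLifts q) (hne : h ≠ k)
    (hkh : CylinderEq α μ a k h) : CylinderEq α μ a h k := by
  have hv := α.toWord_inv_mul_mem_reducedPaths hk hh hne.symm
  have hinv : (h⁻¹ * k).toWord = FreeGroup.invRev (k⁻¹ * h).toWord := by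
    rw [← FreeGroup.toWord_inv, mul_inv_rev, inv_inv]
  have hcyl := α.flip_preimage_cylinder (h := k) hv.1 hv.2.1
  rw [FreeGroup.mk_toWord, mul_inv_cancel_left, ← hinv] at hcyl
  rw [CylinderEq, ← hcyl, hμ.measure_preimage (α.isOpen_cylinder _ _).nullMeasurableSet, hkh, hinv,
    ha.inv _ hv]

/-- The measure is additive over the edge by which the geodesic arrives at `h`, and the weights are
additive by the switch condition; so the claim passes from the longer paths to the shorter one. -/
theorem CylinderEq.of_next (ha : SwitchConditions Γ a) {p q : V} {h k : FreeGroup E}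
    (hh : h ∈ α.vertexLifts p) (hk : k ∈ α.vertexLifts q) {l : E × Bool} {u : List (E × Bool)}
    (hu : (h⁻¹ * k).toWord = l :: u)
    (hnext : ∀ e ∈ Γ.next (letterInv l), CylinderEq α μ a (h * FreeGroup.mk [e]) k) :
    CylinderEq α μ a h k := by
  have hpath := α.isPath_toWord_inv_mul hh hk
  rw [hu] at hpath
  have hv : l :: u ∈ Γ.reducedPaths := ⟨by simp, hu ▸ FreeGroup.isReduced_toWord, p, q, hpath⟩
  have hne : ∀ {e}, e ∈ (Set.toFinite (Γ.next (letterInv l))).toFinset → e ≠ l := fun he => by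
    have := ((Set.Finite.mem_toFinset _).1 he).2
    rwa [letterInv_letterInv] at this
  rw [CylinderEq, hu, α.cylinder_eq_iUnion hh hpath, measure_biUnion_finset,
    ← ha.sum_next_letterInv hv, ENNReal.ofReal_sum_of_nonneg]
  · refine Finset.sum_congr rfl fun e he => ?_
    have h1 := hnext e ((Set.Finite.mem_toFinset _).1 he)
    rwa [CylinderEq, toWord_inv_mul_mk_singleton hu (hne he)] at h1
  · exact fun e he => ha.nonneg _
      ((EGraph.cons_mem_reducedPaths_iff hv).2 ((Set.Finite.mem_toFinset _).1 he))
  · intro e he e' he' hee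
    refine Set.disjoint_left.2 fun z hz hz' => hee ?_
    exact ((α.mem_cylinder_cons_iff (hne he)).1 hz).2.symm.trans
      ((α.mem_cylinder_cons_iff (hne he')).1 hz').2
  · exact fun e _ => (α.isOpen_cylinder _ _).measurableSet

/-- A flip invariant measure whose values on the cylinders between vertices at the same distance
from the base vertex are given by the weights has the right values on all cylinders. -/
theorem cylinderEq_of_norm_eq (ha : SwitchConditions Γ a)
    (hμ : MeasurePreserving (DoubleBoundary.flip (A := Fin N)) μ μ)
    (hatom : ∀ p q, ∀ h ∈ α.vertexLifts p, ∀ k ∈ α.vertexLifts q, h ≠ k → h.norm = k.norm →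
      CylinderEq α μ a h k) {p q : V} {h k : FreeGroup E} (hh : h ∈ α.vertexLifts p)
    (hk : k ∈ α.vertexLifts q) (hne : h ≠ k) : CylinderEq α μ a h k := by
  have hlift : ∀ {p q : V} {h k : FreeGroup E} {l e : E × Bool} {u : List (E × Bool)},
      h ∈ α.vertexLifts p → k ∈ α.vertexLifts q → (h⁻¹ * k).toWord = l :: u →
      e ∈ Γ.next (letterInv l) → h * FreeGroup.mk [e] ∈ α.vertexLifts (Γ.t e) := by
    intro p q h k l e u hh hk hu he
    have hpath := α.isPath_toWord_inv_mul hh hk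
    rw [hu] at hpath
    exact α.mul_mk_mem_vertexLifts hh ⟨by rw [he.1, EGraph.t_letterInv, hpath.1], rfl⟩
  -- The path from `h` to `k` starts towards the base, so a preceding edge has its other end farther
  -- out. The norm of the start grows by one until it equals that of `k`.
  have hinc_le : ∀ n : ℕ, ∀ {p q : V} {h k : FreeGroup E}, h ∈ α.vertexLifts p →
      k ∈ α.vertexLifts q → ¬ h.toWord <+: k.toWord → ¬ k.toWord <+: h.toWord →
      h.norm + n = k.norm → CylinderEq α μ a h k := by
    intro n
    induction n with
    | zero =>
      intro p q h k hh hk h1 h2 hn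
      exact hatom p q h hh k hk (fun h => h1 (h ▸ List.prefix_refl _)) hn
    | succ n ih =>
      intro p q h k hh hk h1 h2 hn
      obtain ⟨a₀, -, l, -, u, -, hl, -, hu, -⟩ := toWord_inv_mul_of_not_prefix h1 h2
      refine CylinderEq.of_next ha hh hk hu fun e he => ?_
      have hw : (h * FreeGroup.mk [e]).toWord = h.toWord ++ [e] := by
        rcases toWord_mul_mk_singleton h e with ⟨w, hw, -⟩ | hw
        · rw [hl] at hw
          have hle : l = letterInv e := by simpa using List.append_inj_right' hw rfl
          exact absurd (eq_letterInv_comm.1 hle) (by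
            have := he.2
            rwa [letterInv_letterInv] at this)
        · exact hw
      refine ih (hlift hh hk hu he) hk ?_ ?_ ?_
      · rw [hw]
        exact fun h => h1 ((List.prefix_append _ _).trans h)
      · rw [hw, List.prefix_concat_iff]
        rintro (h | h)
        · exact h1 (h ▸ List.prefix_append _ _)
        · exact h2 h
      · rw [FreeGroup.norm, hw, List.length_append, List.length_singleton, ← FreeGroup.norm]
        omega
  have hinc : ∀ {p q : V} {h k : FreeGroup E}, h ∈ α.vertexLifts p → k ∈ α.vertexLifts q →
      ¬ h.toWord <+: k.toWord → ¬ k.toWord <+: h.toWord → CylinderEq α μ a h k := by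
    intro p q h k hh hk h1 h2
    rcases le_total h.norm k.norm with hle | hle
    · exact hinc_le _ hh hk h1 h2 (Nat.add_sub_cancel' hle)
    · exact (hinc_le _ hk hh h2 h1 (Nat.add_sub_cancel' hle)).flip ha hμ hh hk
        fun h => h1 (h ▸ List.prefix_refl _)
  -- Now the path leads straight away from the base. The preceding vertex is either one step closer
  -- to the base, where the induction applies, or on a side branch, where neither word is a prefix
  -- of the other.
  have hpre : ∀ n : ℕ, ∀ {p q : V} {h k : FreeGroup E}, h ∈ α.vertexLifts p →
      k ∈ α.vertexLifts q → h ≠ k → h.toWord <+: k.toWord → h.norm = n → CylinderEq α μ a h k := by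
    intro n
    induction n using Nat.strong_induction_on with
    | _ n ih =>
      intro p q h k hh hk hne hp hn
      obtain ⟨v, hv⟩ := hp
      obtain ⟨l, u, rfl⟩ : ∃ l u, v = l :: u := by
        refine List.exists_cons_of_ne_nil ?_
        rintro rfl
        rw [List.append_nil] at hv
        exact hne (FreeGroup.toWord_injective hv)
      have hu : (h⁻¹ * k).toWord = l :: u := by
        have h1 : h⁻¹ * k = FreeGroup.mk (l :: u) := by
          rw [← FreeGroup.mk_toWord (x := k), ← hv, ← FreeGroup.mul_mk, FreeGroup.mk_toWord,
            inv_mul_cancel_left]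
        have h2 : FreeGroup.IsReduced (h.toWord ++ l :: u) := hv ▸ FreeGroup.isReduced_toWord
        rw [h1, FreeGroup.toWord_mk, (h2.infix (List.suffix_append _ _).isInfix).reduce_eq]
      refine CylinderEq.of_next ha hh hk hu fun e he => ?_
      have hel : e ≠ l := by
        have := he.2
        rwa [letterInv_letterInv] at this
      have hh' := hlift hh hk hu he
      rcases toWord_mul_mk_singleton h e with ⟨w, hw, hw'⟩ | hw
      · have hwk : w <+: k.toWord := by
          rw [← hv, hw, List.append_assoc]
          exact List.prefix_append _ _
        have hlt : w.length < n := by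
          rw [← hn, FreeGroup.norm, hw]
          simp
        refine ih _ hlt hh' hk (fun heq => ?_) (hw' ▸ hwk) (by rw [FreeGroup.norm, hw'])
        have := congrArg List.length hv
        rw [← heq, hw', hw] at this
        simp at this
      · refine hinc hh' hk ?_ ?_
        · rw [hw, ← hv, List.prefix_append_right_inj]
          intro hp
          exact hel (List.cons_prefix_cons.1 hp).1
        · rw [hw, ← hv, List.prefix_append_right_inj]
          intro hp
          exact hel (List.cons_prefix_cons.1 hp).1.symm
  by_cases h1 : h.toWord <+: k.toWord
  · exact hpre _ hh hk hne h1 rfl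
  by_cases h2 : k.toWord <+: h.toWord
  · exact (hpre _ hk hh hne.symm h2 rfl).flip ha hμ hh hk hne
  · exact hinc hh hk h1 h2

theorem HasOccurrences.measure_atom (hμ : α.HasOccurrences μ a) {n : ℕ}
    {z : DoubleBoundary (Fin N)} (hz : z ∈ α.atomSystem.D n) :
    μ (α.atomSystem.atom n z) = mass a (α.level n z) := by
  obtain ⟨p, hp⟩ := exists_vertexLifts_mk_take (α := α) z.fst n
  obtain ⟨q, hq⟩ := exists_vertexLifts_mk_take (α := α) z.snd n
  rw [atom_eq_cylinder hz]
  refine hμ.cylinderEq hp hq fun h => hz ?_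
  have h' : (FreeGroup.mk ((α.bd z.fst).take n)).toWord =
    (FreeGroup.mk ((α.bd z.snd).take n)).toWord := congrArg FreeGroup.toWord h
  rwa [toWord_mk_take, toWord_mk_take] at h'

theorem HasOccurrences.measure_ext {μ' : Measure (DoubleBoundary (Fin N))}
    (hμ : α.HasOccurrences μ a) (hμ' : α.HasOccurrences μ' a) : μ = μ' :=
  α.atomSystem.measure_ext (fun n z hz => by rw [hμ.measure_atom hz]; exact ENNReal.coe_ne_top)
    fun n z hz => by rw [hμ.measure_atom hz, hμ'.measure_atom hz]

theorem HasOccurrences.map_smul (hμ : α.HasOccurrences μ a) (g : FreeGroup (Fin N)) :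
    α.HasOccurrences (μ.map fun z => g • z) a := by
  intro v hv p q hpath h hh
  rw [Measure.map_apply (DoubleBoundary.continuous_smul g).measurable
    (α.isOpen_cylinder h v).measurableSet, smul_preimage_cylinder]
  refine hμ v hv p q hpath _ ?_
  obtain ⟨w, hw, rfl⟩ := hh
  obtain ⟨w', hw', hg⟩ := α.exists_isPath_hom g⁻¹
  exact ⟨w' ++ w, hw'.append hw, by rw [← FreeGroup.mul_mk, hg, map_inv]⟩

theorem exists_bd_take_eq [Finite V] (hΓ : Γ.IsCore) {p : V} {h : FreeGroup E}
    (hh : h ∈ α.vertexLifts p) (hpos : 0 < h.norm) :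
    ∃ x, (α.bd x).take h.norm = h.toWord := by
  have hpath := α.isPath_toWord hh
  have hred : FreeGroup.IsReduced h.toWord := FreeGroup.isReduced_toWord
  obtain ⟨w, l, hw⟩ : ∃ w l, h.toWord = w ++ [l] :=
    ⟨_, _, (List.dropLast_append_getLast (List.ne_nil_of_length_pos hpos)).symm⟩
  rw [hw] at hpath hred
  obtain ⟨ξ, hξ, ht⟩ := EGraph.exists_ray_of_path hΓ hred hpath
  obtain ⟨x, rfl⟩ := α.exists_bd_eq hΓ hξ
  refine ⟨x, ?_⟩
  rw [FreeGroup.norm, hw, List.length_append, List.length_singleton]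
  exact ht

/-- Weights that satisfy the switch conditions are the values of a unique geodesic current. -/
theorem existsUnique_current [Finite V] (hΓ : Γ.IsCore) (ha : SwitchConditions Γ a) :
    ∃! μ : Measure (DoubleBoundary (Fin N)), IsGeodesicCurrent μ ∧ α.HasOccurrences μ a := by
  obtain ⟨μ, hreg, hμ⟩ := (consistent_mass (α := α) hΓ ha).exists_regular_measure
  -- Flip invariance comes first, because passing from atoms to general cylinders depends on it. On
  -- atoms it is the invariance of the weights under inversion.
  have hflip : MeasurePreserving (DoubleBoundary.flip (A := Fin N)) μ μ := by
    refine ⟨DoubleBoundary.continuous_flip.measurable, ?_⟩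
    have hmap : ∀ n, ∀ z ∈ α.atomSystem.D n, μ.map DoubleBoundary.flip (α.atomSystem.atom n z) =
        μ (α.atomSystem.atom n z) := by
      intro n z hz
      rw [Measure.map_apply DoubleBoundary.continuous_flip.measurable
        (α.atomSystem.isOpen_atom n z).measurableSet]
      have h1 : DoubleBoundary.flip ⁻¹' α.atomSystem.atom n z = α.atomSystem.atom n z.flip := by
        ext y
        change (_, _) = ((_, _) : List (E × Bool) × List (E × Bool)) ↔
          (_, _) = ((_, _) : List (E × Bool) × List (E × Bool))
        rw [Prod.mk.injEq, Prod.mk.injEq]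
        exact and_comm
      have hz' : z.flip ∈ α.atomSystem.D n := fun h => hz h.symm
      rw [h1, hμ n _ hz', hμ n _ hz]
      obtain ⟨p, hp⟩ := exists_vertexLifts_mk_take (α := α) z.fst n
      obtain ⟨q, hq⟩ := exists_vertexLifts_mk_take (α := α) z.snd n
      have h2 := ha.inv _ (α.toWord_inv_mul_mem_reducedPaths hp hq fun h => hz (by
        have h' := congrArg FreeGroup.toWord h
        rwa [toWord_mk_take, toWord_mk_take] at h'))
      rw [← FreeGroup.toWord_inv, mul_inv_rev, inv_inv] at h2
      exact congrArg (fun r : ℝ => ((r.toNNReal : ℝ≥0) : ℝ≥0∞)) h2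
    exact α.atomSystem.measure_ext
      (fun n z hz => by rw [hmap n z hz, hμ n z hz]; exact ENNReal.coe_ne_top) hmap
  have hocc : α.HasOccurrences μ a := by
    refine hasOccurrences_of_cylinderEq fun p q h hh k hk hne =>
      cylinderEq_of_norm_eq ha hflip (fun p q h hh k hk hne hn => ?_) hh hk hne
    -- At norm 0 both vertices would be the base; positive norm supplies the last edge along which a
    -- ray is prolonged.
    have hpos : 0 < h.norm := by
      rw [Nat.pos_iff_ne_zero]
      intro h0
      exact hne ((FreeGroup.norm_eq_zero.1 h0).trans (FreeGroup.norm_eq_zero.1 (hn ▸ h0)).symm)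
    obtain ⟨x, hx⟩ := exists_bd_take_eq hΓ hh hpos
    obtain ⟨y, hy⟩ := exists_bd_take_eq hΓ hk (hn ▸ hpos)
    rw [← hn] at hy
    have hwne : h.toWord ≠ k.toWord := fun h => hne (FreeGroup.toWord_injective h)
    have hxy : x ≠ y := by
      rintro rfl
      exact hwne (hx.symm.trans hy)
    have hlevel : α.level h.norm ⟨(x, y), hxy⟩ = (h.toWord, k.toWord) := Prod.ext hx hy
    have hz : (⟨(x, y), hxy⟩ : DoubleBoundary (Fin N)) ∈ α.atomSystem.D h.norm := by
      change (α.level h.norm ⟨(x, y), hxy⟩).1 ≠ (α.level h.norm ⟨(x, y), hxy⟩).2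
      rw [hlevel]
      exact hwne
    have h1 := hμ _ _ hz
    rw [atom_eq_cylinder hz] at h1
    change _ = ((mass a (α.level h.norm ⟨(x, y), hxy⟩) : ℝ≥0) : ℝ≥0∞) at h1
    rw [hlevel, mass, FreeGroup.mk_toWord, FreeGroup.mk_toWord] at h1
    exact h1
  refine ⟨μ, ⟨⟨hreg, ⟨fun g s hs => ?_⟩, hflip⟩, hocc⟩, fun μ' hμ' => hμ'.2.measure_ext hocc⟩
  -- The translated measure has the same values on cylinders, so uniqueness identifies it with `μ`.
  rw [← Measure.map_apply (DoubleBoundary.continuous_smul g).measurable hs,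
    (hocc.map_smul g).measure_ext hocc]

end Marking

end TrainTrack

/-! ### Assembly of the theorem -/

namespace TrainTrack

/-- With at most one edge the free group on the edges would be commutative, yet it contains a copy
of F_N. -/
theorem nontrivial_edges {N : ℕ} (hN : 2 ≤ N) {V E : Type*} {Γ : EGraph V E} (α : Marking N Γ) :
    Nontrivial E := by
  by_contra hE
  rw [not_nontrivial_iff_subsingleton] at hE
  have hcomm : ∀ x y : FreeGroup E, x * y = y * x := by
    have hmul : ∀ x y : E, FreeGroup.of x * FreeGroup.of y = FreeGroup.of y * FreeGroup.of x :=
      fun x y => by rw [Subsingleton.elim x y]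
    have h : ∀ x : FreeGroup E, x ∈ Subgroup.closure (Set.range (FreeGroup.of (α := E))) := fun x => by
      rw [FreeGroup.closure_range_of]
      trivial
    intro x y
    refine Subgroup.closure_induction₂ (p := fun x y _ _ => Commute x y) ?_ ?_ ?_ ?_ ?_ ?_ ?_
      (h x) (h y)
    · rintro _ _ ⟨x, rfl⟩ ⟨y, rfl⟩
      exact hmul x y
    · exact fun x _ => Commute.one_left x
    · exact fun x _ => Commute.one_right x
    · exact fun x y z _ _ _ h1 h2 => h1.mul_left h2
    · exact fun x y z _ _ _ h1 h2 => h1.mul_right h2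
    · exact fun x y _ _ h1 => h1.inv_left
    · exact fun x y _ _ h1 => h1.inv_right
  set i : Fin N := ⟨0, by omega⟩
  set j : Fin N := ⟨1, by omega⟩
  have hij : i ≠ j := by simp [i, j]
  have h1 : FreeGroup.of i * FreeGroup.of j = FreeGroup.of j * FreeGroup.of i := by
    apply α.hom_injective
    rw [map_mul, map_mul, hcomm]
  have hred : ∀ x y : Fin N, x ≠ y → (FreeGroup.of x * FreeGroup.of y).toWord =
      [(x, true), (y, true)] := by
    intro x y hxy
    have h : FreeGroup.of x * FreeGroup.of y = FreeGroup.mk [(x, true), (y, true)] := rfl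
    rw [h, FreeGroup.toWord_mk, FreeGroup.IsReduced.reduce_eq]
    simp [FreeGroup.IsReduced]
  have h2 := congrArg FreeGroup.toWord h1
  rw [hred i j hij, hred j i hij.symm] at h2
  simp at h2
  exact hij h2.1

theorem exists_frequencies_current {N : ℕ} (hN : 2 ≤ N) {φ : Out (FreeGroup (Fin N))}
    {V E : Type*} [Finite V] [Finite E] [DecidableEq E] {Γ : EGraph V E} (α : Marking N Γ)
    (f : GraphMap Γ) (hf : IsPositiveTrainTrackRep α f φ) :
    ∃ a : List (E × Bool) → ℝ, HasLimitingFrequencies f a ∧ SwitchConditions Γ a ∧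
      ∃! μ : Measure (DoubleBoundary (Fin N)), IsGeodesicCurrent μ ∧ α.HasOccurrences μ a := by
  have := nontrivial_edges hN α
  obtain ⟨a, ha⟩ := GraphMap.exists_hasLimitingFrequencies hf.matrix_pos
  have hs := GraphMap.switchConditions hf.trainTrack hf.matrix_pos ha
  exact ⟨a, ha, hs, Marking.existsUnique_current hf.core hs⟩

end TrainTrack

theorem lemma3p5 {N : ℕ} (hN : 2 ≤ N) (φ : TrainTrack.Out (FreeGroup (Fin N)))
    {V E : Type*} [Finite V] [Finite E] [DecidableEq E] {Γ : TrainTrack.EGraph V E}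
    (α : TrainTrack.Marking N Γ) (f : TrainTrack.GraphMap Γ)
    (hf : TrainTrack.IsPositiveTrainTrackRep α f φ)
    {V' E' : Type*} [Finite V'] [Finite E'] [DecidableEq E'] {Γ' : TrainTrack.EGraph V' E'}
    (α' : TrainTrack.Marking N Γ') (f' : TrainTrack.GraphMap Γ')
    (hf' : TrainTrack.IsPositiveTrainTrackRep α' f' φ⁻¹) :
    (∃ a : List (E × Bool) → ℝ,
      TrainTrack.HasLimitingFrequencies f a ∧ TrainTrack.SwitchConditions Γ a ∧
      ∃! μ : Measure (TrainTrack.DoubleBoundary (Fin N)),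
        TrainTrack.IsGeodesicCurrent μ ∧ α.HasOccurrences μ a) ∧
    (∃ a : List (E' × Bool) → ℝ,
      TrainTrack.HasLimitingFrequencies f' a ∧ TrainTrack.SwitchConditions Γ' a ∧
      ∃! μ : Measure (TrainTrack.DoubleBoundary (Fin N)),
        TrainTrack.IsGeodesicCurrent μ ∧ α'.HasOccurrences μ a) := by
  exact ⟨TrainTrack.exists_frequencies_current hN α f hf,
    TrainTrack.exists_frequencies_current hN α' f' hf'⟩
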